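/- Let $n\ge 1$ and let $\mathbb{R}_n$ be the real Clifford algebra with imaginary units $e_1,\dots,e_n$, $e_i^2=-1$, $e_ie_j=-e_je_i$ for $i\ne j$, with basis $e_A$ ($A\subseteq\{1,\dots,n\}$), conjugation $\overline{s}=\sum_A(-1)^{|A|(|A|+1)/2}s_Ae_A$ and norm $|s|^2=\sum_A s_A^2$. Let $\mathbb{R}^{n+1}\subseteq\mathbb{R}_n$ be the paravectors $s=s_0+s_1e_1+\dots+s_ne_n$ and $\mathbb{S}=\{J\in\mathbb{R}^{n+1}: J_0=0,\ |J|=1\}$. For $\theta\in(0,\frac\pi2)$ put $I_\theta=(-\theta,\theta)\cup(\pi-\theta,\pi+\theta)$ and $D_\theta=\{te^{J\phi}: t>0,\ J\in\mathbb{S},\ \phi\in I_\theta\}$. **Functions.** $\mathcal{SH}_L(D_\theta)$ is the set of $f:D_\theta\to\mathbb{R}_n$ with $f(x+Jy)=f_0(x,y)+Jf_1(x,y)$ for all $J\in\mathbb{S}$, where $f_0,f_1$ are $\mathbb{R}_n$-valued, $C^1$, respectively even and odd in $y$, and satisfy $\partial_xf_0=\partial_yf_1$, $\partial_yf_0=-\partial_xf_1$;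 $\mathcal{N}(D_\theta)$ is the subset where $f_0,f_1$ can be chosen real valued. $\mathcal{SH}_L^0(D_\theta)$, $\mathcal{N}^0(D_\theta)$ are the bounded $f$ in these sets with $\int_0^\infty|f(te^{J\phi})|\frac{dt}{t}<\infty$ for all $J\in\mathbb{S}$, $\phi\in I_\theta$. $\mathcal{SH}_L^{\rm bnd}(D_\theta)$ (resp. $\mathcal{N}^{\rm bnd}(D_\theta)$) is the set of $f(s)=f_\infty+(1+s^2)^{-1}(f_0-f_\infty)+\widetilde f(s)$ with $f_0,f_\infty\in\mathbb{R}_n$ (resp. $\mathbb{R}$) and $\widetilde f\in\mathcal{SH}_L^0(D_\theta)$ (resp. $\mathcal{N}^0(D_\theta)$). **Operators.** Let $V=\{\sum_Av_A\otimes e_A\}$ be the Clifford module over a real Banach space, with $\|v\|^2=\sum_A\|v_A\|^2$ and the natural left and right multiplications by $\mathbb{R}_n$, and let $T$ be a closed right-linear operator in $V$ with two-sided linear domain. Put $Q_s[T]=T^2-2s_0T+|s|^2$ on $\operatorname{dom}(T^2)$, $\rho_S(T)=\{s\in\mathbb{R}^{n+1}: Q_s[T]^{-1}\in\mathcal{B}(V)\}$,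 $\sigma_S(T)=\mathbb{R}^{n+1}\setminus\rho_S(T)$ and $S_L^{-1}(s,T)=Q_s[T]^{-1}\overline{s}-TQ_s[T]^{-1}$. Assume that $T$ is bisectorial of angle $\omega\in(0,\frac\pi2)$: $\sigma_S(T)\subseteq\overline{D_\omega}$, and for every $\varphi\in(\omega,\frac\pi2)$ there is $C_\varphi\ge0$ with $\|S_L^{-1}(s,T)\|\le C_\varphi/|s|$ for all $s\in\mathbb{R}^{n+1}\setminus(D_\varphi\cup\{0\})$. Let $\theta\in(\omega,\frac\pi2)$. For $f\in\mathcal{SH}_L^{\rm bnd}(D_\theta)$, $J\in\mathbb{S}$ and $\varphi\in(\omega,\theta)$ let $$f(T)=f_\infty+(1+T^2)^{-1}(f_0-f_\infty)+\frac1{2\pi}\int_{\partial D_\varphi\cap\mathbb{C}_J}S_L^{-1}(s,T)\,ds_J\,\widetilde f(s),$$ where $ds_J=ds/J$ and $\partial D_\varphi\cap\mathbb{C}_J$ is positively oriented. A *regularizer* of $f\in\mathcal{SH}_L(D_\theta)$ is an $e\in\mathcal{N}^{\rm bnd}(D_\theta)$ such that $ef\in\mathcal{SH}_L^{\rm bnd}(D_\theta)$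 and $e(T)$ is injective (for every choice of $J$ and $\varphi$). If $f$ has a regularizer, it is called regularizable, $f\in\mathcal{SH}_L^{\rm reg}(D_\theta)$. **Proposition.** 1. Let $f\in\mathcal{SH}_L(D_\theta)$. Suppose that there are $r>0$ and $f_0\in\mathbb{R}_n$ with $\int_0^r|f(te^{J\phi})-f_0|\frac{dt}{t}<\infty$ for all $J\in\mathbb{S}$, $\phi\in I_\theta$, and $k\in\mathbb{N}_0$, $C\ge0$ with $|f(s)|\le C(1+|s|^k)$ for all $s\in D_\theta$. Then $f\in\mathcal{SH}_L^{\rm reg}(D_\theta)$, and $e(s)=(1+s^2)^{-k-1}$ is a regularizer of $f$. 2. Let $T$ be injective and $f\in\mathcal{SH}_L(D_\theta)$. Suppose that there are $k\in\mathbb{N}_0$, $C\ge0$ with $|f(s)|\le C(|s|^{-k}+|s|^k)$ for all $s\in D_\theta$. Then $f\in\mathcal{SH}_L^{\rm reg}(D_\theta)$, and $e(s)=s^{k+1}(1+s^2)^{-k-1}$ is a regularizer of $f$. In both cases the $H^\infty$-calculus operator $f(T)=e(T)^{-1}(ef)(T)$ obtained from this $e$ is therefore a well-defined (in general unbounded)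 operator with domain $\{v\in V: (ef)(T)v\in\operatorname{ran}(e(T))\}$, and $w=f(T)v$ if and only if $e(T)w=(ef)(T)v$. -/

import Mathlib

noncomputable section

namespace CliffordHInfty

open MeasureTheory Set
open scoped symmDiff

/-! ### The real Clifford algebra with `n` imaginary units -/

/-- The underlying space of the Clifford algebra `ℝ_n`: the coefficients `(s_A)` with respect to
the basis vectors `e_A`, where `A` runs over the subsets of `{1, …, n}` (written as increasing
lists). The norm is `|s|² = ∑_A s_A²`. -/
abbrev Cl (n : ℕ) : Type := EuclideanSpace ℝ (Finset (Fin n))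

/-- The sign in `e_A e_B = ± e_{A ∆ B}`: every pair `i ∈ A`, `j ∈ B` with `j < i` has to be swapped,
and every pair with `i = j` contributes `e_i² = -1`. -/
def sgn {n : ℕ} (A B : Finset (Fin n)) : ℝ := ∏ i ∈ A, ∏ j ∈ B, if j ≤ i then -1 else 1

/-- The basis vector `e_A`. -/
def e {n : ℕ} (A : Finset (Fin n)) : Cl n := EuclideanSpace.single A 1

/-- Bilinear extension of `e_A e_B = sgn A B • e_{A ∆ B}`: the coefficient at `C` collects the pairs
`(A, B)` with `A ∆ B = C`, that is `B = A ∆ C`. -/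
instance instMulCl (n : ℕ) : Mul (Cl n) :=
  ⟨fun s t => WithLp.toLp 2 fun C => ∑ A, sgn A (A ∆ C) * (s A * t (A ∆ C))⟩

instance instOneCl (n : ℕ) : One (Cl n) := ⟨e ∅⟩

theorem mul_coeff {n : ℕ} (s t : Cl n) (C : Finset (Fin n)) :
    (s * t) C = ∑ A, sgn A (A ∆ C) * (s A * t (A ∆ C)) := rfl

theorem one_coeff {n : ℕ} (C : Finset (Fin n)) :
    (1 : Cl n) C = if C = ∅ then 1 else 0 := by
  change (EuclideanSpace.single (∅ : Finset (Fin n)) (1 : ℝ)) C = _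
  simp

theorem prod_symmDiff {n : ℕ} (A B : Finset (Fin n)) (g : Fin n → ℝ) (hg : ∀ i, g i * g i = 1) :
    ∏ i ∈ A ∆ B, g i = (∏ i ∈ A, g i) * ∏ i ∈ B, g i := by
  have h (S : Finset (Fin n)) : ∏ i ∈ S, g i = ∏ i, if i ∈ S then g i else 1 := by
    rw [Finset.prod_ite_mem]; simp
  rw [h, h, h, ← Finset.prod_mul_distrib]
  refine Finset.prod_congr rfl fun i _ => ?_
  by_cases hA : i ∈ A <;> by_cases hB : i ∈ B <;> simp [Finset.mem_symmDiff, hA, hB, hg]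

theorem sgn_symmDiff_right {n : ℕ} (A B C : Finset (Fin n)) :
    sgn A (B ∆ C) = sgn A B * sgn A C := by
  unfold sgn
  rw [← Finset.prod_mul_distrib]
  refine Finset.prod_congr rfl fun i _ => prod_symmDiff _ _ _ fun j => ?_
  split_ifs <;> norm_num

theorem sgn_symmDiff_left {n : ℕ} (A B C : Finset (Fin n)) :
    sgn (A ∆ B) C = sgn A C * sgn B C := by
  unfold sgn
  refine prod_symmDiff _ _ _ fun i => ?_
  rw [← Finset.prod_mul_distrib]
  refine Finset.prod_eq_one fun j _ => ?_
  split_ifs <;> norm_num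

theorem mul_assoc' {n : ℕ} (s t u : Cl n) : s * t * u = s * (t * u) := by
  ext D
  simp only [mul_coeff, Finset.sum_mul, Finset.mul_sum]
  rw [Finset.sum_comm]
  refine Finset.sum_congr rfl fun A _ => ?_
  refine Fintype.sum_equiv (Function.Involutive.toPerm (fun B => A ∆ B)
    fun B => symmDiff_symmDiff_cancel_left A B) _ _ fun B => ?_
  change sgn B (B ∆ D) * (sgn A (A ∆ B) * (s A * t (A ∆ B)) * u (B ∆ D)) =
    sgn A (A ∆ D) * (s A * (sgn (A ∆ B) (A ∆ B ∆ (A ∆ D)) * (t (A ∆ B) * u (A ∆ B ∆ (A ∆ D)))))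
  have h1 : A ∆ B ∆ (A ∆ D) = B ∆ D := by
    rw [symmDiff_symmDiff_symmDiff_comm, symmDiff_self, bot_symmDiff]
  rw [h1]
  have h2 : sgn B (B ∆ D) = sgn A (B ∆ D) * sgn (A ∆ B) (B ∆ D) := by
    rw [← sgn_symmDiff_left, symmDiff_symmDiff_cancel_left]
  have h3 : sgn A (A ∆ D) = sgn A (A ∆ B) * sgn A (B ∆ D) := by
    rw [← sgn_symmDiff_right]
    congr 1
    rw [symmDiff_assoc, symmDiff_symmDiff_cancel_left]
  rw [h2, h3]
  ring

/-- The Clifford algebra `ℝ_n` is a ring (with the additive structure of the coefficient space). -/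
instance instRingCl (n : ℕ) : Ring (Cl n) :=
  { (inferInstance : AddCommGroup (Cl n)), instMulCl n, instOneCl n with
    left_distrib := fun a b c => by
      ext C; simp only [mul_coeff, PiLp.add_apply, mul_add, Finset.sum_add_distrib]
    right_distrib := fun a b c => by
      ext C; simp only [mul_coeff, PiLp.add_apply, mul_add, add_mul, Finset.sum_add_distrib]
    zero_mul := fun a => by ext C; simp [mul_coeff]
    mul_zero := fun a => by ext C; simp [mul_coeff]
    mul_assoc := mul_assoc'
    one_mul := fun a => by
      ext C
      rw [mul_coeff, Finset.sum_eq_single ∅]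
      · rw [one_coeff, ← Finset.bot_eq_empty, bot_symmDiff]; simp [sgn]
      · intro A _ hA; rw [one_coeff, if_neg hA]; simp
      · simp
    mul_one := fun a => by
      ext C
      rw [mul_coeff, Finset.sum_eq_single C]
      · rw [one_coeff, symmDiff_self]; simp [sgn]
      · intro A _ hA
        rw [one_coeff, if_neg]
        · simp
        · rw [← Finset.bot_eq_empty, symmDiff_eq_bot]; exact hA
      · simp }

/-- The Clifford conjugate. -/
def conj {n : ℕ} (s : Cl n) : Cl n :=
  WithLp.toLp 2 fun A => (-1) ^ (A.card * (A.card + 1) / 2) * s A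

/-- The paravectors `ℝ^{n+1} = {s_0 + s_1 e_1 + ⋯ + s_n e_n}`. The real part `s_0` of `s` is the
coefficient `s ∅`. -/
def paravectors (n : ℕ) : Set (Cl n) := {s | ∀ A : Finset (Fin n), 2 ≤ A.card → s A = 0}

/-- The sphere `𝕊` of imaginary units. -/
def sphere (n : ℕ) : Set (Cl n) := {J | J ∈ paravectors n ∧ J ∅ = 0 ∧ ‖J‖ = 1}

/-- `t e^{Jφ} = t cos φ + J t sin φ`. -/
def polar {n : ℕ} (J : Cl n) (t φ : ℝ) : Cl n :=
  (t * Real.cos φ) • (1 : Cl n) + (t * Real.sin φ) • J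

/-- `I_ω = (-ω, ω) ∪ (π - ω, π + ω)`. -/
def angles (ω : ℝ) : Set ℝ := Ioo (-ω) ω ∪ Ioo (Real.pi - ω) (Real.pi + ω)

/-- The double sector `D_ω` of all nonzero paravectors with argument in `I_ω`. -/
def doubleSector (n : ℕ) (ω : ℝ) : Set (Cl n) :=
  {s | ∃ J ∈ sphere n, ∃ t : ℝ, 0 < t ∧ ∃ φ ∈ angles ω, s = polar J t φ}

/-! ### Slice hyperholomorphic functions

A function on `U ⊆ ℝ^{n+1}` is given by a total function `Cl n → Cl n`, of which only the values
on `U` matter. -/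

/-- `{(x, y) ∈ ℝ² | x + 𝕊 y ⊆ U}`. -/
def planeSet {n : ℕ} (U : Set (Cl n)) : Set (ℝ × ℝ) :=
  {p | ∀ J ∈ sphere n, p.1 • (1 : Cl n) + p.2 • J ∈ U}

/-- `f(x + Jy) = f₀(x,y) + J f₁(x,y)` with continuously differentiable components which satisfy the
compatibility conditions and the Cauchy-Riemann equations. -/
structure IsLeftSlice {n : ℕ} (U : Set (Cl n)) (f : Cl n → Cl n) (f₀ f₁ : ℝ × ℝ → Cl n) :
    Prop where
  contDiffOn_fst : ContDiffOn ℝ 1 f₀ (planeSet U)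
  contDiffOn_snd : ContDiffOn ℝ 1 f₁ (planeSet U)
  repr : ∀ p ∈ planeSet U, ∀ J ∈ sphere n, f (p.1 • (1 : Cl n) + p.2 • J) = f₀ p + J * f₁ p
  even : ∀ p ∈ planeSet U, f₀ (p.1, -p.2) = f₀ p
  odd : ∀ p ∈ planeSet U, f₁ (p.1, -p.2) = -f₁ p
  cauchyRiemann_fst : ∀ p ∈ planeSet U, fderiv ℝ f₀ p (1, 0) = fderiv ℝ f₁ p (0, 1)
  cauchyRiemann_snd : ∀ p ∈ planeSet U, fderiv ℝ f₀ p (0, 1) = -fderiv ℝ f₁ p (1, 0)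

/-- The left slice hyperholomorphic functions `SH_L(U)`, for an open axially symmetric set `U` of
paravectors. -/
def SHL {n : ℕ} (U : Set (Cl n)) : Set (Cl n → Cl n) := {f | ∃ f₀ f₁, IsLeftSlice U f f₀ f₁}

/-- The intrinsic functions `N(U)`: the components `f₀`, `f₁` are real valued. -/
def Intrinsic {n : ℕ} (U : Set (Cl n)) : Set (Cl n → Cl n) :=
  {f | ∃ f₀ f₁, IsLeftSlice U f f₀ f₁ ∧
    ∀ p ∈ planeSet U, (∃ a : ℝ, f₀ p = a • (1 : Cl n)) ∧ ∃ b : ℝ, f₁ p = b • (1 : Cl n)}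

/-- `f` is bounded on `D_θ` and `∫_0^∞ |f(te^{Jφ})| dt/t < ∞` for all `J ∈ 𝕊`, `φ ∈ I_θ`. -/
def BoundedAndDini {n : ℕ} (θ : ℝ) (f : Cl n → Cl n) : Prop :=
  (∃ C : ℝ, ∀ s ∈ doubleSector n θ, ‖f s‖ ≤ C) ∧
    ∀ J ∈ sphere n, ∀ φ ∈ angles θ, IntegrableOn (fun t : ℝ => ‖f (polar J t φ)‖ / t) (Ioi 0)

/-- `SH_L^0(D_θ)`. -/
def SHLzero (n : ℕ) (θ : ℝ) : Set (Cl n → Cl n) :=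
  {f | f ∈ SHL (doubleSector n θ) ∧ BoundedAndDini θ f}

/-- `N^0(D_θ)`. -/
def Nzero (n : ℕ) (θ : ℝ) : Set (Cl n → Cl n) :=
  {f | f ∈ Intrinsic (doubleSector n θ) ∧ BoundedAndDini θ f}

/-- The remainder `f̃` in `f(s) = f_∞ + (1 + s²)⁻¹ (f_0 - f_∞) + f̃(s)`. -/
def remainder {n : ℕ} (f : Cl n → Cl n) (f0 finf : Cl n) : Cl n → Cl n :=
  fun s => f s - finf - Ring.inverse (1 + s ^ 2) * (f0 - finf)

/-- `SH_L^bnd(D_θ)`. -/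
def SHLbnd (n : ℕ) (θ : ℝ) : Set (Cl n → Cl n) :=
  {f | ∃ c : Cl n × Cl n, remainder f c.1 c.2 ∈ SHLzero n θ}

/-- `N^bnd(D_θ)`. -/
def Nbnd (n : ℕ) (θ : ℝ) : Set (Cl n → Cl n) :=
  {g | ∃ a b : ℝ, remainder g (a • (1 : Cl n)) (b • (1 : Cl n)) ∈ Nzero n θ}

/-! ### Clifford modules and operators -/

variable {n : ℕ} {E : Type*} [NormedAddCommGroup E] [NormedSpace ℝ E]

/-- The Clifford module `V = {∑_A v_A ⊗ e_A}` over the real Banach space `E`, given by its components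
`v_A`, with the norm `‖v‖² = ∑_A ‖v_A‖²`. -/
abbrev CMod (n : ℕ) (E : Type*) [NormedAddCommGroup E] [NormedSpace ℝ E] : Type _ :=
  PiLp 2 fun _ : Finset (Fin n) => E

/-- `v ↦ v ⊗ a`, for `a ∈ ℝ_n`. -/
def tensor (a : Cl n) : E →L[ℝ] CMod n E :=
  (PiLp.continuousLinearEquiv 2 ℝ (fun _ : Finset (Fin n) => E)).symm.toContinuousLinearMap ∘L
    ContinuousLinearMap.pi fun C => a C • ContinuousLinearMap.id ℝ E

/-- Left multiplication `v ↦ s v = ∑_{A,B} (s_B v_A) ⊗ (e_B e_A)`. -/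
def lmul (s : Cl n) : CMod n E →L[ℝ] CMod n E :=
  ∑ A, ∑ B, s B • (tensor (e B * e A) ∘L PiLp.proj 2 (fun _ : Finset (Fin n) => E) A)

/-- Right multiplication `v ↦ v s = ∑_{A,B} (v_A s_B) ⊗ (e_A e_B)`. -/
def rmul (s : Cl n) : CMod n E →L[ℝ] CMod n E :=
  ∑ A, ∑ B, s B • (tensor (e A * e B) ∘L PiLp.proj 2 (fun _ : Finset (Fin n) => E) A)

/-- `T ∈ K(V)`: a closed right-linear operator with two-sided linear domain. -/
structure IsClosedOperator (T : CMod n E →ₗ.[ℝ] CMod n E) : Prop where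
  lmul_mem : ∀ s : Cl n, ∀ v ∈ T.domain, lmul s v ∈ T.domain
  rmul_mem : ∀ s : Cl n, ∀ v ∈ T.domain, rmul s v ∈ T.domain
  right_linear : ∀ (s : Cl n) (v : T.domain), T ⟨rmul s v, rmul_mem s v v.2⟩ = rmul s (T v)
  closed : T.IsClosed

/-- `R` is the (everywhere defined, bounded) inverse of the operator `T² - 2aT + b` with domain
`dom(T²)`: for `v ∈ dom(T²)` one has `(T² - 2aT + b) v = w` exactly when `v = R w`. As the inverse of
a right-linear operator, such an `R` is right-linear if `T` is. -/
def IsQuadInverse (T : CMod n E →ₗ.[ℝ] CMod n E) (a b : ℝ) (R : CMod n E →L[ℝ] CMod n E) : Prop :=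
  ∀ v w : CMod n E,
    (∃ x y, (v, x) ∈ T.graph ∧ (x, y) ∈ T.graph ∧ y - (2 * a) • x + b • v = w) ↔ v = R w

open Classical in
/-- `(T² - 2aT + b)⁻¹`, if it exists in `B(V)` (the inverse is unique), and `0` otherwise. -/
def quadInv (T : CMod n E →ₗ.[ℝ] CMod n E) (a b : ℝ) : CMod n E →L[ℝ] CMod n E :=
  if h : ∃ R, IsQuadInverse T a b R then h.choose else 0

/-- The `S`-resolvent set, with `Q_s[T] = T² - 2 s_0 T + |s|²`. -/
def resolventSet (T : CMod n E →ₗ.[ℝ] CMod n E) : Set (Cl n) :=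
  {s | s ∈ paravectors n ∧ ∃ R, IsQuadInverse T (s ∅) (‖s‖ ^ 2) R}

/-- The `S`-spectrum. -/
def spectrumS (T : CMod n E →ₗ.[ℝ] CMod n E) : Set (Cl n) := paravectors n \ resolventSet T

open Classical in
/-- The product `T R` as a bounded operator, if it is one, and `0` otherwise. For `T` closed and `R`
bounded with range in `dom(T)` it always is one, by the closed graph theorem. -/
def opComp (T : CMod n E →ₗ.[ℝ] CMod n E) (R : CMod n E →L[ℝ] CMod n E) :
    CMod n E →L[ℝ] CMod n E :=
  if h : ∃ S : CMod n E →L[ℝ] CMod n E, ∀ v, (R v, S v) ∈ T.graph then h.choose else 0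

/-- The left `S`-resolvent operator `S_L⁻¹(s,T) = Q_s[T]⁻¹ s̄ - T Q_s[T]⁻¹`. -/
def resolventL (T : CMod n E →ₗ.[ℝ] CMod n E) (s : Cl n) : CMod n E →L[ℝ] CMod n E :=
  quadInv T (s ∅) (‖s‖ ^ 2) ∘L lmul (conj s) - opComp T (quadInv T (s ∅) (‖s‖ ^ 2))

/-- `T ∈ K(V)` is bisectorial of angle `ω`. -/
structure IsBisectorial (T : CMod n E →ₗ.[ℝ] CMod n E) (ω : ℝ) : Prop
    extends IsClosedOperator T where
  spectrum_subset : spectrumS T ⊆ closure (doubleSector n ω)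
  resolvent_bound : ∀ φ ∈ Ioo ω (Real.pi / 2), ∃ C : ℝ, 0 ≤ C ∧
    ∀ s ∈ paravectors n, s ∉ doubleSector n φ → s ≠ 0 → ‖resolventL T s‖ ≤ C / ‖s‖

/-! ### Functional calculi -/

/-- `∫ S_L⁻¹(s,T) ds_J f(s)` along the outgoing ray `s = t e^{Jψ}`, `0 < t < ∞`. Here
`ds_J = (e^{Jψ} / J) dt` and `1 / J = -J`. -/
def rayIntegral (T : CMod n E →ₗ.[ℝ] CMod n E) (J : Cl n) (ψ : ℝ) (f : Cl n → Cl n) :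
    CMod n E →L[ℝ] CMod n E :=
  ∫ t in Ioi (0 : ℝ),
    resolventL T (polar J t ψ) ∘L lmul (polar J 1 ψ * (-J) * f (polar J t ψ))

/-- The `ω`-functional calculus `f(T) = 1/(2π) ∫_{∂D_φ ∩ ℂ_J} S_L⁻¹(s,T) ds_J f(s)`, computed with
the imaginary unit `J` and the angle `φ`. The boundary of the double sector is positively oriented:
it comes in along the rays of angle `φ` and `π + φ`, and goes out along `-φ` and `π - φ`. -/
def omegaCalculus (T : CMod n E →ₗ.[ℝ] CMod n E) (J : Cl n) (φ : ℝ) (f : Cl n → Cl n) :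
    CMod n E →L[ℝ] CMod n E :=
  (1 / (2 * Real.pi)) •
    (rayIntegral T J (-φ) f - rayIntegral T J φ f
      + rayIntegral T J (Real.pi - φ) f - rayIntegral T J (Real.pi + φ) f)

open Classical in
/-- The extended `ω`-functional calculus `f(T) = f_∞ + (1 + T²)⁻¹ (f_0 - f_∞) + f̃(T)` of
`f ∈ SH_L^bnd(D_θ)`, with the (unique) coefficients of `f`. -/
def extCalculus (T : CMod n E →ₗ.[ℝ] CMod n E) (θ : ℝ) (J : Cl n) (φ : ℝ) (f : Cl n → Cl n) :
    CMod n E →L[ℝ] CMod n E :=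
  if h : f ∈ SHLbnd n θ then
    lmul h.choose.2 + quadInv T 0 1 ∘L lmul (h.choose.1 - h.choose.2)
      + omegaCalculus T J φ (remainder f h.choose.1 h.choose.2)
  else 0

/-- `g` is a regularizer of `f` on `D_θ`: `g ∈ N^bnd(D_θ)`, `gf ∈ SH_L^bnd(D_θ)` and `g(T)` is
injective (for `T` bisectorial of angle `ω`; `g(T)` may be computed with any `J ∈ 𝕊` and
`φ ∈ (ω, θ)`). -/
structure IsRegularizer (T : CMod n E →ₗ.[ℝ] CMod n E) (ω θ : ℝ) (g f : Cl n → Cl n) : Prop where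
  mem_Nbnd : g ∈ Nbnd n θ
  mul_mem : (fun s => g s * f s) ∈ SHLbnd n θ
  injective : ∀ J ∈ sphere n, ∀ φ ∈ Ioo ω θ, Function.Injective (extCalculus T θ J φ g)

/-- The regularizable functions `SH_L^reg(D_θ)`. -/
def SHLreg (T : CMod n E →ₗ.[ℝ] CMod n E) (ω θ : ℝ) : Set (Cl n → Cl n) :=
  {f | f ∈ SHL (doubleSector n θ) ∧ ∃ g, IsRegularizer T ω θ g f}

/-- The `H^∞`-functional calculus `f(T) = g(T)⁻¹ (gf)(T)`, computed with the regularizer `g`, on its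
domain `{v | (gf)(T) v ∈ ran g(T)}`. -/
def hInfty (T : CMod n E →ₗ.[ℝ] CMod n E) (θ : ℝ) (J : Cl n) (φ : ℝ) (g f : Cl n → Cl n) :
    CMod n E →ₗ.[ℝ] CMod n E :=
  let A : CMod n E →ₗ.[ℝ] CMod n E := (extCalculus T θ J φ g).toLinearMap.toPMap ⊤
  let B : CMod n E →ₗ[ℝ] CMod n E := (extCalculus T θ J φ fun s => g s * f s).toLinearMap
  A.inverse.comp (B.toPMap (A.inverse.domain.comap B)) fun v => v.2

/-- The function `(1 + s²)^{-k-1}`. -/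
def regInfinity {n : ℕ} (k : ℕ) : Cl n → Cl n := fun s => Ring.inverse ((1 + s ^ 2) ^ (k + 1))

/-- The function `s^{k+1} (1 + s²)^{-k-1}`. -/
def regZero {n : ℕ} (k : ℕ) : Cl n → Cl n :=
  fun s => s ^ (k + 1) * Ring.inverse ((1 + s ^ 2) ^ (k + 1))

end CliffordHInfty

end

noncomputable section

namespace CliffordHInfty

open MeasureTheory Set
open scoped symmDiff

/-! ### The planes `ℂ_J` in the Clifford algebra -/

/-! Everything rests on two operator identities. Put `R = (1 + T²)⁻¹` and `S = T R`. The contour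
integral defining the calculus gives `R ^ (k+1)` for `(1 + s²)^{-k-1}` and `S ^ (k+1)` for `s^{k+1}
(1 + s²)^{-k-1}`. An inverse is injective, and `S` is injective when `T` is, so both regularizers
have injective operators.

The identities come from scalar contour integrals, without a general product rule. For an intrinsic
function with complex symbol `g`, complex conjugate rays combine so that `J` disappears
(`omegaCalculus_eq_symbolOp`). A real functional `ℓ` then turns the operator into `1/π` times the
difference of the imaginary parts of `∫ r(z) g(z) dz` over the rays of angles `π - φ` and `φ`, where
`r(z) = z̄ ℓ(R_z) - ℓ(S_z)`, `R_z = (T² - 2 (Re z) T + |z|²)⁻¹` and `S_z = T R_z`. Formally `r(z)`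
is `ℓ((z - T)⁻¹)`, although no complex scalar acts on `V`. The relations between the operators
`R_z`, `S_z` make `r` holomorphic and show that replacing `ℓ` by `ℓ(R ·)` divides `r` by `1 + z²`,
up to `(a z + b) / (1 + z²)` with real `a`, `b`. This correction, multiplied by `g`, is holomorphic
in the sector and real on the real axis. Its rays can be turned onto the real axis, so it has no
imaginary part (`dual_symbolOp_eq_of_scalarRes_eq`). Hence multiplying `g` by `(1 + z²)⁻¹`
multiplies the operator by `R`, and multiplying `g` by `z (1 + z²)⁻¹` multiplies it by `S`. The base
case `z (1 + z²)⁻¹ ↦ S` is a contour rotation across the imaginary axis (`symbolOp_div_one_add_sq`),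
and induction gives the powers.

That `e f` lies in `SH_L^bnd` is a growth estimate based on `|1 + z²| ≥ cos θ (1 + |z|²)` in the
sector. At infinity the `k + 1` factors beat the growth of `f`. At `0` the Dini condition is
inherited from `f - f_0` in the first case and comes from the spare factor `s` in the second. The
coefficients `f_0`, `f_∞` are unique because `dt/t` is integrable neither at `0` nor at infinity. -/

theorem smul_mul_cl {n : ℕ} (a : ℝ) (s t : Cl n) : (a • s) * t = a • (s * t) := by
  ext C
  simp only [mul_coeff, PiLp.smul_apply, smul_eq_mul, Finset.mul_sum]
  exact Finset.sum_congr rfl fun A _ => by ring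

theorem mul_smul_cl {n : ℕ} (a : ℝ) (s t : Cl n) : s * (a • t) = a • (s * t) := by
  ext C
  simp only [mul_coeff, PiLp.smul_apply, smul_eq_mul, Finset.mul_sum]
  exact Finset.sum_congr rfl fun A _ => by ring

instance instAlgebraCl (n : ℕ) : Algebra ℝ (Cl n) := Algebra.ofModule smul_mul_cl mul_smul_cl

/-- The norm is not submultiplicative in general. There are `2^n` coefficients, each a sum of `2^n`
products bounded by `‖s‖ ‖t‖`; only the existence of a constant matters. -/
theorem norm_mul_cl_le {n : ℕ} (s t : Cl n) :
    ‖s * t‖ ≤ (2 ^ n * 2 ^ n : ℝ) * (‖s‖ * ‖t‖) := by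
  have h (C : Finset (Fin n)) : ‖(s * t) C‖ ≤ 2 ^ n * (‖s‖ * ‖t‖) := by
    rw [mul_coeff]
    refine (norm_sum_le _ _).trans
      ((Finset.sum_le_card_nsmul _ _ (‖s‖ * ‖t‖) fun A _ => ?_).trans ?_)
    · have h1 : ‖sgn A (A ∆ C)‖ = 1 := by
        unfold sgn
        rw [norm_prod]
        refine Finset.prod_eq_one fun i _ => ?_
        rw [norm_prod]
        refine Finset.prod_eq_one fun j _ => ?_
        split_ifs <;> simp
      rw [norm_mul, h1, one_mul, norm_mul]
      exact mul_le_mul (PiLp.norm_apply_le s A) (PiLp.norm_apply_le t _) (norm_nonneg _)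
        (norm_nonneg _)
    · simp
  have h2 : s * t = ∑ C, EuclideanSpace.single C ((s * t) C) := by
    ext D
    simp
  rw [h2]
  refine (norm_sum_le _ _).trans
    ((Finset.sum_le_card_nsmul _ _ (2 ^ n * (‖s‖ * ‖t‖)) fun A _ => ?_).trans ?_)
  · rw [PiLp.norm_single]
    exact h A
  · simp [mul_assoc]

/-- Multiplication in the Clifford algebra, as a bounded bilinear map. -/
def mulCL (n : ℕ) : Cl n →L[ℝ] Cl n →L[ℝ] Cl n :=
  (LinearMap.mul ℝ (Cl n)).mkContinuous₂ (2 ^ n * 2 ^ n) fun s t => by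
    simpa [mul_assoc] using norm_mul_cl_le s t

/-- Only singletons carry coefficients of `J`. The diagonal terms add up to `-‖J‖²`, and the mixed
terms cancel because the generators anticommute. -/
theorem sphere_sq {n : ℕ} {J : Cl n} (hJ : J ∈ sphere n) : J * J = -1 := by
  obtain ⟨hp, h0, h1⟩ := hJ
  have hcard (A : Finset (Fin n)) (hA : J A ≠ 0) : ∃ i, A = {i} := by
    rw [← Finset.card_eq_one]
    have h2 : ¬ 2 ≤ A.card := fun h => hA (hp A h)
    have h3 : A.card ≠ 0 := fun h => hA (by rw [Finset.card_eq_zero.1 h, h0])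
    omega
  have hnorm : ∑ A, J A * J A = 1 := by
    have := EuclideanSpace.norm_sq_eq J
    rw [h1] at this
    simp only [Real.norm_eq_abs, sq_abs] at this
    rw [← one_pow 2, this]
    exact Finset.sum_congr rfl fun A _ => (sq _).symm
  ext C
  rw [mul_coeff, PiLp.neg_apply, one_coeff]
  split_ifs with hC
  · subst hC
    rw [← hnorm, ← Finset.sum_neg_distrib]
    refine Finset.sum_congr rfl fun A _ => ?_
    rw [← Finset.bot_eq_empty, symmDiff_bot]
    by_cases hA : J A = 0
    · simp [hA]
    · obtain ⟨i, rfl⟩ := hcard A hA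
      simp [sgn]
  -- The substitution `A ↦ A ∆ C` exchanges the two factors, so the sum equals the one with reversed
  -- order in `sgn`. By anticommutation the two also add up to zero.
  · have hs : ∑ A, sgn A (A ∆ C) * (J A * J (A ∆ C)) =
        ∑ A, sgn (A ∆ C) A * (J A * J (A ∆ C)) := by
      refine Fintype.sum_equiv (Function.Involutive.toPerm (fun A => A ∆ C)
        fun A => symmDiff_symmDiff_cancel_right C A) _ _ fun A => ?_
      change _ = sgn (A ∆ C ∆ C) (A ∆ C) * (J (A ∆ C) * J (A ∆ C ∆ C))
      rw [symmDiff_symmDiff_cancel_right, mul_comm (J A)]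
    have hz : ∑ A, sgn A (A ∆ C) * (J A * J (A ∆ C)) +
        ∑ A, sgn (A ∆ C) A * (J A * J (A ∆ C)) = 0 := by
      rw [← Finset.sum_add_distrib]
      refine Finset.sum_eq_zero fun A _ => ?_
      by_cases hA : J A = 0
      · simp [hA]
      by_cases hB : J (A ∆ C) = 0
      · simp [hB]
      obtain ⟨i, hi⟩ := hcard _ hA
      obtain ⟨j, hj⟩ := hcard _ hB
      have hij : i ≠ j := by
        rintro rfl
        rw [← hj] at hi
        have := symmDiff_symmDiff_cancel_left A C
        rw [← hi, symmDiff_self] at this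
        exact hC this.symm
      rw [hj, hi]
      rcases lt_or_gt_of_ne hij with h | h
      · simp [sgn, h.le, h.not_ge]
      · simp [sgn, h.le, h.not_ge]
    rw [← hs] at hz
    simp only [neg_zero]
    linarith

/-- The embedding `x + iy ↦ x + Jy` of `ℂ` onto the plane `ℂ_J`. -/
def planeEmb {n : ℕ} (J : Cl n) (z : ℂ) : Cl n := z.re • (1 : Cl n) + z.im • J

theorem planeEmb_mul {n : ℕ} {J : Cl n} (hJ : J ∈ sphere n) (z w : ℂ) :
    planeEmb J (z * w) = planeEmb J z * planeEmb J w := by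
  simp only [planeEmb, Complex.mul_re, Complex.mul_im, add_mul, mul_add, smul_mul_assoc,
    mul_smul_comm, sphere_sq hJ, mul_one, one_mul]
  module

theorem planeEmb_add {n : ℕ} (J : Cl n) (z w : ℂ) :
    planeEmb J (z + w) = planeEmb J z + planeEmb J w := by
  simp only [planeEmb, Complex.add_re, Complex.add_im]
  module

theorem planeEmb_sub {n : ℕ} (J : Cl n) (z w : ℂ) :
    planeEmb J (z - w) = planeEmb J z - planeEmb J w := by
  simp only [planeEmb, Complex.sub_re, Complex.sub_im]
  module

theorem planeEmb_one {n : ℕ} (J : Cl n) : planeEmb J 1 = 1 := by simp [planeEmb]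

theorem planeEmb_pow {n : ℕ} {J : Cl n} (hJ : J ∈ sphere n) (z : ℂ) (k : ℕ) :
    planeEmb J (z ^ k) = planeEmb J z ^ k := by
  induction k with
  | zero => simp [planeEmb_one]
  | succ k ih => rw [pow_succ, pow_succ, planeEmb_mul hJ, ih]

theorem planeEmb_inv {n : ℕ} {J : Cl n} (hJ : J ∈ sphere n) {z : ℂ} (hz : z ≠ 0) :
    Ring.inverse (planeEmb J z) = planeEmb J z⁻¹ := by
  have h1 : planeEmb J z * planeEmb J z⁻¹ = 1 := by
    rw [← planeEmb_mul hJ, mul_inv_cancel₀ hz, planeEmb_one]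
  have h2 : planeEmb J z⁻¹ * planeEmb J z = 1 := by
    rw [← planeEmb_mul hJ, inv_mul_cancel₀ hz, planeEmb_one]
  exact Ring.inverse_unit (⟨_, _, h1, h2⟩ : (Cl n)ˣ)

theorem planeEmb_empty {n : ℕ} {J : Cl n} (hJ : J ∈ sphere n) (z : ℂ) :
    planeEmb J z ∅ = z.re := by
  simp [planeEmb, one_coeff, hJ.2.1]

theorem inner_one_sphere {n : ℕ} {J : Cl n} (hJ : J ∈ sphere n) : inner ℝ (1 : Cl n) J = 0 := by
  change inner ℝ (EuclideanSpace.single (∅ : Finset (Fin n)) (1 : ℝ)) J = 0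
  rw [EuclideanSpace.inner_single_left]
  simp [hJ.2.1]

theorem norm_one_cl {n : ℕ} : ‖(1 : Cl n)‖ = 1 := by
  change ‖(EuclideanSpace.single (∅ : Finset (Fin n)) (1 : ℝ))‖ = 1
  simp

theorem norm_planeEmb {n : ℕ} {J : Cl n} (hJ : J ∈ sphere n) (z : ℂ) : ‖planeEmb J z‖ = ‖z‖ := by
  rw [← sq_eq_sq₀ (norm_nonneg _) (norm_nonneg _), planeEmb, norm_add_sq_real, norm_smul,
    norm_smul, inner_smul_left, inner_smul_right, inner_one_sphere hJ, norm_one_cl, hJ.2.2,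
    Complex.sq_norm, Complex.normSq_apply]
  simp [sq]

theorem planeEmb_mem_paravectors {n : ℕ} {J : Cl n} (hJ : J ∈ sphere n) (z : ℂ) :
    planeEmb J z ∈ paravectors n := by
  intro A hA
  have : A ≠ ∅ := by rintro rfl; simp at hA
  simp [planeEmb, one_coeff, this, hJ.1 A hA]

theorem conj_planeEmb {n : ℕ} {J : Cl n} (hJ : J ∈ sphere n) (z : ℂ) :
    conj (planeEmb J z) = planeEmb J (starRingEnd ℂ z) := by
  ext A
  simp only [conj, planeEmb, Complex.conj_re, Complex.conj_im, PiLp.add_apply, PiLp.smul_apply,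
    one_coeff, smul_eq_mul]
  rcases Nat.lt_or_ge A.card 2 with h | h
  · interval_cases hc : A.card
    · rw [Finset.card_eq_zero] at hc
      simp [hc, hJ.2.1]
    · have : A ≠ ∅ := by rintro rfl; simp at hc
      simp [this]
  · have : A ≠ ∅ := by rintro rfl; simp at h
    simp [this, hJ.1 A h]

theorem polar_eq_planeEmb {n : ℕ} (J : Cl n) (t ψ : ℝ) :
    polar J t ψ = planeEmb J (t * Complex.exp (ψ * Complex.I)) := by
  simp [polar, planeEmb, Complex.exp_ofReal_mul_I_re, Complex.exp_ofReal_mul_I_im]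

theorem sphere_nonempty {n : ℕ} (hn : 1 ≤ n) : (sphere n).Nonempty := by
  refine ⟨e {⟨0, hn⟩}, fun A hA => ?_, ?_, ?_⟩
  · have : A ≠ {⟨0, hn⟩} := by rintro rfl; simp at hA
    simp [e, this]
  · simp [e]
  · simp [e]

/-! ### Double sectors as inequalities between real part and norm. -/

theorem norm_re_gt_of_mem_doubleSector {n : ℕ} {ω : ℝ} (hω : 0 < ω) (hω2 : ω < Real.pi / 2)
    {s : Cl n} (hs : s ∈ doubleSector n ω) : Real.cos ω * ‖s‖ < |s ∅| := by
  obtain ⟨J, hJ, t, ht, φ, hφ, rfl⟩ := hs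
  have hn : ‖polar J t φ‖ = t := by
    rw [polar_eq_planeEmb, norm_planeEmb hJ, norm_mul, Complex.norm_exp_ofReal_mul_I]
    simp [ht.le]
  have h0 : polar J t φ ∅ = t * Real.cos φ := by simp [polar, one_coeff, hJ.2.1]
  have hlt (ψ : ℝ) (h : |ψ| < ω) : Real.cos ω < Real.cos ψ := by
    rw [← Real.cos_abs ψ]
    exact Real.cos_lt_cos_of_nonneg_of_le_pi (abs_nonneg _) (by linarith) h
  have hc : Real.cos ω < |Real.cos φ| := by
    rcases hφ with h | h
    · exact (hlt φ (abs_lt.2 h)).trans_le (le_abs_self _)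
    · have := hlt (φ - Real.pi) (abs_lt.2 ⟨by linarith [h.1], by linarith [h.2]⟩)
      rw [Real.cos_sub_pi] at this
      exact this.trans_le (neg_le_abs _)
  rw [hn, h0, abs_mul, abs_of_pos ht, mul_comm]
  exact mul_lt_mul_of_pos_left hc ht

theorem norm_re_ge_of_mem_closure {n : ℕ} {ω : ℝ} (hω : 0 < ω) (hω2 : ω < Real.pi / 2)
    {s : Cl n} (hs : s ∈ closure (doubleSector n ω)) : Real.cos ω * ‖s‖ ≤ |s ∅| := by
  have hc : IsClosed {s : Cl n | Real.cos ω * ‖s‖ ≤ |s ∅|} :=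
    isClosed_le (by fun_prop) (by fun_prop)
  exact closure_minimal (fun x hx => (norm_re_gt_of_mem_doubleSector hω hω2 hx).le) hc hs

theorem planeEmb_mem_doubleSector {n : ℕ} {ω : ℝ} (hω : 0 < ω)
    {J : Cl n} (hJ : J ∈ sphere n) {z : ℂ} (hz : Real.cos ω * ‖z‖ < |z.re|) :
    planeEmb J z ∈ doubleSector n ω := by
  have hz0 : z ≠ 0 := by rintro rfl; simp at hz
  have hpos : 0 < ‖z‖ := norm_pos_iff.2 hz0
  have key (w : ℂ) (hw : Real.cos ω * ‖w‖ < w.re) : |w.arg| < ω := by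
    have hw0 : w ≠ 0 := by rintro rfl; simp at hw
    by_contra! h
    have := Real.cos_le_cos_of_nonneg_of_le_pi hω.le (Complex.abs_arg_le_pi w) h
    rw [Real.cos_abs, Complex.cos_arg hw0, div_le_iff₀ (norm_pos_iff.2 hw0)] at this
    linarith
  rcases le_or_gt 0 z.re with h | h
  · rw [abs_of_nonneg h] at hz
    refine ⟨J, hJ, ‖z‖, hpos, z.arg, Or.inl (abs_lt.1 (key z hz)), ?_⟩
    rw [polar_eq_planeEmb, Complex.norm_mul_exp_arg_mul_I]
  -- In the left half plane the argument is measured from `-z`, so that the angle `π + arg(-z)`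
  -- falls into the second interval of `angles`.
  · rw [abs_of_neg h] at hz
    have h1 := abs_lt.1 (key (-z) (by simpa using hz))
    refine ⟨J, hJ, ‖z‖, hpos, Real.pi + (-z).arg, Or.inr ⟨by linarith [h1.1], by linarith [h1.2]⟩, ?_⟩
    rw [polar_eq_planeEmb]
    have := Complex.norm_mul_exp_arg_mul_I (-z)
    rw [norm_neg] at this
    push_cast
    rw [add_mul, Complex.exp_add, Complex.exp_pi_mul_I, mul_left_comm, this]
    simp

theorem mem_planeSet_iff {n : ℕ} (hn : 1 ≤ n) {ω : ℝ} (hω : 0 < ω) (hω2 : ω < Real.pi / 2)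
    (p : ℝ × ℝ) :
    p ∈ planeSet (doubleSector n ω) ↔ Real.cos ω * ‖(⟨p.1, p.2⟩ : ℂ)‖ < |p.1| := by
  constructor
  · intro h
    obtain ⟨J, hJ⟩ := sphere_nonempty hn
    have := norm_re_gt_of_mem_doubleSector hω hω2 (h J hJ)
    have he : p.1 • (1 : Cl n) + p.2 • J = planeEmb J ⟨p.1, p.2⟩ := rfl
    rwa [he, norm_planeEmb hJ, planeEmb_empty hJ] at this
  · intro h J hJ
    exact planeEmb_mem_doubleSector hω hJ h

theorem isOpen_planeSet {n : ℕ} (hn : 1 ≤ n) {ω : ℝ} (hω : 0 < ω) (hω2 : ω < Real.pi / 2) :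
    IsOpen (planeSet (doubleSector n ω)) := by
  have he : planeSet (doubleSector n ω) =
      {p : ℝ × ℝ | Real.cos ω * ‖Complex.equivRealProdCLM.symm p‖ < |p.1|} := by
    ext p
    exact mem_planeSet_iff hn hω hω2 p
  rw [he]
  exact isOpen_lt (by fun_prop) (by fun_prop)

end CliffordHInfty
end

noncomputable section

namespace CliffordHInfty

open MeasureTheory Set
variable {n : ℕ} {E : Type*} [NormedAddCommGroup E] [NormedSpace ℝ E]

/-! ### Left multiplication -/

theorem sum_coeff_smul_e (s : Cl n) : ∑ A, s A • e A = s := by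
  ext D
  simp [e, Finset.sum_apply, Pi.single_apply]

theorem lmul_apply_coeff (s : Cl n) (v : CMod n E) (C : Finset (Fin n)) :
    lmul s v C = ∑ A, (s * e A) C • v A := by
  have h (A : Finset (Fin n)) : (s * e A) C = ∑ B, s B * (e B * e A) C := by
    conv_lhs => rw [← sum_coeff_smul_e s, Finset.sum_mul]
    simp
  simp only [lmul, tensor, h, Finset.sum_smul]
  simp [mul_smul]

theorem lmul_mul (s t : Cl n) : lmul (E := E) (s * t) = lmul s ∘L lmul t := by
  ext v C
  rw [ContinuousLinearMap.comp_apply, lmul_apply_coeff, lmul_apply_coeff]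
  simp only [lmul_apply_coeff, Finset.smul_sum, smul_smul]
  rw [Finset.sum_comm]
  refine Finset.sum_congr rfl fun B _ => ?_
  rw [← Finset.sum_smul]
  congr 1
  rw [mul_assoc]
  conv_lhs => rw [← sum_coeff_smul_e (t * e B), Finset.mul_sum]
  simp [mul_comm]

theorem lmul_add (s t : Cl n) : lmul (E := E) (s + t) = lmul s + lmul t := by
  ext v C
  simp [lmul_apply_coeff, add_mul, add_smul, Finset.sum_add_distrib]

theorem lmul_smul (a : ℝ) (s : Cl n) : lmul (E := E) (a • s) = a • lmul s := by
  ext v C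
  simp [lmul_apply_coeff, mul_smul, Finset.smul_sum]

theorem lmul_one : lmul (E := E) (1 : Cl n) = 1 := by
  ext v C
  simp [lmul_apply_coeff, e]

theorem lmul_zero : lmul (E := E) (0 : Cl n) = 0 := by
  ext v C
  simp [lmul_apply_coeff]

theorem lmul_planeEmb (J : Cl n) (z : ℂ) :
    lmul (E := E) (planeEmb J z) = z.re • 1 + z.im • lmul J := by
  rw [planeEmb, lmul_add, lmul_smul, lmul_smul, lmul_one]

theorem lmul_sphere_sq {J : Cl n} (hJ : J ∈ sphere n) :
    lmul (E := E) J * lmul J = -1 := by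
  change lmul J ∘L lmul J = _
  rw [← lmul_mul, sphere_sq hJ, ← neg_one_smul ℝ (1 : Cl n), lmul_smul, lmul_one]
  ext v C
  simp

/-! ### Algebraic relations between pseudo-resolvents -/

/-- `R = (T² - 2aT + b)⁻¹` and `S = T R` as bounded operators, through the graph of `T`. -/
structure IsQuadPair (T : CMod n E →ₗ.[ℝ] CMod n E) (a b : ℝ) (R S : CMod n E →L[ℝ] CMod n E) :
    Prop where
  inv : IsQuadInverse T a b R
  graph_fst : ∀ v, (R v, S v) ∈ T.graph
  graph_snd : ∀ v, (S v, v + (2 * a) • S v - b • R v) ∈ T.graph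

theorem graph_snd_unique {T : CMod n E →ₗ.[ℝ] CMod n E} {v x y : CMod n E}
    (hx : (v, x) ∈ T.graph) (hy : (v, y) ∈ T.graph) : x = y :=
  LinearPMap.mem_graph_snd_inj T hx hy rfl

theorem IsQuadInverse.unique {T : CMod n E →ₗ.[ℝ] CMod n E} {a b : ℝ}
    {R R' : CMod n E →L[ℝ] CMod n E} (h : IsQuadInverse T a b R) (h' : IsQuadInverse T a b R') :
    R = R' := by
  ext1 v
  exact (h' _ _).1 ((h _ _).2 rfl)

theorem IsQuadInverse.injective {T : CMod n E →ₗ.[ℝ] CMod n E} {a b : ℝ}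
    {R : CMod n E →L[ℝ] CMod n E} (h : IsQuadInverse T a b R) : Function.Injective R := by
  intro v w hvw
  obtain ⟨x, y, hx, hy, hv⟩ := (h _ _).2 (rfl : R v = R v)
  obtain ⟨x', y', hx', hy', hw⟩ := (h _ _).2 hvw
  obtain rfl := graph_snd_unique hx hx'
  obtain rfl := graph_snd_unique hy hy'
  rw [← hv, ← hw]

/-- The range of `R` lies in `dom(T²)`, so `T R` is everywhere defined. Its graph is a preimage of
the closed graph of `T`, and the closed graph theorem makes it bounded. -/
theorem IsQuadInverse.exists_pair [CompleteSpace E] {T : CMod n E →ₗ.[ℝ] CMod n E}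
    (hT : T.IsClosed) {a b : ℝ} {R : CMod n E →L[ℝ] CMod n E} (h : IsQuadInverse T a b R) :
    IsQuadPair T a b (quadInv T a b) (opComp T (quadInv T a b)) := by
  have hR : quadInv T a b = R := by
    have hex : ∃ R, IsQuadInverse T a b R := ⟨R, h⟩
    rw [quadInv, dif_pos hex]
    exact hex.choose_spec.unique h
  rw [hR]
  have hdom (v : CMod n E) : R v ∈ T.domain := by
    obtain ⟨x, y, hx, -, -⟩ := (h _ _).2 (rfl : R v = R v)
    exact LinearPMap.mem_domain_of_mem_graph hx
  let S₀ : CMod n E →ₗ[ℝ] CMod n E :=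
    T.toFun ∘ₗ LinearMap.codRestrict T.domain R.toLinearMap hdom
  have hS₀ (v) : (R v, S₀ v) ∈ T.graph := T.mem_graph ⟨R v, hdom v⟩
  have hclosed : IsClosed (S₀.graph : Set (CMod n E × CMod n E)) := by
    have : (S₀.graph : Set (CMod n E × CMod n E)) =
        (fun p : CMod n E × CMod n E => (R p.1, p.2)) ⁻¹' (T.graph : Set _) := by
      ext p
      simp only [SetLike.mem_coe, LinearMap.mem_graph_iff, mem_preimage]
      exact ⟨fun hp => hp ▸ hS₀ p.1, fun hp => graph_snd_unique hp (hS₀ _)⟩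
    rw [this]
    exact IsClosed.preimage (by fun_prop) hT
  let S : CMod n E →L[ℝ] CMod n E := ⟨S₀, S₀.continuous_of_isClosed_graph hclosed⟩
  have hex : ∃ S : CMod n E →L[ℝ] CMod n E, ∀ v, (R v, S v) ∈ T.graph := ⟨S, hS₀⟩
  have hg : ∀ v, (R v, opComp T R v) ∈ T.graph := by
    rw [opComp, dif_pos hex]
    exact hex.choose_spec
  refine ⟨h, hg, fun v => ?_⟩
  obtain ⟨x, y, hx, hy, hv⟩ := (h _ _).2 (rfl : R v = R v)
  obtain rfl := graph_snd_unique hx (hg v)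
  have : v + (2 * a) • opComp T R v - b • R v = y := by
    nth_rw 1 [← hv]
    abel
  rwa [this]

namespace IsQuadPair

variable {T : CMod n E →ₗ.[ℝ] CMod n E} {a b a' b' : ℝ} {R S R' S' : CMod n E →L[ℝ] CMod n E}

/-- `R` commutes with `T` on `dom(T)`: for `x = T v`, the vector `S v = T R v` lies in `dom(T²)` and
solves the quadratic equation with right-hand side `x`. -/
theorem apply_fst_of_mem_graph (h : IsQuadPair T a b R S) {v x : CMod n E}
    (hx : (v, x) ∈ T.graph) : R x = S v := by
  refine ((h.inv (S v) x).1 ⟨v + (2 * a) • S v - b • R v,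
    x + (2 * a) • (v + (2 * a) • S v - b • R v) - b • S v, h.graph_snd v, ?_, by abel⟩).symm
  have := T.graph.sub_mem (T.graph.add_mem hx (T.graph.smul_mem (2 * a) (h.graph_snd v)))
    (T.graph.smul_mem b (h.graph_fst v))
  simpa using this

theorem apply_snd_of_mem_graph (h : IsQuadPair T a b R S) {v x : CMod n E}
    (hx : (v, x) ∈ T.graph) : S x = v + (2 * a) • S v - b • R v := by
  refine graph_snd_unique (h.graph_fst x) ?_
  rw [h.apply_fst_of_mem_graph hx]
  exact h.graph_snd v

theorem snd_mul_fst (h : IsQuadPair T a b R S) (h' : IsQuadPair T a' b' R' S') :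
    S * R' = R * S' := by
  ext1 v
  exact (h.apply_fst_of_mem_graph (h'.graph_fst v)).symm

/-- With `Q = T² - 2aT + b` and `Q'` formed from `a'`, `b'`, one has `Q = Q' + 2(a' - a) T + (b -
b')`. Apply this to `R'` and multiply by `R` from the left; applying `T` to the result gives
`resolvent_snd`. -/
theorem resolvent_fst (h : IsQuadPair T a b R S) (h' : IsQuadPair T a' b' R' S') :
    R' = R + (b - b') • (R * R') + (2 * (a' - a)) • (R * S') := by
  ext1 v
  have := (h.inv (R' v) _).1 ⟨S' v, v + (2 * a') • S' v - b' • R' v, h'.graph_fst v,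
    h'.graph_snd v, rfl⟩
  rw [this]
  simp only [map_add, map_sub, map_smul, add_apply,
    smul_apply, mul_apply_eq_comp]
  module

theorem resolvent_snd (h : IsQuadPair T a b R S) (h' : IsQuadPair T a' b' R' S') :
    S' = S + (b - b') • (R * S') + (2 * (a' - a)) • (S * S') := by
  ext1 v
  have h1 := h.graph_fst (v + (b - b') • R' v + (2 * (a' - a)) • S' v)
  have h2 : R (v + (b - b') • R' v + (2 * (a' - a)) • S' v) = R' v := by
    have := congrArg (fun X : CMod n E →L[ℝ] CMod n E => X v) (h.resolvent_fst h')
    simp only [add_apply, smul_apply,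
      mul_apply_eq_comp] at this
    simp only [map_add, map_smul]
    exact this.symm
  rw [h2] at h1
  rw [graph_snd_unique (h'.graph_fst v) h1, ← h.snd_mul_fst h']
  simp

theorem snd_mul_snd (h : IsQuadPair T a b R S) (h' : IsQuadPair T a' b' R' S') :
    S * S' = R' + (2 * a) • (R * S') - b • (R * R') := by
  ext1 v
  rw [← h.snd_mul_fst h']
  exact h.apply_snd_of_mem_graph (h'.graph_fst v)

end IsQuadPair

/-! ### Pseudo-resolvents in a Banach algebra -/

/-- Two families `R z = (T² - 2 (Re z) T + |z|²)⁻¹` and `S z = T R z` in a Banach algebra, on an open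
set of complex parameters, described by the relations they satisfy. -/
structure IsPseudoResolvent {𝔅 : Type*} [NormedRing 𝔅] [NormedAlgebra ℝ 𝔅] (Ω : Set ℂ)
    (R S : ℂ → 𝔅) : Prop where
  isOpen : IsOpen Ω
  snd_mul_fst : ∀ w ∈ Ω, ∀ z ∈ Ω, S w * R z = R w * S z
  snd_mul_snd : ∀ w ∈ Ω, ∀ z ∈ Ω,
    S w * S z = R z + (2 * w.re) • (R w * S z) - (‖w‖ ^ 2) • (R w * R z)
  resolvent_fst : ∀ w ∈ Ω, ∀ z ∈ Ω,
    R z = R w + (‖w‖ ^ 2 - ‖z‖ ^ 2) • (R w * R z) + (2 * (z.re - w.re)) • (R w * S z)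
  resolvent_snd : ∀ w ∈ Ω, ∀ z ∈ Ω,
    S z = S w + (‖w‖ ^ 2 - ‖z‖ ^ 2) • (R w * S z) + (2 * (z.re - w.re)) • (S w * S z)

/-- The nonzero complex numbers outside the closed double sector of angle `ω`. -/
def sectorCompl (ω : ℝ) : Set ℂ := {z | |z.re| < Real.cos ω * ‖z‖}

theorem isOpen_sectorCompl (ω : ℝ) : IsOpen (sectorCompl ω) :=
  isOpen_lt (by fun_prop) (by fun_prop)

/-! ### Resolvents and resolvent bounds of a bisectorial operator. -/

theorem isQuadPair_of_mem_sectorCompl [CompleteSpace E] (hn : 1 ≤ n)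
    {T : CMod n E →ₗ.[ℝ] CMod n E} {ω : ℝ} (hω : 0 < ω) (hω2 : ω < Real.pi / 2)
    (hT : IsBisectorial T ω) {z : ℂ} (hz : z ∈ sectorCompl ω) :
    IsQuadPair T z.re (‖z‖ ^ 2) (quadInv T z.re (‖z‖ ^ 2))
      (opComp T (quadInv T z.re (‖z‖ ^ 2))) := by
  obtain ⟨J, hJ⟩ := sphere_nonempty hn
  have hr : planeEmb J z ∈ resolventSet T := by
    by_contra h
    have h1 := norm_re_ge_of_mem_closure hω hω2
      (hT.spectrum_subset ⟨planeEmb_mem_paravectors hJ z, h⟩)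
    rw [norm_planeEmb hJ, planeEmb_empty hJ] at h1
    exact absurd hz (not_lt.2 h1)
  obtain ⟨-, R, hR⟩ := hr
  rw [norm_planeEmb hJ, planeEmb_empty hJ] at hR
  exact hR.exists_pair hT.closed

theorem isPseudoResolvent_quadInv [CompleteSpace E] (hn : 1 ≤ n)
    {T : CMod n E →ₗ.[ℝ] CMod n E} {ω : ℝ} (hω : 0 < ω) (hω2 : ω < Real.pi / 2)
    (hT : IsBisectorial T ω) :
    IsPseudoResolvent (sectorCompl ω) (fun z => quadInv T z.re (‖z‖ ^ 2))
      (fun z => opComp T (quadInv T z.re (‖z‖ ^ 2))) where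
  isOpen := isOpen_sectorCompl ω
  snd_mul_fst _ hw _ hz := (isQuadPair_of_mem_sectorCompl hn hω hω2 hT hw).snd_mul_fst
    (isQuadPair_of_mem_sectorCompl hn hω hω2 hT hz)
  snd_mul_snd _ hw _ hz := (isQuadPair_of_mem_sectorCompl hn hω hω2 hT hw).snd_mul_snd
    (isQuadPair_of_mem_sectorCompl hn hω hω2 hT hz)
  resolvent_fst _ hw _ hz := (isQuadPair_of_mem_sectorCompl hn hω hω2 hT hw).resolvent_fst
    (isQuadPair_of_mem_sectorCompl hn hω hω2 hT hz)
  resolvent_snd _ hw _ hz := (isQuadPair_of_mem_sectorCompl hn hω hω2 hT hw).resolvent_snd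
    (isQuadPair_of_mem_sectorCompl hn hω hω2 hT hz)

theorem resolventL_planeEmb (T : CMod n E →ₗ.[ℝ] CMod n E) {J : Cl n} (hJ : J ∈ sphere n) (z : ℂ) :
    resolventL T (planeEmb J z) =
      z.re • quadInv T z.re (‖z‖ ^ 2) - z.im • (quadInv T z.re (‖z‖ ^ 2) * lmul J)
        - opComp T (quadInv T z.re (‖z‖ ^ 2)) := by
  rw [resolventL, planeEmb_empty hJ, norm_planeEmb hJ, conj_planeEmb hJ, lmul_planeEmb]
  congr 1
  ext1 v
  simp [sub_eq_add_neg]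

/-- The `S`-resolvents at `s` and at its conjugate differ by `-2y R j`. Since `j` is invertible and
`|y|` is comparable to `r`, this controls `R`; then `S` is what remains of one `S`-resolvent. -/
theorem norm_le_of_conjugate_bounds {𝔅 : Type*} [NormedRing 𝔅] [NormedAlgebra ℝ 𝔅] {j : 𝔅}
    (hj : j * j = -1) {R S : 𝔅} {x y r C σ : ℝ} (hr : 0 < r) (hσ : 0 < σ) (hx : |x| ≤ r)
    (hy : |y| ≤ r) (hy' : σ * r ≤ |y|)
    (h₁ : ‖x • R - y • (R * j) - S‖ ≤ C / r) (h₂ : ‖x • R - -y • (R * j) - S‖ ≤ C / r) :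
    ‖R‖ ≤ (C * ‖j‖ / σ) / r ^ 2 ∧ ‖S‖ ≤ (C * ‖j‖ / σ * (1 + ‖j‖) + C) / r := by
  have hRj : (2 * y) • R = ((x • R - y • (R * j) - S) - (x • R - -y • (R * j) - S)) * j := by
    have : (x • R - y • (R * j) - S) - (x • R - -y • (R * j) - S) = -(2 * y) • (R * j) := by
      module
    rw [this, smul_mul_assoc, mul_assoc, hj]
    simp
  have hR1 : 2 * |y| * ‖R‖ ≤ (C / r + C / r) * ‖j‖ := by
    calc 2 * |y| * ‖R‖ = ‖(2 * y) • R‖ := by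
          rw [norm_smul, Real.norm_eq_abs, abs_mul, abs_two]
      _ ≤ _ := by
          rw [hRj]
          refine (norm_mul_le _ _).trans (mul_le_mul_of_nonneg_right ?_ (norm_nonneg _))
          exact (norm_sub_le _ _).trans (add_le_add h₁ h₂)
  have hR2 : ‖R‖ ≤ (C * ‖j‖ / σ) / r ^ 2 := by
    have h1 : σ * r * ‖R‖ ≤ C / r * ‖j‖ := by
      refine (mul_le_mul_of_nonneg_right hy' (norm_nonneg R)).trans ?_
      linarith
    have h2 : (C * ‖j‖ / σ) / r ^ 2 = (C / r * ‖j‖) / (σ * r) := by field_simp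
    rw [h2, le_div_iff₀ (by positivity), mul_comm]
    exact h1
  refine ⟨hR2, ?_⟩
  set D := C * ‖j‖ / σ
  have hSe : S = x • R - y • (R * j) - (x • R - y • (R * j) - S) := by abel
  have h3 : ‖x • R‖ ≤ r * (D / r ^ 2) := by
    rw [norm_smul]
    exact mul_le_mul hx hR2 (norm_nonneg _) hr.le
  have h4 : ‖y • (R * j)‖ ≤ r * (D / r ^ 2 * ‖j‖) := by
    rw [norm_smul]
    refine mul_le_mul hy ?_ (norm_nonneg _) hr.le
    exact (norm_mul_le _ _).trans (mul_le_mul_of_nonneg_right hR2 (norm_nonneg _))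
  calc ‖S‖ ≤ ‖x • R‖ + ‖y • (R * j)‖ + C / r := by
        nth_rw 1 [hSe]
        exact (norm_sub_le _ _).trans (add_le_add (norm_sub_le _ _) h₁)
    _ ≤ r * (D / r ^ 2) + r * (D / r ^ 2 * ‖j‖) + C / r := by gcongr
    _ = _ := by field_simp

theorem sin_mul_norm_le_abs_im {φ : ℝ} (hφ : 0 ≤ φ) (hφ2 : φ ≤ Real.pi / 2) {z : ℂ}
    (hr : |z.re| ≤ Real.cos φ * ‖z‖) : Real.sin φ * ‖z‖ ≤ |z.im| := by
  have hsin : 0 ≤ Real.sin φ := Real.sin_nonneg_of_nonneg_of_le_pi hφ (by linarith [Real.pi_pos])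
  refine (sq_le_sq₀ (by positivity) (abs_nonneg _)).1 ?_
  have h1 : z.re ^ 2 ≤ (Real.cos φ * ‖z‖) ^ 2 := by
    rw [← sq_abs]
    exact pow_le_pow_left₀ (abs_nonneg _) hr 2
  have h2 : ‖z‖ ^ 2 = z.re ^ 2 + z.im ^ 2 := by
    rw [Complex.sq_norm, Complex.normSq_apply]; ring
  have h3 := Real.sin_sq_add_cos_sq φ
  rw [sq_abs]
  have h4 : (Real.sin φ * ‖z‖) ^ 2 = (1 - Real.cos φ ^ 2) * ‖z‖ ^ 2 := by
    rw [← h3]; ring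
  rw [h4]
  nlinarith

theorem norm_resolventL_planeEmb_le {T : CMod n E →ₗ.[ℝ] CMod n E} {φ C : ℝ} (hφ0 : 0 < φ)
    (hφ : φ < Real.pi / 2)
    (hb : ∀ s ∈ paravectors n, s ∉ doubleSector n φ → s ≠ 0 → ‖resolventL T s‖ ≤ C / ‖s‖)
    {J : Cl n} (hJ : J ∈ sphere n) {z : ℂ} (hz : z ≠ 0) (hr : |z.re| ≤ Real.cos φ * ‖z‖) :
    ‖resolventL T (planeEmb J z)‖ ≤ C / ‖z‖ := by
  have := hb (planeEmb J z) (planeEmb_mem_paravectors hJ z) (fun h => by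
    have := norm_re_gt_of_mem_doubleSector hφ0 hφ h
    rw [norm_planeEmb hJ, planeEmb_empty hJ] at this
    linarith) (fun h => by
    have := norm_planeEmb hJ z
    rw [h, norm_zero] at this
    exact hz (norm_eq_zero.1 this.symm))
  rwa [norm_planeEmb hJ] at this

theorem exists_bound_quadInv (hn : 1 ≤ n) {T : CMod n E →ₗ.[ℝ] CMod n E} {ω φ : ℝ} (hω : 0 < ω)
    (hωφ : ω < φ) (hφ : φ < Real.pi / 2) (hT : IsBisectorial T ω) :
    ∃ C : ℝ, 0 ≤ C ∧ ∀ z : ℂ, z ≠ 0 → |z.re| ≤ Real.cos φ * ‖z‖ →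
      ‖quadInv T z.re (‖z‖ ^ 2)‖ ≤ C / ‖z‖ ^ 2 ∧
      ‖opComp T (quadInv T z.re (‖z‖ ^ 2))‖ ≤ C / ‖z‖ := by
  obtain ⟨J, hJ⟩ := sphere_nonempty hn
  obtain ⟨C, hC, hb⟩ := hT.resolvent_bound φ ⟨hωφ, hφ⟩
  have hφ0 : 0 < φ := hω.trans hωφ
  have hsin : 0 < Real.sin φ := Real.sin_pos_of_pos_of_lt_pi hφ0 (by linarith [Real.pi_pos])
  obtain ⟨L, hL, hLe⟩ : ∃ L : ℝ, 0 ≤ L ∧ L = ‖lmul (E := E) J‖ := ⟨_, norm_nonneg _, rfl⟩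
  obtain ⟨D, hD, hDe⟩ : ∃ D : ℝ, 0 ≤ D ∧ D = C * L / Real.sin φ := ⟨_, by positivity, rfl⟩
  have hDL : 0 ≤ D * (1 + L) := by positivity
  refine ⟨D + (D * (1 + L) + C), by linarith, fun z hz hr => ?_⟩
  have hz' : 0 < ‖z‖ := norm_pos_iff.2 hz
  have hz1 := norm_resolventL_planeEmb_le hφ0 hφ hb hJ hz hr
  -- `R` and `S` depend only on `Re z` and `|z|`, so they are the same at the conjugate of `z`, and
  -- the assumed estimate is available at both points.
  have hz2 := norm_resolventL_planeEmb_le hφ0 hφ hb hJ (z := starRingEnd ℂ z) (by simpa using hz)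
    (by simpa using hr)
  rw [resolventL_planeEmb T hJ] at hz1 hz2
  rw [Complex.conj_re, Complex.conj_im, Complex.norm_conj] at hz2
  have := norm_le_of_conjugate_bounds (lmul_sphere_sq hJ) hz' hsin (Complex.abs_re_le_norm z)
    (Complex.abs_im_le_norm z) (sin_mul_norm_le_abs_im hφ0.le hφ.le hr) hz1 hz2
  rw [← hLe, ← hDe] at this
  exact ⟨this.1.trans (div_le_div_of_nonneg_right (by linarith) (by positivity)),
    this.2.trans (div_le_div_of_nonneg_right (by linarith) hz'.le)⟩

end CliffordHInfty
end

noncomputable section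

namespace CliffordHInfty

open MeasureTheory Set

/-! ### Integrals of holomorphic functions along rays -/

/-- The complex number `t e^{iψ}`. -/
def cpolar (t ψ : ℝ) : ℂ := t * Complex.exp (ψ * Complex.I)

theorem norm_cpolar {t : ℝ} (ht : 0 ≤ t) (ψ : ℝ) : ‖cpolar t ψ‖ = t := by
  rw [cpolar, norm_mul, Complex.norm_exp_ofReal_mul_I, mul_one, Complex.norm_real,
    Real.norm_of_nonneg ht]

theorem cpolar_re (t ψ : ℝ) : (cpolar t ψ).re = t * Real.cos ψ := by
  simp [cpolar, Complex.exp_ofReal_mul_I_re]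

theorem cpolar_im (t ψ : ℝ) : (cpolar t ψ).im = t * Real.sin ψ := by
  simp [cpolar, Complex.exp_ofReal_mul_I_im]

theorem continuous_cpolar (ψ : ℝ) : Continuous fun t : ℝ => cpolar t ψ := by
  unfold cpolar; fun_prop

theorem exp_pi_sub_mul_I (φ : ℝ) : Complex.exp ((Real.pi - φ : ℝ) * Complex.I) =
    -starRingEnd ℂ (Complex.exp (φ * Complex.I)) := by
  rw [← Complex.exp_conj, map_mul, Complex.conj_ofReal, Complex.conj_I]
  push_cast
  rw [sub_mul, sub_eq_add_neg, Complex.exp_add, Complex.exp_pi_mul_I]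
  simp

theorem cpolar_pi_sub (t φ : ℝ) : cpolar t (Real.pi - φ) = -starRingEnd ℂ (cpolar t φ) := by
  rw [cpolar, exp_pi_sub_mul_I, cpolar, map_mul, Complex.conj_ofReal, mul_neg]

theorem abs_cos_pi_sub (φ : ℝ) : |Real.cos (Real.pi - φ)| = |Real.cos φ| := by
  rw [Real.cos_pi_sub, abs_neg]

/-- `∫ h(z) dz` along the outgoing ray of angle `ψ`. -/
def rayInt (h : ℂ → ℂ) (ψ : ℝ) : ℂ :=
  ∫ t in Ioi (0 : ℝ), h (cpolar t ψ) * Complex.exp (ψ * Complex.I)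

theorem integrableOn_inv_one_add_sq (s : Set ℝ) (C : ℝ) :
    IntegrableOn (fun t : ℝ => C / (1 + t ^ 2)) s := by
  simpa [div_eq_mul_inv] using (integrable_inv_one_add_sq.const_mul C).integrableOn

/-- The interval `[1/2, 2]` is exempt from the bound: the integrands used below may have poles on
the unit circle, where continuity along the ray has to suffice. -/
theorem integrableOn_Ioi_of_norm_le {F : Type*} [NormedAddCommGroup F] {f : ℝ → F} {C : ℝ}
    (hf : ContinuousOn f (Ioi 0))
    (hb : ∀ t, 0 < t → t ∉ Icc (1 / 2 : ℝ) 2 → ‖f t‖ ≤ C / (1 + t ^ 2)) :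
    IntegrableOn f (Ioi 0) := by
  have hu : Ioi (0 : ℝ) = Icc (1 / 2) 2 ∪ (Ioi 0 \ Icc (1 / 2) 2) := by
    rw [union_sdiff_cancel]
    exact fun t ht => lt_of_lt_of_le (by norm_num) ht.1
  rw [hu]
  refine IntegrableOn.union ?_ ?_
  · exact (hf.mono fun t ht => lt_of_lt_of_le (by norm_num) ht.1).integrableOn_Icc
  · refine Integrable.mono' (integrableOn_inv_one_add_sq _ C) ?_ ?_
    · exact (hf.mono sdiff_subset).aestronglyMeasurable (measurableSet_Ioi.diff measurableSet_Icc)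
    · exact (ae_restrict_iff' (measurableSet_Ioi.diff measurableSet_Icc)).2
        (Filter.Eventually.of_forall fun t ht => hb t ht.1 ht.2)

theorem integrableOn_ray {h : ℂ → ℂ} {ψ C : ℝ}
    (hd : ∀ t, 0 < t → ContinuousAt h (cpolar t ψ))
    (hb : ∀ t, 0 < t → t ∉ Icc (1 / 2 : ℝ) 2 → ‖h (cpolar t ψ)‖ ≤ C / (1 + t ^ 2)) :
    IntegrableOn (fun t => h (cpolar t ψ) * Complex.exp (ψ * Complex.I)) (Ioi 0) := by
  refine integrableOn_Ioi_of_norm_le (C := C) (fun t ht => ?_) fun t ht ht' => ?_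
  · refine ContinuousAt.continuousWithinAt (ContinuousAt.mul ?_ continuousAt_const)
    exact ContinuousAt.comp (f := fun t => cpolar t ψ) (hd t ht) (continuous_cpolar ψ).continuousAt
  · rw [norm_mul, Complex.norm_exp_ofReal_mul_I, mul_one]
    exact hb t ht ht'

theorem integral_Ioi_eq_integral_exp (f : ℝ → ℂ) :
    ∫ t in Ioi (0 : ℝ), f t = ∫ x : ℝ, (Real.exp x : ℂ) * f (Real.exp x) := by
  have := integral_image_eq_integral_abs_deriv_smul (s := univ) (f := Real.exp) (f' := Real.exp)
    MeasurableSet.univ (fun x _ => (Real.hasDerivAt_exp x).hasDerivWithinAt)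
    Real.exp_injective.injOn f
  rw [image_univ, Real.range_exp] at this
  rw [this, setIntegral_univ]
  simp [abs_of_pos (Real.exp_pos _)]

theorem integrable_exp_of_integrableOn_Ioi {f : ℝ → ℂ} (hf : IntegrableOn f (Ioi 0)) :
    Integrable fun x : ℝ => (Real.exp x : ℂ) * f (Real.exp x) := by
  have := integrableOn_image_iff_integrableOn_abs_deriv_smul (s := univ) (f := Real.exp)
    (f' := Real.exp) MeasurableSet.univ (fun x _ => (Real.hasDerivAt_exp x).hasDerivWithinAt)
    Real.exp_injective.injOn f
  rw [image_univ, Real.range_exp, integrableOn_univ] at this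
  simpa [abs_of_pos (Real.exp_pos _)] using this.1 hf

theorem cexp_eq_cpolar (x ψ : ℝ) :
    Complex.exp (x + ψ * Complex.I) = cpolar (Real.exp x) ψ := by
  rw [Complex.exp_add, cpolar, Complex.ofReal_exp]

/-- A ray may be rotated through a sector in which the integrand is holomorphic and decays. -/
theorem rayInt_eq_rayInt {h : ℂ → ℂ} {α β C : ℝ} (hαβ : α ≤ β)
    (hd : ∀ t, 0 < t → ∀ ψ ∈ Icc α β, DifferentiableAt ℂ h (cpolar t ψ))
    (hb : ∀ t, 0 < t → t ∉ Icc (1 / 2 : ℝ) 2 → ∀ ψ ∈ Icc α β,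
      ‖h (cpolar t ψ)‖ ≤ C / (1 + t ^ 2)) :
    rayInt h α = rayInt h β := by
  -- In the coordinate `w = log z` rays become horizontal lines and the sector a strip, so Cauchy's
  -- theorem for rectangles applies.
  set H : ℂ → ℂ := fun w => h (Complex.exp w) * Complex.exp w with hH
  have hC : 0 ≤ C := by
    have := (norm_nonneg _).trans (hb 3 (by norm_num) (by norm_num) α ⟨le_rfl, hαβ⟩)
    by_contra! hC
    exact absurd this (not_le.2 (div_neg_of_neg_of_pos hC (by norm_num)))
  have hray (ψ : ℝ) : rayInt h ψ = ∫ x : ℝ, H (x + ψ * Complex.I) := by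
    rw [rayInt, integral_Ioi_eq_integral_exp]
    refine integral_congr_ae (Filter.Eventually.of_forall fun x => ?_)
    simp only [hH, cexp_eq_cpolar]
    rw [cpolar]
    ring
  have hint (ψ : ℝ) (hψ : ψ ∈ Icc α β) : Integrable fun x : ℝ => H (x + ψ * Complex.I) := by
    refine (integrable_exp_of_integrableOn_Ioi (integrableOn_ray (h := h) (ψ := ψ) (C := C)
      (fun t ht => (hd t ht ψ hψ).continuousAt) fun t ht ht' => hb t ht ht' ψ hψ)).congr
      (Filter.Eventually.of_forall fun x => ?_)
    simp only [hH, cexp_eq_cpolar]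
    rw [cpolar]
    ring
  have hlim (ψ : ℝ) (hψ : ψ ∈ Icc α β) : Filter.Tendsto
      (fun R : ℝ => ∫ x in (-R)..R, H (x + ψ * Complex.I)) Filter.atTop (nhds (rayInt h ψ)) := by
    rw [hray]
    exact intervalIntegral_tendsto_integral (hint ψ hψ) Filter.tendsto_neg_atTop_atBot
      Filter.tendsto_id
  -- The factor `e^R` from `dz = e^w dw` against `1 / (1 + e^{2R})` leaves `e^{-|R|}` at both ends.
  -- As `e > 2`, the condition `1 ≤ |R|` puts `e^R` outside the exempt interval.
  have hside (R : ℝ) (hR : 1 ≤ |R|) :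
      ‖∫ y in α..β, H (R + y * Complex.I)‖ ≤ C * Real.exp (-|R|) * |β - α| := by
    refine intervalIntegral.norm_integral_le_of_norm_le_const fun y hy => ?_
    rw [uIoc_of_le hαβ] at hy
    have he := Real.exp_pos R
    have h2 : (2 : ℝ) < Real.exp 1 := by linarith [Real.exp_one_gt_d9]
    have hRn : Real.exp R ∉ Icc (1 / 2 : ℝ) 2 := by
      rintro ⟨h3, h4⟩
      rcases le_abs'.1 hR with h | h
      · have h5 := Real.exp_le_exp.2 h
        rw [Real.exp_neg] at h5
        have : (Real.exp 1)⁻¹ < 2⁻¹ := inv_strictAnti₀ (by norm_num) h2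
        linarith
      · have h5 := Real.exp_le_exp.2 h
        linarith
    have h1 := hb _ he hRn y ⟨hy.1.le, hy.2⟩
    simp only [hH, cexp_eq_cpolar]
    rw [norm_mul, norm_cpolar he.le]
    refine (mul_le_mul_of_nonneg_right h1 he.le).trans ?_
    rw [div_mul_eq_mul_div, mul_div_assoc]
    refine mul_le_mul_of_nonneg_left ?_ hC
    rw [div_le_iff₀ (by positivity)]
    rcases le_total 0 R with h | h
    · rw [abs_of_nonneg h, Real.exp_neg]
      have : (Real.exp R)⁻¹ * (1 + Real.exp R ^ 2) = (Real.exp R)⁻¹ + Real.exp R := by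
        field_simp
      rw [this]
      linarith [inv_pos.2 he]
    · rw [abs_of_nonpos h, neg_neg]
      nlinarith [pow_pos he 3]
  have hzero (s : ℝ) (hs : |s| = 1) : Filter.Tendsto
      (fun R : ℝ => ∫ y in α..β, H (((s * R : ℝ) : ℂ) + y * Complex.I)) Filter.atTop (nhds 0) := by
    have h0 : Filter.Tendsto (fun R : ℝ => C * Real.exp (-R) * |β - α|) Filter.atTop (nhds 0) := by
      have := ((Real.tendsto_exp_neg_atTop_nhds_zero).const_mul C).mul_const |β - α|
      simpa using this
    refine squeeze_zero_norm' ?_ h0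
    filter_upwards [Filter.eventually_ge_atTop (1 : ℝ)] with R hR
    have hR' : |s * R| = R := by rw [abs_mul, hs, one_mul, abs_of_nonneg (by linarith)]
    have := hside (s * R) (by rw [hR']; exact hR)
    rwa [hR'] at this
  have hrect (R : ℝ) : (∫ x in (-R)..R, H (x + α * Complex.I)) -
      (∫ x in (-R)..R, H (x + β * Complex.I)) +
      Complex.I • (∫ y in α..β, H (((1 * R : ℝ) : ℂ) + y * Complex.I)) -
      Complex.I • (∫ y in α..β, H (((-1 * R : ℝ) : ℂ) + y * Complex.I)) = 0 := by
    have := Complex.integral_boundary_rect_eq_zero_of_differentiableOn H ⟨-R, α⟩ ⟨R, β⟩ ?_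
    · simpa using this
    · intro w hw
      rw [uIcc_of_le hαβ] at hw
      have hw2 : w.im ∈ Icc α β := hw.2
      have hwe : Complex.exp w = cpolar (Real.exp w.re) w.im := by
        rw [← cexp_eq_cpolar, Complex.re_add_im]
      have h1 := hd _ (Real.exp_pos w.re) w.im hw2
      rw [← hwe] at h1
      exact ((h1.comp w Complex.differentiableAt_exp).mul
        Complex.differentiableAt_exp).differentiableWithinAt
  have hl := (((hlim α ⟨le_rfl, hαβ⟩).sub (hlim β ⟨hαβ, le_rfl⟩)).add
    ((hzero 1 (by simp)).const_smul Complex.I)).sub ((hzero (-1) (by simp)).const_smul Complex.I)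
  simp only [hrect] at hl
  have := tendsto_nhds_unique hl tendsto_const_nhds
  simpa [sub_eq_zero] using this

/-- The closed double sector of angle `φ` around the real axis. -/
def csector (φ : ℝ) : Set ℂ := {z | Real.cos φ * ‖z‖ ≤ |z.re|}

theorem cpolar_mem_csector {t φ ψ : ℝ} (ht : 0 ≤ t) (h : Real.cos φ ≤ |Real.cos ψ|) :
    cpolar t ψ ∈ csector φ := by
  rw [csector, mem_ofPred_eq, norm_cpolar ht, cpolar_re, abs_mul, abs_of_nonneg ht, mul_comm]
  exact mul_le_mul_of_nonneg_left h ht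

/-- The rays are turned inside the sector onto the positive and the negative real axis, where
integrand and direction are both real. -/
theorem im_rayInt_eq_zero {h : ℂ → ℂ} {φ C : ℝ} (hφ : 0 ≤ φ) (hφ2 : φ < Real.pi / 2)
    (hd : ∀ z : ℂ, z.re ≠ 0 → DifferentiableAt ℂ h z)
    (hc : ∀ z, h (starRingEnd ℂ z) = starRingEnd ℂ (h z))
    (hb : ∀ z ∈ csector φ, ‖h z‖ ≤ C / (1 + ‖z‖ ^ 2)) :
    (rayInt h φ).im = 0 ∧ (rayInt h (Real.pi - φ)).im = 0 := by
  have hreal (ψ : ℝ) (hψ : Complex.exp (ψ * Complex.I) =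
      starRingEnd ℂ (Complex.exp (ψ * Complex.I))) : (rayInt h ψ).im = 0 := by
    rw [← Complex.conj_eq_iff_im, rayInt, ← integral_conj]
    refine integral_congr_ae (Filter.Eventually.of_forall fun t => ?_)
    simp only [map_mul, ← hc, ← hψ]
    rw [cpolar, map_mul, Complex.conj_ofReal, ← hψ]
  have hcos (ψ : ℝ) (h0 : 0 ≤ ψ) (h1 : ψ ≤ φ) : Real.cos φ ≤ Real.cos ψ ∧ 0 < Real.cos ψ :=
    ⟨Real.cos_le_cos_of_nonneg_of_le_pi h0 (by linarith) h1,
      Real.cos_pos_of_mem_Ioo ⟨by linarith, by linarith⟩⟩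
  have key (α β : ℝ) (hαβ : α ≤ β)
      (hs : ∀ ψ ∈ Icc α β, Real.cos φ ≤ |Real.cos ψ| ∧ Real.cos ψ ≠ 0) :
      rayInt h α = rayInt h β := by
    refine rayInt_eq_rayInt (C := C) hαβ (fun t ht ψ hψ => hd _ ?_) fun t ht _ ψ hψ => ?_
    · rw [cpolar_re]
      exact mul_ne_zero ht.ne' (hs ψ hψ).2
    · have := hb _ (cpolar_mem_csector ht.le (hs ψ hψ).1)
      rwa [norm_cpolar ht.le] at this
  constructor
  · rw [← key 0 φ hφ fun ψ hψ => ?_]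
    · exact hreal 0 (by simp)
    · have := hcos ψ hψ.1 hψ.2
      exact ⟨this.1.trans (le_abs_self _), this.2.ne'⟩
  · rw [key (Real.pi - φ) Real.pi (by linarith) fun ψ hψ => ?_]
    · exact hreal Real.pi (by simp)
    · have := hcos (Real.pi - ψ) (by linarith [hψ.2]) (by linarith [hψ.1])
      rw [Real.cos_pi_sub] at this
      exact ⟨this.1.trans (neg_le_abs _), by linarith [this.2]⟩

/-! ### Estimates and integrals of explicit rational functions. -/

theorem norm_one_sub_ge {r : ℝ} (hr : 0 < r) (hr' : r ∉ Icc (1 / 2 : ℝ) 2) {w : ℂ}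
    (hw : ‖w‖ = r ^ 2) : (1 + r ^ 2) / 2 ≤ ‖1 - w‖ := by
  rw [mem_Icc, not_and_or, not_le, not_le] at hr'
  rcases hr' with h | h
  · have h1 := norm_sub_norm_le (1 : ℂ) w
    rw [norm_one, hw] at h1
    nlinarith
  · have h1 := norm_sub_norm_le w (1 : ℂ)
    rw [norm_one, hw, norm_sub_rev] at h1
    nlinarith

theorem norm_one_sub_pow_four_ge {r : ℝ} (hr : 0 < r) (hr' : r ∉ Icc (1 / 2 : ℝ) 2) {w : ℂ}
    (hw : ‖w‖ = r) : (1 + r ^ 2) ^ 2 / 4 ≤ ‖1 - w ^ 4‖ := by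
  have h1 := norm_one_sub_ge hr hr' (w := w ^ 2) (by rw [norm_pow, hw])
  have h2 := norm_one_sub_ge hr hr' (w := -w ^ 2) (by rw [norm_neg, norm_pow, hw])
  have : (1 : ℂ) - w ^ 4 = (1 - w ^ 2) * (1 - -w ^ 2) := by ring
  rw [this, norm_mul]
  calc (1 + r ^ 2) ^ 2 / 4 = (1 + r ^ 2) / 2 * ((1 + r ^ 2) / 2) := by ring
    _ ≤ _ := mul_le_mul h1 h2 (by positivity) (norm_nonneg _)

theorem norm_div_one_sub_pow_four_le {r : ℝ} (hr : 0 < r) (hr' : r ∉ Icc (1 / 2 : ℝ) 2) {w : ℂ}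
    (hw : ‖w‖ = r) : ‖2 * w / (1 - w ^ 4)‖ ≤ 4 / (1 + r ^ 2) := by
  have h1 := norm_one_sub_pow_four_ge hr hr' hw
  have h2 : 0 < ‖1 - w ^ 4‖ := lt_of_lt_of_le (by positivity) h1
  rw [norm_div, norm_mul, hw, div_le_div_iff₀ h2 (by positivity), Complex.norm_ofNat]
  have h3 : (1 + r ^ 2) * (1 + r ^ 2 - 2 * r) ≥ 0 :=
    mul_nonneg (by positivity) (by nlinarith [sq_nonneg (r - 1)])
  nlinarith

theorem one_sub_pow_four_ne_zero {z : ℂ} (hr : z.re ≠ 0) (hi : z.im ≠ 0) : 1 - z ^ 4 ≠ 0 := by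
  have h : (1 : ℂ) - z ^ 4 = (1 - z ^ 2) * (1 + z ^ 2) := by ring
  have him : (z ^ 2).im = 2 * (z.re * z.im) := by rw [sq, Complex.mul_im]; ring
  have h0 : z.re * z.im ≠ 0 := mul_ne_zero hr hi
  rw [h]
  refine mul_ne_zero (fun h1 => ?_) fun h1 => ?_
  · have := congrArg Complex.im h1
    rw [Complex.sub_im, him] at this
    simp at this
    exact this.elim hr hi
  · have := congrArg Complex.im h1
    rw [Complex.add_im, him] at this
    simp at this
    exact this.elim hr hi

theorem integral_Ioi_two_mul_div :
    ∫ t in Ioi (0 : ℝ), 2 * t / (1 + t ^ 4) = Real.pi / 2 := by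
  have h1 := integral_comp_rpow_Ioi_of_pos (g := fun y : ℝ => (1 + y ^ 2)⁻¹) (p := 2) (by norm_num)
  rw [integral_Ioi_inv_one_add_sq, Real.arctan_zero, sub_zero] at h1
  rw [← h1]
  refine setIntegral_congr_fun measurableSet_Ioi fun t _ => ?_
  norm_num
  rw [← pow_mul, div_eq_mul_inv]

/-- Within the open first quadrant the ray can be turned to the angle `π/4`, since the poles `±1`,
`±i` lie on the axes. There `z⁴ = -t⁴` and the integrand is `i` times a real one. -/
theorem rayInt_two_mul_div {φ : ℝ} (hφ : 0 < φ) (hφ2 : φ < Real.pi / 2) :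
    rayInt (fun z => 2 * z / (1 - z ^ 4)) φ = (Real.pi / 2 : ℝ) * Complex.I := by
  have key (α β : ℝ) (hαβ : α ≤ β) (hα : 0 < α) (hβ : β < Real.pi / 2) :
      rayInt (fun z => 2 * z / (1 - z ^ 4)) α = rayInt (fun z => 2 * z / (1 - z ^ 4)) β := by
    refine rayInt_eq_rayInt (C := 4) hαβ (fun t ht ψ hψ => ?_) fun t ht ht' ψ hψ => ?_
    · refine DifferentiableAt.div (by fun_prop) (by fun_prop) (one_sub_pow_four_ne_zero ?_ ?_)
      · rw [cpolar_re]
        exact mul_ne_zero ht.ne' (Real.cos_pos_of_mem_Ioo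
          ⟨by linarith [hψ.1], by linarith [hψ.2]⟩).ne'
      · rw [cpolar_im]
        exact mul_ne_zero ht.ne' (Real.sin_pos_of_pos_of_lt_pi (by linarith [hψ.1])
          (by linarith [hψ.2])).ne'
    · exact norm_div_one_sub_pow_four_le ht ht' (norm_cpolar ht.le ψ)
  have hpi := Real.pi_pos
  have hq : rayInt (fun z => 2 * z / (1 - z ^ 4)) φ =
      rayInt (fun z => 2 * z / (1 - z ^ 4)) (Real.pi / 4) := by
    rcases le_total φ (Real.pi / 4) with h | h
    · exact key _ _ h hφ (by linarith)
    · exact (key _ _ h (by linarith) hφ2).symm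
  rw [hq, rayInt, ← integral_Ioi_two_mul_div, ← integral_complex_ofReal, ← integral_mul_const]
  refine setIntegral_congr_fun measurableSet_Ioi fun t _ => ?_
  set u := Complex.exp ((Real.pi / 4 : ℝ) * Complex.I) with hu
  have hu2 : u ^ 2 = Complex.I := by
    rw [hu, ← Complex.exp_nat_mul]
    refine Eq.trans (congrArg Complex.exp ?_) Complex.exp_pi_div_two_mul_I
    push_cast
    ring
  have hu4 : u ^ 4 = -1 := by
    rw [show u ^ 4 = (u ^ 2) ^ 2 by ring, hu2, Complex.I_sq]
  simp only [cpolar, ← hu, mul_pow, hu4]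
  push_cast
  rw [← hu2]
  ring

theorem rayInt_pi_sub {h : ℂ → ℂ} (hh : ∀ z, h (-starRingEnd ℂ z) = -starRingEnd ℂ (h z)) (φ : ℝ) :
    rayInt h (Real.pi - φ) = starRingEnd ℂ (rayInt h φ) := by
  rw [rayInt, rayInt, ← integral_conj]
  refine integral_congr_ae (Filter.Eventually.of_forall fun t => ?_)
  simp only [cpolar_pi_sub, hh, exp_pi_sub_mul_I, map_mul, neg_mul_neg]

/-- This follows from `|1 + z²|² = (1 - |z|²)² + 4 (Re z)²`, with `(Re z)² ≥ cos² φ |z|²` and `cos²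
φ ≤ 1`. -/
theorem norm_one_add_sq_ge {φ : ℝ} {z : ℂ} (hφ : 0 ≤ Real.cos φ) (hz : z ∈ csector φ) :
    Real.cos φ * (1 + ‖z‖ ^ 2) ≤ ‖1 + z ^ 2‖ := by
  refine (sq_le_sq₀ (by positivity) (norm_nonneg _)).1 ?_
  have h1 : ‖1 + z ^ 2‖ ^ 2 = (1 + z.re ^ 2 - z.im ^ 2) ^ 2 + (2 * z.re * z.im) ^ 2 := by
    rw [Complex.sq_norm, Complex.normSq_apply]
    simp [sq]
    ring
  have h2 : ‖z‖ ^ 2 = z.re ^ 2 + z.im ^ 2 := by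
    rw [Complex.sq_norm, Complex.normSq_apply]; ring
  have h3 : (Real.cos φ * ‖z‖) ^ 2 ≤ z.re ^ 2 := by
    rw [← sq_abs z.re]
    exact pow_le_pow_left₀ (by positivity) hz 2
  have h4 : Real.cos φ ^ 2 ≤ 1 := by
    nlinarith [Real.sin_sq_add_cos_sq φ, sq_nonneg (Real.sin φ)]
  rw [mul_pow] at h3 ⊢
  rw [h1, h2]
  rw [h2] at h3
  nlinarith [mul_nonneg (sub_nonneg.2 h4) (sq_nonneg (1 - (z.re ^ 2 + z.im ^ 2)))]

end CliffordHInfty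
end

noncomputable section

namespace CliffordHInfty

open MeasureTheory Set

/-! ### Scalar symbols -/

/-- Holomorphic functions off the imaginary axis which are real on the real axis and decay like
`|z|` at `0` and like `1 / |z|` at infinity in every double sector. -/
structure IsSymbol (g : ℂ → ℂ) : Prop where
  differentiableAt : ∀ z : ℂ, z.re ≠ 0 → DifferentiableAt ℂ g z
  conj : ∀ z, g (starRingEnd ℂ z) = starRingEnd ℂ (g z)
  bound : ∀ φ : ℝ, 0 < φ → φ < Real.pi / 2 →
    ∃ C : ℝ, 0 ≤ C ∧ ∀ z ∈ csector φ, ‖g z‖ ≤ C * ‖z‖ / (1 + ‖z‖ ^ 2)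

theorem one_add_sq_ne_zero {z : ℂ} (hz : z.re ≠ 0) : 1 + z ^ 2 ≠ 0 := by
  intro h
  have hi := congrArg Complex.im h
  have hr := congrArg Complex.re h
  simp [sq] at hi hr
  have hi' : z.im = 0 := by
    have : 2 * (z.re * z.im) = 0 := by linarith
    simpa [hz] using this
  rw [hi'] at hr
  nlinarith [sq_nonneg z.re]

theorem cos_pos_of_lt {φ : ℝ} (hφ : 0 < φ) (hφ2 : φ < Real.pi / 2) : 0 < Real.cos φ :=
  Real.cos_pos_of_mem_Ioo ⟨by linarith, hφ2⟩

theorem norm_inv_one_add_sq_le {φ : ℝ} (hφ : 0 < φ) (hφ2 : φ < Real.pi / 2) {z : ℂ}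
    (hz : z ∈ csector φ) : ‖(1 + z ^ 2)⁻¹‖ ≤ (Real.cos φ)⁻¹ / (1 + ‖z‖ ^ 2) := by
  have hc := cos_pos_of_lt hφ hφ2
  rw [norm_inv, ← one_div, ← one_div, div_div]
  exact one_div_le_one_div_of_le (by positivity) (norm_one_add_sq_ge hc.le hz)

theorem conj_one_add_sq (z : ℂ) : 1 + (starRingEnd ℂ z) ^ 2 = starRingEnd ℂ (1 + z ^ 2) := by
  simp

namespace IsSymbol

variable {g m : ℂ → ℂ}

theorem mul (hg : IsSymbol g) (hd : ∀ z : ℂ, z.re ≠ 0 → DifferentiableAt ℂ m z)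
    (hc : ∀ z, m (starRingEnd ℂ z) = starRingEnd ℂ (m z))
    (hb : ∀ φ : ℝ, 0 < φ → φ < Real.pi / 2 → ∃ C : ℝ, 0 ≤ C ∧ ∀ z ∈ csector φ, ‖m z‖ ≤ C) :
    IsSymbol fun z => g z * m z where
  differentiableAt z hz := (hg.differentiableAt z hz).mul (hd z hz)
  conj z := by rw [hg.conj, hc, map_mul]
  bound φ hφ hφ2 := by
    obtain ⟨C, hC, h1⟩ := hg.bound φ hφ hφ2
    obtain ⟨D, hD, h2⟩ := hb φ hφ hφ2
    refine ⟨C * D, mul_nonneg hC hD, fun z hz => ?_⟩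
    rw [norm_mul]
    refine (mul_le_mul (h1 z hz) (h2 z hz) (norm_nonneg _) (by positivity)).trans (le_of_eq ?_)
    ring

theorem neg (hg : IsSymbol g) : IsSymbol fun z => -g z where
  differentiableAt z hz := (hg.differentiableAt z hz).neg
  conj z := by rw [hg.conj, map_neg]
  bound φ hφ hφ2 := by simpa using hg.bound φ hφ hφ2

theorem add (hg : IsSymbol g) (hm : IsSymbol m) : IsSymbol fun z => g z + m z where
  differentiableAt z hz := (hg.differentiableAt z hz).add (hm.differentiableAt z hz)
  conj z := by rw [hg.conj, hm.conj, map_add]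
  bound φ hφ hφ2 := by
    obtain ⟨C, hC, h1⟩ := hg.bound φ hφ hφ2
    obtain ⟨D, hD, h2⟩ := hm.bound φ hφ hφ2
    refine ⟨C + D, add_nonneg hC hD, fun z hz => ?_⟩
    refine (norm_add_le _ _).trans ((add_le_add (h1 z hz) (h2 z hz)).trans (le_of_eq ?_))
    ring

theorem zero : IsSymbol fun _ => 0 where
  differentiableAt z _ := differentiableAt_const 0
  conj z := by simp
  bound φ _ _ := ⟨0, le_rfl, fun z _ => by simp⟩

theorem differentiableAt_inv_one_add_sq {z : ℂ} (hz : z.re ≠ 0) :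
    DifferentiableAt ℂ (fun z : ℂ => (1 + z ^ 2)⁻¹) z :=
  DifferentiableAt.inv (by fun_prop) (one_add_sq_ne_zero hz)

theorem mul_inv_one_add_sq (hg : IsSymbol g) : IsSymbol fun z => g z * (1 + z ^ 2)⁻¹ := by
  refine hg.mul (fun z hz => differentiableAt_inv_one_add_sq hz) (fun z => ?_) fun φ hφ hφ2 => ?_
  · rw [conj_one_add_sq, map_inv₀]
  · have hc := cos_pos_of_lt hφ hφ2
    refine ⟨(Real.cos φ)⁻¹, by positivity, fun z hz => (norm_inv_one_add_sq_le hφ hφ2 hz).trans ?_⟩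
    exact div_le_self (by positivity) (by nlinarith [sq_nonneg ‖z‖])

theorem div_one_add_sq : IsSymbol fun z => z * (1 + z ^ 2)⁻¹ where
  differentiableAt z hz := differentiableAt_id.mul (differentiableAt_inv_one_add_sq hz)
  conj z := by rw [conj_one_add_sq, map_mul, map_inv₀]
  bound φ hφ hφ2 := by
    have hc := cos_pos_of_lt hφ hφ2
    refine ⟨(Real.cos φ)⁻¹, by positivity, fun z hz => ?_⟩
    rw [norm_mul]
    refine (mul_le_mul_of_nonneg_left (norm_inv_one_add_sq_le hφ hφ2 hz) (norm_nonneg _)).trans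
      (le_of_eq ?_)
    ring

theorem bounded (hg : IsSymbol g) {φ : ℝ} (hφ : 0 < φ) (hφ2 : φ < Real.pi / 2) :
    ∃ C : ℝ, 0 ≤ C ∧ ∀ z ∈ csector φ, ‖g z‖ ≤ C := by
  obtain ⟨C, hC, h⟩ := hg.bound φ hφ hφ2
  refine ⟨C, hC, fun z hz => (h z hz).trans ?_⟩
  rw [mul_div_assoc]
  refine mul_le_of_le_one_right hC ?_
  rw [div_le_one (by positivity)]
  nlinarith [sq_nonneg (‖z‖ - 1)]

theorem mul_div_one_add_sq (hg : IsSymbol g) : IsSymbol fun z => g z * (z * (1 + z ^ 2)⁻¹) :=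
  hg.mul div_one_add_sq.differentiableAt div_one_add_sq.conj fun _ h1 h2 =>
    div_one_add_sq.bounded h1 h2

theorem pow_div_one_add_sq (k : ℕ) : IsSymbol fun z => (z * (1 + z ^ 2)⁻¹) ^ (k + 1) := by
  induction k with
  | zero => simpa using div_one_add_sq
  | succ k ih =>
    simp only [pow_succ _ (k + 1)]
    exact ih.mul_div_one_add_sq

end IsSymbol

/-- For `u = (1 + z²)⁻¹` one has `u² - u = -(z u)²`, so each remainder is built from the previous
one by multiplications that the calculus understands. At `1 + z² = 0` the convention `u = 0` keeps
the identity true. -/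
theorem inv_pow_sub_inv_succ (k : ℕ) (z : ℂ) :
    ((1 + z ^ 2)⁻¹ ^ (k + 2) - (1 + z ^ 2)⁻¹) =
      ((1 + z ^ 2)⁻¹ ^ (k + 1) - (1 + z ^ 2)⁻¹) * (1 + z ^ 2)⁻¹ +
        -(z * (1 + z ^ 2)⁻¹ * (z * (1 + z ^ 2)⁻¹)) := by
  by_cases h : 1 + z ^ 2 = 0
  · simp [h]
  · linear_combination (1 + z ^ 2)⁻¹ * mul_inv_cancel₀ h

theorem IsSymbol.inv_pow_sub_inv (k : ℕ) :
    IsSymbol fun z => (1 + z ^ 2)⁻¹ ^ (k + 1) - (1 + z ^ 2)⁻¹ := by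
  induction k with
  | zero => simpa using IsSymbol.zero
  | succ k ih =>
    simp only [inv_pow_sub_inv_succ]
    exact ih.mul_inv_one_add_sq.add IsSymbol.div_one_add_sq.mul_div_one_add_sq.neg

/-! ### The resolvent as a family of holomorphic functions -/

variable {𝔅 : Type*} [NormedRing 𝔅] [NormedAlgebra ℝ 𝔅]

/-- The scalar function `ℓ((z - T)⁻¹) = z̄ ℓ(R z) - ℓ(S z)`. -/
def scalarRes (R S : ℂ → 𝔅) (ℓ : StrongDual ℝ 𝔅) (z : ℂ) : ℂ :=
  starRingEnd ℂ z * (ℓ (R z) : ℂ) - (ℓ (S z) : ℂ)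

/-- The functional `x ↦ ℓ(a x)`. -/
def dualMul (a : 𝔅) (ℓ : StrongDual ℝ 𝔅) : StrongDual ℝ 𝔅 := ℓ ∘L ContinuousLinearMap.mul ℝ 𝔅 a

theorem dualMul_apply (a : 𝔅) (ℓ : StrongDual ℝ 𝔅) (x : 𝔅) : dualMul a ℓ x = ℓ (a * x) := rfl

theorem ofReal_norm_sq (z : ℂ) : ((‖z‖ ^ 2 : ℝ) : ℂ) = z * starRingEnd ℂ z := by
  rw [Complex.mul_conj, Complex.normSq_eq_norm_sq]

theorem ofReal_two_re (z : ℂ) : ((2 * z.re : ℝ) : ℂ) = z + starRingEnd ℂ z := by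
  rw [Complex.add_conj]

namespace IsPseudoResolvent

variable {Ω : Set ℂ} {R S : ℂ → 𝔅}

section Relations

variable (h : IsPseudoResolvent Ω R S) (ℓ : StrongDual ℝ 𝔅) {w z : ℂ}
include h

theorem dual_snd_mul_snd (hw : w ∈ Ω) (hz : z ∈ Ω) :
    (ℓ (S w * S z) : ℂ) = ℓ (R z) + (w + starRingEnd ℂ w) * ℓ (R w * S z)
      - w * starRingEnd ℂ w * ℓ (R w * R z) := by
  rw [h.snd_mul_snd w hw z hz, ← ofReal_two_re, ← ofReal_norm_sq]
  simp

theorem dual_resolvent_fst (hw : w ∈ Ω) (hz : z ∈ Ω) :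
    (ℓ (R z) : ℂ) = ℓ (R w) + (w * starRingEnd ℂ w - z * starRingEnd ℂ z) * ℓ (R w * R z)
      + (z + starRingEnd ℂ z - (w + starRingEnd ℂ w)) * ℓ (R w * S z) := by
  have := congrArg (fun x => (ℓ x : ℂ)) (h.resolvent_fst w hw z hz)
  simp only [map_add, map_smul, smul_eq_mul] at this
  rw [this, ← ofReal_two_re, ← ofReal_two_re, ← ofReal_norm_sq, ← ofReal_norm_sq]
  push_cast
  ring

theorem dual_resolvent_snd (hw : w ∈ Ω) (hz : z ∈ Ω) :
    (ℓ (S z) : ℂ) = ℓ (S w) + (w * starRingEnd ℂ w - z * starRingEnd ℂ z) * ℓ (R w * S z)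
      + (z + starRingEnd ℂ z - (w + starRingEnd ℂ w)) * ℓ (S w * S z) := by
  have := congrArg (fun x => (ℓ x : ℂ)) (h.resolvent_snd w hw z hz)
  simp only [map_add, map_smul, smul_eq_mul] at this
  rw [this, ← ofReal_two_re, ← ofReal_two_re, ← ofReal_norm_sq, ← ofReal_norm_sq]
  push_cast
  ring

/-- This is the resolvent identity: the bracket is `ℓ` of `(w̄ - T)(z̄ - T) R_w R_z`, which plays
the role of `(w - T)⁻¹ (z - T)⁻¹`. It exhibits the difference quotient of `scalarRes`. -/
theorem scalarRes_sub (hw : w ∈ Ω) (hz : z ∈ Ω) :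
    scalarRes R S ℓ w - scalarRes R S ℓ z = (w - z) *
      -(starRingEnd ℂ w * starRingEnd ℂ z * ℓ (R w * R z)
        - (starRingEnd ℂ w + starRingEnd ℂ z) * ℓ (R w * S z) + ℓ (S w * S z)) := by
  have h2 := h.dual_snd_mul_snd ℓ hw hz
  have h3 := h.dual_resolvent_fst ℓ hw hz
  have h4 := h.dual_resolvent_snd ℓ hw hz
  unfold scalarRes
  linear_combination (-starRingEnd ℂ w) * h3 + h4 + (starRingEnd ℂ z - starRingEnd ℂ w) * h2

/-- Formally `1 + z² = (1 + T²) + (z - T)(z + T)`; divide by `(1 + T²)(z - T)`. What matters is that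
the correction is a polynomial with real coefficients. Applying `T` and using `T² R = 1 - R` gives
the version for `S`. -/
theorem scalarRes_dualMul_fst (hI : Complex.I ∈ Ω) (hz : z ∈ Ω) :
    (1 + z ^ 2) * scalarRes R S (dualMul (R Complex.I) ℓ) z =
      scalarRes R S ℓ z + (ℓ (R Complex.I) * z + ℓ (S Complex.I)) := by
  have h2 := h.dual_snd_mul_snd ℓ hI hz
  have h3 := h.dual_resolvent_fst ℓ hI hz
  have h4 := h.dual_resolvent_snd ℓ hI hz
  simp only [Complex.conj_I, mul_neg, Complex.I_mul_I, neg_neg, add_neg_cancel, zero_mul,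
    sub_zero] at h2 h3 h4
  simp only [scalarRes, dualMul_apply]
  linear_combination z * h3 + h4 + (z + starRingEnd ℂ z) * h2

theorem scalarRes_dualMul_snd (hI : Complex.I ∈ Ω) (hz : z ∈ Ω) :
    (1 + z ^ 2) * scalarRes R S (dualMul (S Complex.I) ℓ) z =
      z * scalarRes R S ℓ z + (ℓ (S Complex.I) * z + (-ℓ (R Complex.I) : ℝ)) := by
  have h2 := h.dual_snd_mul_snd ℓ hI hz
  have h3 := h.dual_resolvent_fst ℓ hI hz
  have h4 := h.dual_resolvent_snd ℓ hI hz
  simp only [Complex.conj_I, mul_neg, Complex.I_mul_I, neg_neg, add_neg_cancel, zero_mul,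
    sub_zero] at h2 h3 h4
  simp only [scalarRes, dualMul_apply, h.snd_mul_fst _ hI _ hz, Complex.ofReal_neg]
  linear_combination -h3 + z * h4 + (z * starRingEnd ℂ z - 1) * h2

end Relations

section Continuity

variable [CompleteSpace 𝔅] (h : IsPseudoResolvent Ω R S) {z : ℂ}
include h

/-- The resolvent relation reads `R z = R w * P w` with `P w → 1`. Hence `P w` is invertible near
`z` and `R w = R z * (P w)⁻¹`, with no prior local bound on `R w`; the same holds for `S`. -/
theorem continuousAt (hz : z ∈ Ω) : ContinuousAt R z ∧ ContinuousAt S z := by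
  set P : ℂ → 𝔅 := fun w =>
    1 + (‖w‖ ^ 2 - ‖z‖ ^ 2) • R z + (2 * (z.re - w.re)) • S z with hP
  have hPc : Continuous P := by fun_prop
  have hPz : P z = 1 := by simp [hP]
  have hPt : Filter.Tendsto P (nhds z) (nhds 1) := hPz ▸ hPc.tendsto z
  have hinv : Filter.Tendsto (fun w => Ring.inverse (P w)) (nhds z) (nhds 1) := by
    have := NormedRing.inverse_continuousAt (1 : 𝔅ˣ)
    rw [ContinuousAt, Units.val_one, Ring.inverse_one] at this
    exact this.comp hPt
  have hunit : ∀ᶠ w in nhds z, IsUnit (P w) :=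
    hPt.eventually (Units.isOpen.mem_nhds (isUnit_one : IsUnit (1 : 𝔅)))
  have hΩ : ∀ᶠ w in nhds z, w ∈ Ω := h.isOpen.mem_nhds hz
  constructor
  · have h1 : ∀ᶠ w in nhds z, R z * Ring.inverse (P w) = R w := by
      filter_upwards [hunit, hΩ] with w hu hw
      have : R z = R w * P w := by
        nth_rw 1 [h.resolvent_fst w hw z hz]
        simp [hP, mul_add]
      rw [this, mul_assoc, Ring.mul_inverse_cancel _ hu, mul_one]
    have h2 := (hinv.const_mul (R z)).congr' h1
    rwa [mul_one] at h2
  · have h1 : ∀ᶠ w in nhds z, S z * Ring.inverse (P w) = S w := by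
      filter_upwards [hunit, hΩ] with w hu hw
      have : S z = S w * P w := by
        nth_rw 1 [h.resolvent_snd w hw z hz]
        simp [hP, mul_add, h.snd_mul_fst w hw z hz]
      rw [this, mul_assoc, Ring.mul_inverse_cancel _ hu, mul_one]
    have h2 := (hinv.const_mul (S z)).congr' h1
    rwa [mul_one] at h2

theorem differentiableAt_scalarRes (ℓ : StrongDual ℝ 𝔅) (hz : z ∈ Ω) :
    DifferentiableAt ℂ (scalarRes R S ℓ) z := by
  obtain ⟨hR, hS⟩ := h.continuousAt hz
  set G : ℂ → ℂ := fun w => -(starRingEnd ℂ w * starRingEnd ℂ z * ℓ (R w * R z)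
        - (starRingEnd ℂ w + starRingEnd ℂ z) * ℓ (R w * S z) + ℓ (S w * S z)) with hG
  have hGc : ContinuousAt G z := by
    have h1 (X : ℂ → 𝔅) (Y : 𝔅) (hX : ContinuousAt X z) :
        ContinuousAt (fun w => (ℓ (X w * Y) : ℂ)) z :=
      Complex.continuous_ofReal.continuousAt.comp
        (ℓ.continuous.continuousAt.comp (hX.mul continuousAt_const))
    have h2 := h1 R (R z) hR
    have h3 := h1 R (S z) hR
    have h4 := h1 S (S z) hS
    have h5 : ContinuousAt (fun w : ℂ => starRingEnd ℂ w) z := Complex.continuous_conj.continuousAt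
    exact ((((h5.mul continuousAt_const).mul h2).sub ((h5.add continuousAt_const).mul h3)).add
      h4).neg
  refine HasDerivAt.differentiableAt (f' := G z) ?_
  rw [hasDerivAt_iff_tendsto_slope]
  refine (hGc.tendsto.mono_left nhdsWithin_le_nhds).congr' ?_
  have hΩ : ∀ᶠ w in nhdsWithin z {z}ᶜ, w ∈ Ω := nhdsWithin_le_nhds (h.isOpen.mem_nhds hz)
  filter_upwards [hΩ, self_mem_nhdsWithin] with w hw hne
  have hne' : w - z ≠ 0 := sub_ne_zero.2 hne
  rw [slope_def_field, h.scalarRes_sub ℓ hw hz, mul_div_cancel_left₀ _ hne']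

end Continuity

end IsPseudoResolvent

end CliffordHInfty
end

noncomputable section

namespace CliffordHInfty

open MeasureTheory Set

/-! ### The functional calculus of a pseudo-resolvent -/

variable {𝔅 : Type*} [NormedRing 𝔅] [NormedAlgebra ℝ 𝔅]

/-- The integrand of `rayOp`. -/
def rayOpIntegrand (R S : ℂ → 𝔅) (g : ℂ → ℂ) (ψ t : ℝ) : 𝔅 :=
  (t * (g (cpolar t ψ)).im) • R (cpolar t ψ) -
    (Complex.exp (ψ * Complex.I) * g (cpolar t ψ)).im • S (cpolar t ψ)

/-- The imaginary part of `∫ (z - T)⁻¹ g(z) dz` along the outgoing ray of angle `ψ`. -/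
def rayOp (R S : ℂ → 𝔅) (g : ℂ → ℂ) (ψ : ℝ) : 𝔅 := ∫ t in Ioi (0 : ℝ), rayOpIntegrand R S g ψ t

/-- The functional calculus of intrinsic functions. -/
def symbolOp (R S : ℂ → 𝔅) (φ : ℝ) (g : ℂ → ℂ) : 𝔅 :=
  (1 / Real.pi) • (rayOp R S g (Real.pi - φ) - rayOp R S g φ)

/-- A pseudo-resolvent outside the double sector of angle `ω`, which satisfies the resolvent
estimates outside the double sector of angle `φ`. -/
structure IsSectorialResolvent (ω φ : ℝ) (R S : ℂ → 𝔅) : Prop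
    extends IsPseudoResolvent (sectorCompl ω) R S where
  pos : 0 < ω
  lt : ω < φ
  lt_pi : φ < Real.pi / 2
  bound : ∃ C : ℝ, 0 ≤ C ∧ ∀ z : ℂ, z ≠ 0 → |z.re| ≤ Real.cos φ * ‖z‖ →
    ‖R z‖ ≤ C / ‖z‖ ^ 2 ∧ ‖S z‖ ≤ C / ‖z‖

namespace IsSectorialResolvent

variable {ω φ ψ : ℝ} {R S : ℂ → 𝔅} {g : ℂ → ℂ}

section

variable (h : IsSectorialResolvent ω φ R S)
include h

theorem cos_pos : 0 < Real.cos φ := cos_pos_of_lt (h.pos.trans h.lt) h.lt_pi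

theorem abs_cos : |Real.cos φ| = Real.cos φ := abs_of_pos h.cos_pos

theorem abs_cos_pi_sub : |Real.cos (Real.pi - φ)| = Real.cos φ := by
  rw [CliffordHInfty.abs_cos_pi_sub, h.abs_cos]

omit h [NormedRing 𝔅] [NormedAlgebra ℝ 𝔅] in
theorem abs_re_cpolar_le (hψ : |Real.cos ψ| ≤ Real.cos φ) {t : ℝ} (ht : 0 < t) :
    |(cpolar t ψ).re| ≤ Real.cos φ * ‖cpolar t ψ‖ := by
  rw [cpolar_re, norm_cpolar ht.le, abs_mul, abs_of_pos ht, mul_comm]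
  gcongr

theorem mem_sectorCompl {z : ℂ} (hz : z ≠ 0) (hr : |z.re| ≤ Real.cos φ * ‖z‖) :
    z ∈ sectorCompl ω := by
  refine lt_of_le_of_lt hr ?_
  exact mul_lt_mul_of_pos_right (Real.cos_lt_cos_of_nonneg_of_le_pi h.pos.le
    (by linarith [h.lt_pi, Real.pi_pos]) h.lt) (norm_pos_iff.2 hz)

omit h [NormedRing 𝔅] [NormedAlgebra ℝ 𝔅] in
theorem cpolar_ne_zero {t : ℝ} (ht : 0 < t) : cpolar t ψ ≠ 0 :=
  norm_pos_iff.1 (by rwa [norm_cpolar ht.le])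

theorem cpolar_mem (hψ : |Real.cos ψ| ≤ Real.cos φ) {t : ℝ} (ht : 0 < t) :
    cpolar t ψ ∈ sectorCompl ω :=
  h.mem_sectorCompl (cpolar_ne_zero ht) (abs_re_cpolar_le hψ ht)

theorem I_mem : Complex.I ∈ sectorCompl ω :=
  h.mem_sectorCompl Complex.I_ne_zero (by simp [h.cos_pos.le])

theorem cpolar_re_ne_zero (hψ : |Real.cos ψ| = Real.cos φ) {t : ℝ} (ht : 0 < t) :
    (cpolar t ψ).re ≠ 0 := by
  rw [cpolar_re]
  refine mul_ne_zero ht.ne' fun h0 => ?_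
  rw [h0, abs_zero] at hψ
  exact h.cos_pos.ne hψ

theorem exists_bound_symbol (hg : IsSymbol g) (hψ : |Real.cos ψ| = Real.cos φ) :
    ∃ C : ℝ, 0 ≤ C ∧ ∀ t, 0 < t → ‖g (cpolar t ψ)‖ ≤ C * t / (1 + t ^ 2) := by
  obtain ⟨C, hC, hb⟩ := hg.bound φ (h.pos.trans h.lt) h.lt_pi
  refine ⟨C, hC, fun t ht => ?_⟩
  have := hb _ (cpolar_mem_csector ht.le hψ.ge)
  rwa [norm_cpolar ht.le] at this

theorem exists_bound_scalarRes (ℓ : StrongDual ℝ 𝔅) :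
    ∃ C : ℝ, 0 ≤ C ∧ ∀ z : ℂ, z ≠ 0 → |z.re| ≤ Real.cos φ * ‖z‖ →
      ‖scalarRes R S ℓ z‖ ≤ C / ‖z‖ := by
  obtain ⟨C, hC, hb⟩ := h.bound
  refine ⟨‖ℓ‖ * C + ‖ℓ‖ * C, by positivity, fun z hz hr => ?_⟩
  obtain ⟨h1, h2⟩ := hb z hz hr
  have hz' : 0 < ‖z‖ := norm_pos_iff.2 hz
  refine (norm_sub_le _ _).trans ?_
  rw [add_div]
  refine add_le_add ?_ ?_
  · rw [norm_mul, RCLike.norm_conj, Complex.norm_real]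
    calc ‖z‖ * ‖ℓ (R z)‖ ≤ ‖z‖ * (‖ℓ‖ * (C / ‖z‖ ^ 2)) := by
          gcongr
          exact (ℓ.le_opNorm _).trans (by gcongr)
      _ = ‖ℓ‖ * C / ‖z‖ := by field_simp
  · rw [Complex.norm_real, mul_div_assoc]
    exact (ℓ.le_opNorm _).trans (by gcongr)

end

section

variable [CompleteSpace 𝔅] (h : IsSectorialResolvent ω φ R S)
include h

/-- The weight `t / (1 + t²)` cancels the singularity `1/t` common to `t R` and `S`. No symmetry of
`g` is used, so that `I * g` is covered as well. -/
theorem integrableOn_rayOpIntegrand_of_bound (hg : ∀ z : ℂ, z.re ≠ 0 → ContinuousAt g z) {D : ℝ}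
    (hD : 0 ≤ D) (hψ : |Real.cos ψ| = Real.cos φ)
    (hgb : ∀ t, 0 < t → ‖g (cpolar t ψ)‖ ≤ D * t / (1 + t ^ 2)) :
    IntegrableOn (rayOpIntegrand R S g ψ) (Ioi 0) := by
  obtain ⟨C, hC, hb⟩ := h.bound
  refine integrableOn_Ioi_of_norm_le (C := 2 * C * D) (fun t ht => ?_) fun t ht _ => ?_
  · obtain ⟨hR, hS⟩ := h.continuousAt (h.cpolar_mem hψ.le ht)
    have hc : ContinuousAt (fun t => cpolar t ψ) t := (continuous_cpolar ψ).continuousAt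
    have hR' : ContinuousAt (fun t => R (cpolar t ψ)) t := hR.comp (f := fun t => cpolar t ψ) hc
    have hS' : ContinuousAt (fun t => S (cpolar t ψ)) t := hS.comp (f := fun t => cpolar t ψ) hc
    have hg' : ContinuousAt (fun t => g (cpolar t ψ)) t :=
      (hg _ (h.cpolar_re_ne_zero hψ ht)).comp (f := fun t => cpolar t ψ) hc
    have him (f : ℝ → ℂ) (hf : ContinuousAt f t) : ContinuousAt (fun t => (f t).im) t :=
      Complex.continuous_im.continuousAt.comp hf
    exact (((continuousAt_id.mul (him _ hg')).smul hR').sub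
      ((him _ (continuousAt_const.mul hg')).smul hS')).continuousWithinAt
  · obtain ⟨h1, h2⟩ := hb _ (cpolar_ne_zero ht) (abs_re_cpolar_le hψ.le ht)
    rw [norm_cpolar ht.le] at h1 h2
    have h3 := hgb t ht
    have ht' : 0 < t := ht
    have e1 : |t * (g (cpolar t ψ)).im| ≤ t * (D * t / (1 + t ^ 2)) := by
      rw [abs_mul, abs_of_pos ht']
      exact mul_le_mul_of_nonneg_left ((Complex.abs_im_le_norm _).trans h3) ht'.le
    have e2 : |(Complex.exp (ψ * Complex.I) * g (cpolar t ψ)).im| ≤ D * t / (1 + t ^ 2) := by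
      refine (Complex.abs_im_le_norm _).trans ?_
      rwa [norm_mul, Complex.norm_exp_ofReal_mul_I, one_mul]
    calc ‖rayOpIntegrand R S g ψ t‖
        ≤ t * (D * t / (1 + t ^ 2)) * (C / t ^ 2) + D * t / (1 + t ^ 2) * (C / t) := by
          refine (norm_sub_le _ _).trans (add_le_add ?_ ?_)
          · rw [norm_smul, Real.norm_eq_abs]
            exact mul_le_mul e1 h1 (norm_nonneg _) (by positivity)
          · rw [norm_smul, Real.norm_eq_abs]
            exact mul_le_mul e2 h2 (norm_nonneg _) (by positivity)
      _ = 2 * C * D / (1 + t ^ 2) := by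
          field_simp
          ring

theorem integrableOn_rayOpIntegrand (hg : IsSymbol g) (hψ : |Real.cos ψ| = Real.cos φ) :
    IntegrableOn (rayOpIntegrand R S g ψ) (Ioi 0) := by
  obtain ⟨D, hD, hgb⟩ := h.exists_bound_symbol hg hψ
  exact h.integrableOn_rayOpIntegrand_of_bound
    (fun z hz => (hg.differentiableAt z hz).continuousAt) hD hψ hgb

theorem integrableOn_I_mul_rayOpIntegrand (hg : IsSymbol g) (hψ : |Real.cos ψ| = Real.cos φ) :
    IntegrableOn (rayOpIntegrand R S (fun z => Complex.I * g z) ψ) (Ioi 0) := by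
  obtain ⟨D, hD, hgb⟩ := h.exists_bound_symbol hg hψ
  exact h.integrableOn_rayOpIntegrand_of_bound
    (fun z hz => continuousAt_const.mul (hg.differentiableAt z hz).continuousAt) hD hψ
    fun t ht => by rw [norm_mul, Complex.norm_I, one_mul]; exact hgb t ht

theorem integrableOn_scalarRes_mul (hg : IsSymbol g) (hψ : |Real.cos ψ| = Real.cos φ)
    (ℓ : StrongDual ℝ 𝔅) :
    IntegrableOn (fun t => scalarRes R S ℓ (cpolar t ψ) * g (cpolar t ψ) *
      Complex.exp (ψ * Complex.I)) (Ioi 0) := by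
  obtain ⟨C, hC, hb⟩ := h.exists_bound_scalarRes ℓ
  obtain ⟨D, hD, hgb⟩ := h.exists_bound_symbol hg hψ
  refine integrableOn_ray (h := fun z => scalarRes R S ℓ z * g z) (C := C * D)
    (fun t ht => ?_) fun t ht _ => ?_
  · exact (h.differentiableAt_scalarRes ℓ (h.cpolar_mem hψ.le ht)).continuousAt.mul
      (hg.differentiableAt _ (h.cpolar_re_ne_zero hψ ht)).continuousAt
  · have h1 := hb _ (cpolar_ne_zero ht) (abs_re_cpolar_le hψ.le ht)
    rw [norm_cpolar ht.le] at h1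
    rw [norm_mul]
    refine (mul_le_mul h1 (hgb t ht) (norm_nonneg _) (by positivity)).trans (le_of_eq ?_)
    field_simp

/-- On the ray `z̄ dz = t dt` is real, so the imaginary part falls only on factors containing `g`.
This is why the real algebra suffices to define `rayOp`. -/
theorem dual_rayOp (hg : IsSymbol g) (hψ : |Real.cos ψ| = Real.cos φ) (ℓ : StrongDual ℝ 𝔅) :
    ℓ (rayOp R S g ψ) = (rayInt (fun z => scalarRes R S ℓ z * g z) ψ).im := by
  rw [rayOp, ← ℓ.integral_comp_comm (h.integrableOn_rayOpIntegrand hg hψ)]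
  have h1 := Complex.imCLM.integral_comp_comm (h.integrableOn_scalarRes_mul hg hψ ℓ)
  simp only [Complex.imCLM_apply] at h1
  rw [rayInt, ← h1]
  refine integral_congr_ae (Filter.Eventually.of_forall fun t => ?_)
  have hz : starRingEnd ℂ (cpolar t ψ) * Complex.exp (ψ * Complex.I) = t := by
    have hn : starRingEnd ℂ (Complex.exp (ψ * Complex.I)) * Complex.exp (ψ * Complex.I) = 1 := by
      rw [mul_comm, Complex.mul_conj, Complex.normSq_eq_norm_sq, Complex.norm_exp_ofReal_mul_I]
      simp
    rw [cpolar, map_mul, Complex.conj_ofReal, mul_assoc, hn, mul_one]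
  have he : scalarRes R S ℓ (cpolar t ψ) * g (cpolar t ψ) * Complex.exp (ψ * Complex.I) =
      ((t * ℓ (R (cpolar t ψ)) : ℝ) : ℂ) * g (cpolar t ψ) -
        (ℓ (S (cpolar t ψ)) : ℂ) * (Complex.exp (ψ * Complex.I) * g (cpolar t ψ)) := by
    rw [scalarRes]
    push_cast
    linear_combination (ℓ (R (cpolar t ψ)) * g (cpolar t ψ)) * hz
  simp only [he, rayOpIntegrand]
  rw [Complex.sub_im, Complex.im_ofReal_mul, Complex.im_ofReal_mul, map_sub, map_smul, map_smul,
    smul_eq_mul, smul_eq_mul]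
  ring

theorem dual_symbolOp (hg : IsSymbol g) (ℓ : StrongDual ℝ 𝔅) :
    ℓ (symbolOp R S φ g) = 1 / Real.pi *
      ((rayInt (fun z => scalarRes R S ℓ z * g z) (Real.pi - φ)).im -
        (rayInt (fun z => scalarRes R S ℓ z * g z) φ).im) := by
  rw [symbolOp, map_smul, map_sub, h.dual_rayOp hg h.abs_cos, h.dual_rayOp hg h.abs_cos_pi_sub,
    smul_eq_mul]

theorem symbolOp_add {g' : ℂ → ℂ} (hg : IsSymbol g) (hg' : IsSymbol g') :
    symbolOp R S φ (fun z => g z + g' z) = symbolOp R S φ g + symbolOp R S φ g' := by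
  have key (ψ : ℝ) (hψ : |Real.cos ψ| = Real.cos φ) :
      rayOp R S (fun z => g z + g' z) ψ = rayOp R S g ψ + rayOp R S g' ψ := by
    rw [rayOp, rayOp, rayOp, ← integral_add (h.integrableOn_rayOpIntegrand hg hψ)
      (h.integrableOn_rayOpIntegrand hg' hψ)]
    refine integral_congr_ae (Filter.Eventually.of_forall fun t => ?_)
    simp only [rayOpIntegrand, mul_add, Complex.add_im, add_smul]
    abel
  rw [symbolOp, symbolOp, symbolOp, key _ h.abs_cos, key _ h.abs_cos_pi_sub, ← smul_add]
  congr 1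
  abel

omit h [CompleteSpace 𝔅] in
theorem symbolOp_neg : symbolOp R S φ (fun z => -g z) = -symbolOp R S φ g := by
  have key (ψ : ℝ) : rayOp R S (fun z => -g z) ψ = -rayOp R S g ψ := by
    rw [rayOp, rayOp, ← integral_neg]
    refine integral_congr_ae (Filter.Eventually.of_forall fun t => ?_)
    simp only [rayOpIntegrand, mul_neg, Complex.neg_im, neg_smul]
    abel
  rw [symbolOp, symbolOp, key, key, ← smul_neg]
  congr 1
  abel

/-- The substitute for a product rule: a change of functional that multiplies `scalarRes` by `m` may
be moved into the symbol. The correction `q` is real on the real axis because `a` and `b` are real,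
and it is `O(1 / (1 + |z|²))`, so `im_rayInt_eq_zero` removes it on both rays. -/
theorem dual_symbolOp_eq_of_scalarRes_eq {m : ℂ → ℂ} (hg : IsSymbol g)
    (hgm : IsSymbol fun z => g z * m z) {ℓ ℓ' : StrongDual ℝ 𝔅} {a b : ℝ}
    (hm : ∀ z ∈ sectorCompl ω, z.re ≠ 0 →
      scalarRes R S ℓ' z = scalarRes R S ℓ z * m z + (a * z + b) * (1 + z ^ 2)⁻¹) :
    ℓ' (symbolOp R S φ g) = ℓ (symbolOp R S φ fun z => g z * m z) := by
  set q : ℂ → ℂ := fun z => g z * ((a * z + b) * (1 + z ^ 2)⁻¹) with hq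
  have hφ := h.pos.trans h.lt
  have hqd (z : ℂ) (hz : z.re ≠ 0) : DifferentiableAt ℂ q z :=
    (hg.differentiableAt z hz).mul (DifferentiableAt.mul (by fun_prop)
      (IsSymbol.differentiableAt_inv_one_add_sq hz))
  have hqc (z : ℂ) : q (starRingEnd ℂ z) = starRingEnd ℂ (q z) := by
    simp only [hq, hg.conj, conj_one_add_sq]
    simp
  obtain ⟨C, hC, hgb⟩ := hg.bound φ hφ h.lt_pi
  have hqb : ∃ D, ∀ z ∈ csector φ, ‖q z‖ ≤ D / (1 + ‖z‖ ^ 2) := by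
    refine ⟨C * ((|a| + |b|) * (Real.cos φ)⁻¹), fun z hz => ?_⟩
    have hcp := h.cos_pos
    have h1 := hgb z hz
    have h2 := norm_inv_one_add_sq_le hφ h.lt_pi hz
    have h3 : ‖(a * z + b : ℂ)‖ ≤ |a| * ‖z‖ + |b| := by
      refine (norm_add_le _ _).trans ?_
      rw [norm_mul, Complex.norm_real, Complex.norm_real, Real.norm_eq_abs, Real.norm_eq_abs]
    have h4 : ‖z‖ * (|a| * ‖z‖ + |b|) ≤ (|a| + |b|) * (1 + ‖z‖ ^ 2) := by
      nlinarith [abs_nonneg a, abs_nonneg b, norm_nonneg z, mul_nonneg (abs_nonneg b)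
        (sq_nonneg (‖z‖ - 1)), mul_nonneg (abs_nonneg b) (sq_nonneg ‖z‖)]
    simp only [hq]
    rw [norm_mul, norm_mul]
    calc ‖g z‖ * (‖(a * z + b : ℂ)‖ * ‖(1 + z ^ 2)⁻¹‖)
        ≤ C * ‖z‖ / (1 + ‖z‖ ^ 2) *
          ((|a| * ‖z‖ + |b|) * ((Real.cos φ)⁻¹ / (1 + ‖z‖ ^ 2))) := by gcongr
      _ = C * (Real.cos φ)⁻¹ / (1 + ‖z‖ ^ 2) ^ 2 * (‖z‖ * (|a| * ‖z‖ + |b|)) := by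
          field_simp
      _ ≤ C * (Real.cos φ)⁻¹ / (1 + ‖z‖ ^ 2) ^ 2 * ((|a| + |b|) * (1 + ‖z‖ ^ 2)) := by gcongr
      _ = _ := by field_simp
  obtain ⟨D, hqb⟩ := hqb
  obtain ⟨i1, i2⟩ := im_rayInt_eq_zero hφ.le h.lt_pi hqd hqc hqb
  have key (ψ : ℝ) (hψ : |Real.cos ψ| = Real.cos φ) (hi : (rayInt q ψ).im = 0) :
      (rayInt (fun z => scalarRes R S ℓ' z * g z) ψ).im =
        (rayInt (fun z => scalarRes R S ℓ z * (g z * m z)) ψ).im := by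
    have hint : IntegrableOn (fun t => q (cpolar t ψ) * Complex.exp (ψ * Complex.I)) (Ioi 0) :=
      integrableOn_ray (C := D) (fun t ht => (hqd _ (h.cpolar_re_ne_zero hψ ht)).continuousAt)
        fun t ht _ => by
          have := hqb _ (cpolar_mem_csector ht.le hψ.ge)
          rwa [norm_cpolar ht.le] at this
    have : rayInt (fun z => scalarRes R S ℓ' z * g z) ψ =
        rayInt (fun z => scalarRes R S ℓ z * (g z * m z)) ψ + rayInt q ψ := by
      rw [rayInt, rayInt, rayInt, ← integral_add (h.integrableOn_scalarRes_mul hgm hψ ℓ) hint]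
      refine setIntegral_congr_fun measurableSet_Ioi fun t ht => ?_
      simp only [hq, hm _ (h.cpolar_mem hψ.le ht) (h.cpolar_re_ne_zero hψ ht)]
      ring
    rw [this, Complex.add_im, hi, add_zero]
  rw [h.dual_symbolOp hg, h.dual_symbolOp hgm, key _ h.abs_cos i1, key _ h.abs_cos_pi_sub i2]

theorem symbolOp_mul_inv_one_add_sq (hg : IsSymbol g) :
    symbolOp R S φ (fun z => g z * (1 + z ^ 2)⁻¹) = R Complex.I * symbolOp R S φ g := by
  refine (SeparatingDual.eq_iff_forall_dual_eq (R := ℝ)).2 fun ℓ => ?_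
  rw [← dualMul_apply]
  refine (h.dual_symbolOp_eq_of_scalarRes_eq hg hg.mul_inv_one_add_sq (a := ℓ (R Complex.I))
    (b := ℓ (S Complex.I)) fun z hz hr => ?_).symm
  have := h.scalarRes_dualMul_fst ℓ h.I_mem hz
  rw [← add_mul, ← this, mul_comm (1 + z ^ 2), mul_assoc, mul_inv_cancel₀ (one_add_sq_ne_zero hr),
    mul_one]

theorem symbolOp_mul_div_one_add_sq (hg : IsSymbol g) :
    symbolOp R S φ (fun z => g z * (z * (1 + z ^ 2)⁻¹)) = S Complex.I * symbolOp R S φ g := by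
  refine (SeparatingDual.eq_iff_forall_dual_eq (R := ℝ)).2 fun ℓ => ?_
  rw [← dualMul_apply]
  refine (h.dual_symbolOp_eq_of_scalarRes_eq hg hg.mul_div_one_add_sq (a := ℓ (S Complex.I))
    (b := -ℓ (R Complex.I)) fun z hz hr => ?_).symm
  have := h.scalarRes_dualMul_snd ℓ h.I_mem hz
  rw [← mul_assoc, ← add_mul, mul_comm (scalarRes R S ℓ z), ← this, mul_comm (1 + z ^ 2),
    mul_assoc, mul_inv_cancel₀ (one_add_sq_ne_zero hr), mul_one]

/-- The ray is to be turned from `φ` to `π - φ` across the imaginary axis, where `z (1 + z²)⁻¹` has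
the pole `i`. The two extra integrals record what has to be added to make this rotation legitimate.
-/
theorem rayInt_scalarRes_mul_div_one_add_sq (ℓ : StrongDual ℝ 𝔅) :
    rayInt (fun z => scalarRes R S ℓ z * (z * (1 + z ^ 2)⁻¹)) φ
      - ℓ (R Complex.I) * rayInt (fun z => (1 + z ^ 2)⁻¹) φ
      + ℓ (S Complex.I) * rayInt (fun z => 2 * z / (1 - z ^ 4)) φ =
    rayInt (fun z => scalarRes R S ℓ z * (z * (1 + z ^ 2)⁻¹)) (Real.pi - φ)
      - ℓ (R Complex.I) * rayInt (fun z => (1 + z ^ 2)⁻¹) (Real.pi - φ)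
      + ℓ (S Complex.I) * rayInt (fun z => 2 * z / (1 - z ^ 4)) (Real.pi - φ) := by
  set a : ℝ := ℓ (R Complex.I)
  set b : ℝ := ℓ (S Complex.I)
  -- By `scalarRes_dualMul_fst` the first term is the wanted integrand with its pole at `i` removed,
  -- plus `(a z² + b z) / (1 + z²)`. Subtracting `a` and adding `b z / (1 - z²)` cancels the
  -- constant and the `1/z` tail at infinity; the new poles `±1` lie outside the region swept.
  set H : ℂ → ℂ := fun z =>
    z * scalarRes R S (dualMul (R Complex.I) ℓ) z - a + b * (z / (1 - z ^ 2)) with hH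
  have hφ := h.pos.trans h.lt
  have hone (z : ℂ) (hz : z ∈ sectorCompl ω) : 1 - z ^ 2 ≠ 0 := by
    intro h0
    have hlt : Real.cos ω < 1 := by
      have := Real.cos_lt_cos_of_nonneg_of_le_pi le_rfl (by linarith [h.lt, h.lt_pi, Real.pi_pos])
        h.pos
      rwa [Real.cos_zero] at this
    have h1 : (z - 1) * (z + 1) = 0 := by linear_combination -h0
    rcases mul_eq_zero.1 h1 with h2 | h2
    · rw [sub_eq_zero.1 h2] at hz
      simp only [sectorCompl, mem_ofPred_eq, Complex.one_re, abs_one, norm_one, mul_one] at hz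
      linarith
    · rw [eq_neg_of_add_eq_zero_left h2] at hz
      simp only [sectorCompl, mem_ofPred_eq, Complex.neg_re, Complex.one_re, abs_neg, abs_one,
        norm_neg, norm_one, mul_one] at hz
      linarith
  have hHeq (z : ℂ) (hz : z ∈ sectorCompl ω) (h2 : 1 + z ^ 2 ≠ 0) :
      H z = scalarRes R S ℓ z * (z * (1 + z ^ 2)⁻¹) - a * (1 + z ^ 2)⁻¹
        + b * (2 * z / (1 - z ^ 4)) := by
    have h1 := hone z hz
    have h4 : (1 : ℂ) - z ^ 4 = (1 - z ^ 2) * (1 + z ^ 2) := by ring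
    have h3 := h.scalarRes_dualMul_fst ℓ h.I_mem hz
    simp only [hH]
    rw [h4]
    field_simp
    linear_combination z * (1 - z ^ 2) * h3
  obtain ⟨C, hC, hb⟩ := h.exists_bound_scalarRes ℓ
  have b1 (t : ℝ) (ht : 0 < t) (ht' : t ∉ Icc (1 / 2 : ℝ) 2) (z : ℂ) (hz : ‖z‖ = t) :
      0 < ‖1 + z ^ 2‖ ∧ ‖(1 + z ^ 2)⁻¹‖ ≤ 2 / (1 + t ^ 2) := by
    have := norm_one_sub_ge ht ht' (w := -z ^ 2) (by rw [norm_neg, norm_pow, hz])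
    rw [sub_neg_eq_add] at this
    refine ⟨lt_of_lt_of_le (by positivity) this, ?_⟩
    rw [norm_inv]
    refine (inv_anti₀ (by positivity) this).trans (le_of_eq ?_)
    rw [inv_div]
  have hrot : rayInt H φ = rayInt H (Real.pi - φ) := by
    have hcos (ψ : ℝ) (hψ : ψ ∈ Icc φ (Real.pi - φ)) : |Real.cos ψ| ≤ Real.cos φ := by
      refine abs_le.2 ⟨?_, ?_⟩
      · rw [← Real.cos_pi_sub]
        exact Real.cos_le_cos_of_nonneg_of_le_pi (by linarith [hψ.1]) (by linarith) hψ.2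
      · exact Real.cos_le_cos_of_nonneg_of_le_pi hφ.le (by linarith [hψ.2]) hψ.1
    refine rayInt_eq_rayInt (C := 2 * C + 2 * |a| + 4 * |b|) (by linarith [h.lt_pi])
      (fun t ht ψ hψ => ?_) fun t ht ht' ψ hψ => ?_
    · have hz := h.cpolar_mem (hcos ψ hψ) ht
      have h1 := h.differentiableAt_scalarRes (dualMul (R Complex.I) ℓ) hz
      have h2 : DifferentiableAt ℂ (fun z : ℂ => z / (1 - z ^ 2)) (cpolar t ψ) :=
        DifferentiableAt.div (by fun_prop) (by fun_prop) (hone _ hz)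
      exact ((differentiableAt_id.mul h1).sub_const _).add (h2.const_mul _)
    · have hz := h.cpolar_mem (hcos ψ hψ) ht
      have hzn := norm_cpolar ht.le ψ
      obtain ⟨h1, h2⟩ := b1 t ht ht' _ hzn
      have h3 := norm_div_one_sub_pow_four_le ht ht' hzn
      have h4 := hb _ (cpolar_ne_zero ht) (abs_re_cpolar_le (hcos ψ hψ) ht)
      rw [hzn] at h4
      rw [hHeq _ hz (norm_pos_iff.1 h1)]
      calc _ ≤ C / t * (t * (2 / (1 + t ^ 2))) + |a| * (2 / (1 + t ^ 2))
            + |b| * (4 / (1 + t ^ 2)) := by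
            refine (norm_add_le _ _).trans (add_le_add ((norm_sub_le _ _).trans
              (add_le_add ?_ ?_)) ?_)
            · rw [norm_mul, norm_mul, hzn]
              gcongr
            · rw [norm_mul, Complex.norm_real, Real.norm_eq_abs]
              gcongr
            · rw [norm_mul, Complex.norm_real, Real.norm_eq_abs]
              gcongr
        _ = _ := by field_simp
  have key (ψ : ℝ) (hψ : |Real.cos ψ| = Real.cos φ) : rayInt H ψ =
      rayInt (fun z => scalarRes R S ℓ z * (z * (1 + z ^ 2)⁻¹)) ψ
      - a * rayInt (fun z => (1 + z ^ 2)⁻¹) ψ + b * rayInt (fun z => 2 * z / (1 - z ^ 4)) ψ := by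
    have j1 := h.integrableOn_scalarRes_mul IsSymbol.div_one_add_sq hψ ℓ
    have j2 := integrableOn_ray (h := fun z => (1 + z ^ 2)⁻¹) (ψ := ψ) (C := 2)
      (fun t ht => (IsSymbol.differentiableAt_inv_one_add_sq
        (h.cpolar_re_ne_zero hψ ht)).continuousAt)
      fun t ht ht' => (b1 t ht ht' _ (norm_cpolar ht.le ψ)).2
    have hsin : Real.sin ψ ≠ 0 := by
      intro h0
      have h1 := Real.sin_sq_add_cos_sq ψ
      rw [h0, ← sq_abs (Real.cos ψ), hψ] at h1
      have h2 := Real.sin_sq_add_cos_sq φ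
      have h3 := Real.sin_pos_of_pos_of_lt_pi hφ (by linarith [h.lt_pi, Real.pi_pos])
      nlinarith
    have j3 := integrableOn_ray (h := fun z => 2 * z / (1 - z ^ 4)) (ψ := ψ) (C := 4)
      (fun t ht => ContinuousAt.div (by fun_prop) (by fun_prop)
        (one_sub_pow_four_ne_zero (h.cpolar_re_ne_zero hψ ht)
          (by rw [cpolar_im]; exact mul_ne_zero ht.ne' hsin)))
      fun t ht ht' => norm_div_one_sub_pow_four_le ht ht' (norm_cpolar ht.le ψ)
    simp only [rayInt]
    rw [← integral_const_mul, ← integral_const_mul, ← integral_sub j1 (j2.const_mul (a : ℂ))]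
    refine Eq.trans ?_ (integral_add (j1.sub (j2.const_mul (a : ℂ))) (j3.const_mul (b : ℂ)))
    refine setIntegral_congr_fun measurableSet_Ioi fun t ht => ?_
    simp only [hHeq _ (h.cpolar_mem hψ.le ht) (one_add_sq_ne_zero (h.cpolar_re_ne_zero hψ ht))]
    ring
  rw [← key φ h.abs_cos, ← key _ h.abs_cos_pi_sub, hrot]

/-- In imaginary parts the integrals of `(1 + z²)⁻¹` vanish, and those of `2z / (1 - z⁴)` are `π/2`
and `-π/2`. The difference `π ℓ(S)` cancels the normalization `1/π`. -/
theorem symbolOp_div_one_add_sq :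
    symbolOp R S φ (fun z => z * (1 + z ^ 2)⁻¹) = S Complex.I := by
  refine (SeparatingDual.eq_iff_forall_dual_eq (R := ℝ)).2 fun ℓ => ?_
  have hφ := h.pos.trans h.lt
  have hcp := h.cos_pos
  rw [h.dual_symbolOp IsSymbol.div_one_add_sq]
  have h1 := congrArg Complex.im (h.rayInt_scalarRes_mul_div_one_add_sq ℓ)
  obtain ⟨i1, i2⟩ := im_rayInt_eq_zero (h := fun z => (1 + z ^ 2)⁻¹) hφ.le h.lt_pi
    (fun z hz => IsSymbol.differentiableAt_inv_one_add_sq hz)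
    (fun z => by rw [conj_one_add_sq, map_inv₀])
    (fun z hz => norm_inv_one_add_sq_le hφ h.lt_pi hz)
  rw [rayInt_pi_sub (h := fun z => 2 * z / (1 - z ^ 4)), rayInt_two_mul_div hφ h.lt_pi] at h1
  · simp only [Complex.add_im, Complex.sub_im, Complex.im_ofReal_mul, i1, i2, map_mul,
      Complex.conj_ofReal, Complex.conj_I, Complex.neg_im, Complex.I_im] at h1
    have hpi := Real.pi_pos
    rw [one_div, inv_mul_eq_iff_eq_mul₀ hpi.ne']
    linarith
  · intro z
    have h4 : (-starRingEnd ℂ z) ^ 4 = starRingEnd ℂ z ^ 4 := by ring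
    simp only [h4, map_div₀, map_sub, map_mul, map_pow, map_one, map_ofNat]
    ring

theorem symbolOp_pow_div_one_add_sq (k : ℕ) :
    symbolOp R S φ (fun z => (z * (1 + z ^ 2)⁻¹) ^ (k + 1)) = S Complex.I ^ (k + 1) := by
  induction k with
  | zero => simpa using h.symbolOp_div_one_add_sq
  | succ k ih =>
    simp only [pow_succ _ (k + 1)]
    rw [h.symbolOp_mul_div_one_add_sq (IsSymbol.pow_div_one_add_sq k), ih, ← pow_succ', ← pow_succ]

/-- The scalar recursion `inv_pow_sub_inv_succ` is matched on the operator side by `S² = R - R²` at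
`z = i`. -/
theorem symbolOp_inv_pow_sub_inv (k : ℕ) :
    symbolOp R S φ (fun z => (1 + z ^ 2)⁻¹ ^ (k + 1) - (1 + z ^ 2)⁻¹) =
      R Complex.I ^ (k + 1) - R Complex.I := by
  induction k with
  | zero => simp [symbolOp, rayOp, rayOpIntegrand]
  | succ k ih =>
    have hq := IsSymbol.div_one_add_sq
    have hg := IsSymbol.inv_pow_sub_inv k
    simp only [inv_pow_sub_inv_succ]
    rw [h.symbolOp_add hg.mul_inv_one_add_sq hq.mul_div_one_add_sq.neg, symbolOp_neg,
      h.symbolOp_mul_inv_one_add_sq hg, ih, h.symbolOp_mul_div_one_add_sq hq,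
      h.symbolOp_div_one_add_sq, h.snd_mul_snd _ h.I_mem _ h.I_mem]
    simp only [Complex.I_re, Complex.norm_I, mul_zero, zero_smul, one_pow, one_smul, add_zero,
      mul_sub, ← pow_succ']
    abel

end

end IsSectorialResolvent

end CliffordHInfty
end

noncomputable section

namespace CliffordHInfty

open MeasureTheory Set

/-! ### Slice hyperholomorphic functions from holomorphic ones -/

variable {n : ℕ} {θ : ℝ}

theorem exists_planeEmb_of_mem_doubleSector (hθ : 0 < θ) (hθ2 : θ < Real.pi / 2) {s : Cl n}
    (hs : s ∈ doubleSector n θ) :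
    ∃ J ∈ sphere n, ∃ z : ℂ, Real.cos θ * ‖z‖ < |z.re| ∧ s = planeEmb J z := by
  have h := norm_re_gt_of_mem_doubleSector hθ hθ2 hs
  obtain ⟨J, hJ, t, ht, φ, hφ, rfl⟩ := hs
  refine ⟨J, hJ, _, ?_, polar_eq_planeEmb J t φ⟩
  rwa [polar_eq_planeEmb, norm_planeEmb hJ, planeEmb_empty hJ] at h

theorem re_ne_zero_of_lt (hθ : 0 < θ) (hθ2 : θ < Real.pi / 2) {z : ℂ}
    (hz : Real.cos θ * ‖z‖ < |z.re|) : z.re ≠ 0 :=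
  abs_pos.1 (lt_of_le_of_lt (mul_nonneg (cos_pos_of_lt hθ hθ2).le (norm_nonneg z)) hz)

theorem polar_mem_doubleSector {J : Cl n} (hJ : J ∈ sphere n) {t φ : ℝ} (ht : 0 < t)
    (hφ : φ ∈ angles θ) : polar J t φ ∈ doubleSector n θ := ⟨J, hJ, t, ht, φ, hφ, rfl⟩

theorem norm_polar {J : Cl n} (hJ : J ∈ sphere n) {t : ℝ} (ht : 0 ≤ t) (φ : ℝ) :
    ‖polar J t φ‖ = t := by
  rw [polar_eq_planeEmb, norm_planeEmb hJ]
  exact norm_cpolar ht φ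

theorem abs_re_cpolar_gt (hn : 1 ≤ n) (hθ : 0 < θ) (hθ2 : θ < Real.pi / 2) {t φ : ℝ} (ht : 0 < t)
    (hφ : φ ∈ angles θ) : Real.cos θ * ‖cpolar t φ‖ < |(cpolar t φ).re| := by
  obtain ⟨J, hJ⟩ := sphere_nonempty hn
  have h := norm_re_gt_of_mem_doubleSector hθ hθ2 (polar_mem_doubleSector hJ ht hφ)
  rwa [polar_eq_planeEmb, norm_planeEmb hJ, planeEmb_empty hJ] at h

/-- A holomorphic function, as a function of the real coordinates. -/
def coordFun (m : ℂ → ℂ) (p : ℝ × ℝ) : ℂ := m ⟨p.1, p.2⟩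

theorem coordFun_eq (m : ℂ → ℂ) : coordFun m = m ∘ Complex.equivRealProdCLM.symm := rfl

theorem hasFDerivAt_coordFun {m : ℂ → ℂ} {p : ℝ × ℝ}
    (hm : DifferentiableAt ℂ m ⟨p.1, p.2⟩) :
    ∃ d : ℂ, ∃ L : ℝ × ℝ →L[ℝ] ℂ, HasFDerivAt (coordFun m) L p ∧ L (1, 0) = d ∧
      L (0, 1) = d * Complex.I := by
  have h1 : HasFDerivAt m ((fderiv ℂ m ⟨p.1, p.2⟩).restrictScalars ℝ)
      (Complex.equivRealProdCLM.symm p) := hm.hasFDerivAt.restrictScalars ℝ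
  refine ⟨deriv m ⟨p.1, p.2⟩, _, h1.comp p
    Complex.equivRealProdCLM.symm.toContinuousLinearMap.hasFDerivAt, ?_, ?_⟩
  · have : (Complex.equivRealProdCLM.symm (1, 0) : ℂ) = 1 := rfl
    simp [this]
  · have : (Complex.equivRealProdCLM.symm (0, 1) : ℂ) = Complex.I := rfl
    simp [this, mul_comm]

theorem contDiffOn_coordFun {m : ℂ → ℂ} (hm : ∀ z : ℂ, z.re ≠ 0 → DifferentiableAt ℂ m z) :
    ContDiffOn ℝ 1 (coordFun m) {p | p.1 ≠ 0} := by
  have ho : IsOpen {z : ℂ | z.re ≠ 0} := isOpen_ne.preimage Complex.continuous_re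
  have h1 : ContDiffOn ℂ 1 m {z : ℂ | z.re ≠ 0} :=
    DifferentiableOn.contDiffOn (fun z hz => (hm z hz).differentiableWithinAt) ho
  rw [coordFun_eq]
  exact (h1.restrict_scalars ℝ).comp
    Complex.equivRealProdCLM.symm.toContinuousLinearMap.contDiff.contDiffOn fun p hp => hp

theorem planeSet_fst_ne_zero (hn : 1 ≤ n) (hθ : 0 < θ) (hθ2 : θ < Real.pi / 2) {p : ℝ × ℝ}
    (hp : p ∈ planeSet (doubleSector n θ)) : p.1 ≠ 0 :=
  re_ne_zero_of_lt hθ hθ2 (z := ⟨p.1, p.2⟩) ((mem_planeSet_iff hn hθ hθ2 p).1 hp)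

theorem isLeftSlice_const (U : Set (Cl n)) (c : Cl n) :
    IsLeftSlice U (fun _ => c) (fun _ => c) (fun _ => 0) where
  contDiffOn_fst := contDiffOn_const
  contDiffOn_snd := contDiffOn_const
  repr p _ J _ := by simp
  even p _ := rfl
  odd p _ := by simp
  cauchyRiemann_fst p _ := by simp
  cauchyRiemann_snd p _ := by simp

theorem IsLeftSlice.differentiableAt {f f₀ f₁ : _} (hn : 1 ≤ n) (hθ : 0 < θ)
    (hθ2 : θ < Real.pi / 2) (hf : IsLeftSlice (doubleSector n θ) f f₀ f₁) {p : ℝ × ℝ}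
    (hp : p ∈ planeSet (doubleSector n θ)) :
    DifferentiableAt ℝ f₀ p ∧ DifferentiableAt ℝ f₁ p := by
  have ho := (isOpen_planeSet hn hθ hθ2).mem_nhds hp
  exact ⟨(hf.contDiffOn_fst.contDiffAt ho).differentiableAt one_ne_zero,
    (hf.contDiffOn_snd.contDiffAt ho).differentiableAt one_ne_zero⟩

theorem IsLeftSlice.sub {f f₀ f₁ g g₀ g₁ : _} (hn : 1 ≤ n) (hθ : 0 < θ) (hθ2 : θ < Real.pi / 2)
    (hf : IsLeftSlice (doubleSector n θ) f f₀ f₁) (hg : IsLeftSlice (doubleSector n θ) g g₀ g₁) :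
    IsLeftSlice (doubleSector n θ) (fun s => f s - g s) (fun p => f₀ p - g₀ p)
      (fun p => f₁ p - g₁ p) where
  contDiffOn_fst := hf.contDiffOn_fst.sub hg.contDiffOn_fst
  contDiffOn_snd := hf.contDiffOn_snd.sub hg.contDiffOn_snd
  repr p hp J hJ := by
    simp only [hf.repr p hp J hJ, hg.repr p hp J hJ, mul_sub]
    abel
  even p hp := by simp only [hf.even p hp, hg.even p hp]
  odd p hp := by
    simp only [hf.odd p hp, hg.odd p hp]
    abel
  cauchyRiemann_fst p hp := by
    obtain ⟨h1, h2⟩ := hf.differentiableAt hn hθ hθ2 hp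
    obtain ⟨h3, h4⟩ := hg.differentiableAt hn hθ hθ2 hp
    rw [fderiv_fun_sub h1 h3, fderiv_fun_sub h2 h4, sub_apply, sub_apply,
      hf.cauchyRiemann_fst p hp, hg.cauchyRiemann_fst p hp]
  cauchyRiemann_snd p hp := by
    obtain ⟨h1, h2⟩ := hf.differentiableAt hn hθ hθ2 hp
    obtain ⟨h3, h4⟩ := hg.differentiableAt hn hθ hθ2 hp
    rw [fderiv_fun_sub h1 h3, fderiv_fun_sub h2 h4, sub_apply, sub_apply,
      hf.cauchyRiemann_snd p hp, hg.cauchyRiemann_snd p hp]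
    abel

/-- The product of an intrinsic function and a slice hyperholomorphic function. -/
theorem IsLeftSlice.intrinsic_mul {f f₀ f₁ F : _} {m : ℂ → ℂ} (hn : 1 ≤ n) (hθ : 0 < θ)
    (hθ2 : θ < Real.pi / 2) (hf : IsLeftSlice (doubleSector n θ) f f₀ f₁)
    (hd : ∀ z : ℂ, z.re ≠ 0 → DifferentiableAt ℂ m z)
    (hc : ∀ z, m (starRingEnd ℂ z) = starRingEnd ℂ (m z))
    (hF : ∀ J ∈ sphere n, ∀ z : ℂ, z.re ≠ 0 →
      F (planeEmb J z) = planeEmb J (m z) * f (planeEmb J z)) :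
    IsLeftSlice (doubleSector n θ) F
      (fun p => (coordFun m p).re • f₀ p - (coordFun m p).im • f₁ p)
      (fun p => (coordFun m p).re • f₁ p + (coordFun m p).im • f₀ p) := by
  have hne {p : ℝ × ℝ} (hp : p ∈ planeSet (doubleSector n θ)) : p.1 ≠ 0 :=
    planeSet_fst_ne_zero hn hθ hθ2 hp
  have hm := (contDiffOn_coordFun hd).mono fun p hp => hne hp
  have hre : ContDiffOn ℝ 1 (fun p => (coordFun m p).re) (planeSet (doubleSector n θ)) :=
    Complex.reCLM.contDiff.comp_contDiffOn hm
  have him : ContDiffOn ℝ 1 (fun p => (coordFun m p).im) (planeSet (doubleSector n θ)) :=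
    Complex.imCLM.contDiff.comp_contDiffOn hm
  have hconj (p : ℝ × ℝ) : coordFun m (p.1, -p.2) = starRingEnd ℂ (coordFun m p) :=
    hc ⟨p.1, p.2⟩
  -- Here `d` is the complex derivative of `m`, with `∂_y m = i ∂_x m`. The product rule then leaves
  -- only the Cauchy-Riemann equations of `f₀`, `f₁`. The real coefficients commute with `J`, which
  -- is why the factor `m` must be intrinsic.
  have hder {p : ℝ × ℝ} (hp : p ∈ planeSet (doubleSector n θ)) : ∃ d : ℂ,
      (fderiv ℝ (fun p => (coordFun m p).re • f₀ p - (coordFun m p).im • f₁ p) p (1, 0) =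
        ((coordFun m p).re • fderiv ℝ f₀ p (1, 0) + d.re • f₀ p) -
        ((coordFun m p).im • fderiv ℝ f₁ p (1, 0) + d.im • f₁ p)) ∧
      (fderiv ℝ (fun p => (coordFun m p).re • f₀ p - (coordFun m p).im • f₁ p) p (0, 1) =
        ((coordFun m p).re • fderiv ℝ f₀ p (0, 1) + (-d.im) • f₀ p) -
        ((coordFun m p).im • fderiv ℝ f₁ p (0, 1) + d.re • f₁ p)) ∧
      (fderiv ℝ (fun p => (coordFun m p).re • f₁ p + (coordFun m p).im • f₀ p) p (1, 0) =
        ((coordFun m p).re • fderiv ℝ f₁ p (1, 0) + d.re • f₁ p) +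
        ((coordFun m p).im • fderiv ℝ f₀ p (1, 0) + d.im • f₀ p)) ∧
      (fderiv ℝ (fun p => (coordFun m p).re • f₁ p + (coordFun m p).im • f₀ p) p (0, 1) =
        ((coordFun m p).re • fderiv ℝ f₁ p (0, 1) + (-d.im) • f₁ p) +
        ((coordFun m p).im • fderiv ℝ f₀ p (0, 1) + d.re • f₀ p)) := by
    obtain ⟨d, L, hL, hL1, hL2⟩ := hasFDerivAt_coordFun (hd ⟨p.1, p.2⟩ (hne hp))
    obtain ⟨h1, h2⟩ := hf.differentiableAt hn hθ hθ2 hp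
    have hLr : HasFDerivAt (fun p => (coordFun m p).re) (Complex.reCLM ∘L L) p :=
      Complex.reCLM.hasFDerivAt.comp p hL
    have hLi : HasFDerivAt (fun p => (coordFun m p).im) (Complex.imCLM ∘L L) p :=
      Complex.imCLM.hasFDerivAt.comp p hL
    have e1 := ((hLr.smul h1.hasFDerivAt).sub (hLi.smul h2.hasFDerivAt)).fderiv
    have e2 := ((hLr.smul h2.hasFDerivAt).add (hLi.smul h1.hasFDerivAt)).fderiv
    refine ⟨d, ?_, ?_, ?_, ?_⟩
    · refine (congrArg (fun L : ℝ × ℝ →L[ℝ] Cl n => L (1, 0)) e1).trans ?_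
      simp [hL1]
    · refine (congrArg (fun L : ℝ × ℝ →L[ℝ] Cl n => L (0, 1)) e1).trans ?_
      simp [hL2]
    · refine (congrArg (fun L : ℝ × ℝ →L[ℝ] Cl n => L (1, 0)) e2).trans ?_
      simp [hL1]
    · refine (congrArg (fun L : ℝ × ℝ →L[ℝ] Cl n => L (0, 1)) e2).trans ?_
      simp [hL2]
  exact
  { contDiffOn_fst := (hre.smul hf.contDiffOn_fst).sub (him.smul hf.contDiffOn_snd)
    contDiffOn_snd := (hre.smul hf.contDiffOn_snd).add (him.smul hf.contDiffOn_fst)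
    repr := fun p hp J hJ => by
      change F (planeEmb J ⟨p.1, p.2⟩) = _
      rw [hF J hJ _ (hne hp)]
      change _ * f (p.1 • (1 : Cl n) + p.2 • J) = _
      rw [hf.repr p hp J hJ]
      change planeEmb J (coordFun m p) * _ = _
      simp only [planeEmb, add_mul, mul_add, smul_mul_assoc, mul_smul_comm, one_mul]
      rw [← mul_assoc J J, sphere_sq hJ, neg_one_mul]
      module
    even := fun p hp => by
      simp only [hconj, Complex.conj_re, Complex.conj_im, hf.even p hp, hf.odd p hp]
      module
    odd := fun p hp => by
      simp only [hconj, Complex.conj_re, Complex.conj_im, hf.even p hp, hf.odd p hp]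
      module
    cauchyRiemann_fst := fun p hp => by
      obtain ⟨d, h1, h2, h3, h4⟩ := hder hp
      rw [h1, h4, hf.cauchyRiemann_fst p hp, hf.cauchyRiemann_snd p hp]
      module
    cauchyRiemann_snd := fun p hp => by
      obtain ⟨d, h1, h2, h3, h4⟩ := hder hp
      rw [h2, h3, hf.cauchyRiemann_fst p hp, hf.cauchyRiemann_snd p hp]
      module }

theorem intrinsic_of_planeEmb {F : Cl n → Cl n} {m : ℂ → ℂ} (hn : 1 ≤ n) (hθ : 0 < θ)
    (hθ2 : θ < Real.pi / 2) (hd : ∀ z : ℂ, z.re ≠ 0 → DifferentiableAt ℂ m z)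
    (hc : ∀ z, m (starRingEnd ℂ z) = starRingEnd ℂ (m z))
    (hF : ∀ J ∈ sphere n, ∀ z : ℂ, z.re ≠ 0 → F (planeEmb J z) = planeEmb J (m z)) :
    F ∈ Intrinsic (doubleSector n θ) := by
  refine ⟨_, _, (isLeftSlice_const _ (1 : Cl n)).intrinsic_mul hn hθ hθ2 hd hc (F := F)
    (fun J hJ z hz => by rw [hF J hJ z hz, mul_one]), fun p _ => ⟨⟨(coordFun m p).re, ?_⟩,
      ⟨(coordFun m p).im, ?_⟩⟩⟩
  · simp
  · simp

theorem intrinsic_subset_SHL (U : Set (Cl n)) : Intrinsic U ⊆ SHL U :=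
  fun _ ⟨f₀, f₁, h, _⟩ => ⟨f₀, f₁, h⟩

/-! ### Boundedness and integrability along rays. -/

theorem continuousOn_ray (hn : 1 ≤ n) (hθ : 0 < θ) (hθ2 : θ < Real.pi / 2) {F : Cl n → Cl n}
    (hF : F ∈ SHL (doubleSector n θ)) {J : Cl n} (hJ : J ∈ sphere n) {φ : ℝ} (hφ : φ ∈ angles θ) :
    ContinuousOn (fun t => F (polar J t φ)) (Ioi 0) := by
  obtain ⟨f₀, f₁, hf⟩ := hF
  have hp : MapsTo (fun t : ℝ => (t * Real.cos φ, t * Real.sin φ)) (Ioi 0)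
      (planeSet (doubleSector n θ)) := by
    intro t ht
    rw [mem_planeSet_iff hn hθ hθ2]
    have := abs_re_cpolar_gt hn hθ hθ2 ht hφ
    have he : cpolar t φ = ⟨t * Real.cos φ, t * Real.sin φ⟩ :=
      Complex.ext (cpolar_re t φ) (cpolar_im t φ)
    rwa [he] at this
  have hc : ContinuousOn (fun t : ℝ => (t * Real.cos φ, t * Real.sin φ)) (Ioi 0) := by fun_prop
  have h0 := hf.contDiffOn_fst.continuousOn.comp hc hp
  have h1 := hf.contDiffOn_snd.continuousOn.comp hc hp
  have hJc : Continuous fun x : Cl n => J * x := (mulCL n J).continuous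
  refine (h0.add (hJc.comp_continuousOn h1)).congr fun t ht => ?_
  exact hf.repr _ (hp ht) J hJ

theorem continuousOn_norm_ray_div (hn : 1 ≤ n) (hθ : 0 < θ) (hθ2 : θ < Real.pi / 2)
    {F : Cl n → Cl n} (hF : F ∈ SHL (doubleSector n θ)) {J : Cl n} (hJ : J ∈ sphere n) {φ : ℝ}
    (hφ : φ ∈ angles θ) : ContinuousOn (fun t => ‖F (polar J t φ)‖ / t) (Ioi 0) :=
  (continuousOn_ray hn hθ hθ2 hF hJ hφ).norm.div continuousOn_id fun _ ht => ne_of_gt ht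

theorem boundedAndDini_of_norm_le (hn : 1 ≤ n) (hθ : 0 < θ) (hθ2 : θ < Real.pi / 2)
    {F : Cl n → Cl n} (hF : F ∈ SHL (doubleSector n θ)) {C : ℝ} (hC : 0 ≤ C)
    (hb : ∀ s ∈ doubleSector n θ, ‖F s‖ ≤ C * ‖s‖ / (1 + ‖s‖ ^ 2)) : BoundedAndDini θ F := by
  refine ⟨⟨C, fun s hs => (hb s hs).trans ?_⟩, fun J hJ φ hφ => ?_⟩
  · rw [mul_div_assoc]
    refine mul_le_of_le_one_right hC ?_
    rw [div_le_one (by positivity)]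
    nlinarith [sq_nonneg (‖s‖ - 1)]
  · refine integrableOn_Ioi_of_norm_le (C := C) (continuousOn_norm_ray_div hn hθ hθ2 hF hJ hφ)
      fun t ht _ => ?_
    have := hb _ (polar_mem_doubleSector hJ ht hφ)
    rw [norm_polar hJ ht.le] at this
    rw [norm_div, norm_norm, Real.norm_of_nonneg ht.le, div_le_iff₀ ht]
    refine this.trans (le_of_eq ?_)
    ring

/-- Boundedness and the Dini condition for a function which decays like `1 / |s|²` at infinity and
satisfies the Dini condition at `0`. -/
theorem boundedAndDini_of_norm_le_of_integrableOn (hn : 1 ≤ n) (hθ : 0 < θ)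
    (hθ2 : θ < Real.pi / 2) {F : Cl n → Cl n} (hF : F ∈ SHL (doubleSector n θ)) {C r : ℝ}
    (hC : 0 ≤ C) (hr : 0 < r)
    (hb : ∀ s ∈ doubleSector n θ, ‖F s‖ ≤ C / (1 + ‖s‖ ^ 2))
    (hi : ∀ J ∈ sphere n, ∀ φ ∈ angles θ,
      IntegrableOn (fun t : ℝ => ‖F (polar J t φ)‖ / t) (Ioo 0 r)) : BoundedAndDini θ F := by
  refine ⟨⟨C, fun s hs => (hb s hs).trans ?_⟩, fun J hJ φ hφ => ?_⟩
  · exact div_le_self hC (by nlinarith [sq_nonneg ‖s‖])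
  · rw [← Ioo_union_Ici_eq_Ioi hr]
    refine (hi J hJ φ hφ).union ?_
    refine Integrable.mono' (integrableOn_inv_one_add_sq (Ici r) (C / r)) ?_ ?_
    · exact ((continuousOn_norm_ray_div hn hθ hθ2 hF hJ hφ).mono fun t ht =>
        lt_of_lt_of_le hr ht).aestronglyMeasurable measurableSet_Ici
    · refine (ae_restrict_iff' measurableSet_Ici).2 (Filter.Eventually.of_forall fun t ht => ?_)
      have ht' : 0 < t := lt_of_lt_of_le hr ht
      have := hb _ (polar_mem_doubleSector hJ ht' hφ)
      rw [norm_polar hJ ht'.le] at this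
      rw [norm_div, norm_norm, Real.norm_of_nonneg ht'.le]
      calc ‖F (polar J t φ)‖ / t ≤ C / (1 + t ^ 2) / r :=
            div_le_div₀ (by positivity) this hr ht
        _ = C / r / (1 + t ^ 2) := by rw [div_right_comm]

theorem norm_le_of_planeEmb {F : Cl n → Cl n} {g : ℂ → ℂ} (hθ : 0 < θ) (hθ2 : θ < Real.pi / 2)
    (hg : IsSymbol g) (hF : ∀ J ∈ sphere n, ∀ z : ℂ, z.re ≠ 0 → F (planeEmb J z) = planeEmb J (g z)) :
    ∃ C, 0 ≤ C ∧ ∀ s ∈ doubleSector n θ, ‖F s‖ ≤ C * ‖s‖ / (1 + ‖s‖ ^ 2) := by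
  obtain ⟨C, hC, hb⟩ := hg.bound θ hθ hθ2
  refine ⟨C, hC, fun s hs => ?_⟩
  obtain ⟨J, hJ, z, hz, rfl⟩ := exists_planeEmb_of_mem_doubleSector hθ hθ2 hs
  rw [hF J hJ z (re_ne_zero_of_lt hθ hθ2 hz), norm_planeEmb hJ, norm_planeEmb hJ]
  exact hb z hz.le

theorem mem_Nzero_of_planeEmb {F : Cl n → Cl n} {g : ℂ → ℂ} (hn : 1 ≤ n) (hθ : 0 < θ)
    (hθ2 : θ < Real.pi / 2) (hg : IsSymbol g)
    (hF : ∀ J ∈ sphere n, ∀ z : ℂ, z.re ≠ 0 → F (planeEmb J z) = planeEmb J (g z)) :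
    F ∈ Nzero n θ := by
  have h1 := intrinsic_of_planeEmb hn hθ hθ2 hg.differentiableAt hg.conj hF
  obtain ⟨C, hC, hb⟩ := norm_le_of_planeEmb hθ hθ2 hg hF
  exact ⟨h1, boundedAndDini_of_norm_le hn hθ hθ2 (intrinsic_subset_SHL _ h1) hC hb⟩

/-! ### Uniqueness of the coefficients -/

/-- A nonzero limit would make `1/t` integrable near `0`. The next such lemma uses the divergence at
infinity. -/
theorem eq_zero_of_dini_of_tendsto_zero {F : Type*} [NormedAddCommGroup F] {D : ℝ → F} {a : F}
    (hD : IntegrableOn (fun t => ‖D t‖ / t) (Ioi 0))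
    (ha : Filter.Tendsto D (nhdsWithin 0 (Ioi 0)) (nhds a)) : a = 0 := by
  by_contra h
  have hpos : 0 < ‖a‖ := norm_pos_iff.2 h
  have hev : ∀ᶠ t in nhdsWithin 0 (Ioi 0), ‖a‖ / 2 < ‖D t‖ :=
    ha.norm.eventually_const_lt (by linarith)
  obtain ⟨δ, hδ, hsub⟩ := mem_nhdsGT_iff_exists_Ioc_subset.1 hev
  have hi : IntegrableOn (fun t : ℝ => t⁻¹) (Ioc 0 δ) := by
    refine Integrable.mono' ((hD.mono_set Ioc_subset_Ioi_self).const_mul (2 / ‖a‖))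
      measurable_inv.aestronglyMeasurable ?_
    refine (ae_restrict_iff' measurableSet_Ioc).2 (Filter.Eventually.of_forall fun t ht => ?_)
    have h1 : ‖a‖ / 2 < ‖D t‖ := hsub ht
    have ht' : 0 < t := ht.1
    rw [Real.norm_of_nonneg (inv_nonneg.2 ht'.le), div_mul_div_comm, le_div_iff₀ (by positivity),
      mul_comm, mul_assoc, mul_inv_cancel₀ ht'.ne']
    linarith
  have h2 := (intervalIntegrable_iff_integrableOn_Ioc_of_le (le_of_lt hδ)).2 hi
  rw [intervalIntegrable_inv_iff] at h2
  rcases h2 with h2 | h2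
  · exact absurd h2 (ne_of_lt hδ)
  · exact h2 left_mem_uIcc

theorem eq_zero_of_dini_of_tendsto_atTop {F : Type*} [NormedAddCommGroup F] {D : ℝ → F} {a : F}
    (hD : IntegrableOn (fun t => ‖D t‖ / t) (Ioi 0))
    (ha : Filter.Tendsto D Filter.atTop (nhds a)) : a = 0 := by
  by_contra h
  have hpos : 0 < ‖a‖ := norm_pos_iff.2 h
  have hev : ∀ᶠ t in Filter.atTop, ‖a‖ / 2 < ‖D t‖ := ha.norm.eventually_const_lt (by linarith)
  obtain ⟨N, hN⟩ := Filter.eventually_atTop.1 (hev.and (Filter.eventually_gt_atTop 0))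
  refine not_integrableOn_Ioi_inv (a := N) ?_
  have hsub : Ioi N ⊆ Ioi (0 : ℝ) := fun t ht => (hN t (le_of_lt ht)).2
  refine Integrable.mono' ((hD.mono_set hsub).const_mul (2 / ‖a‖))
    measurable_inv.aestronglyMeasurable ?_
  refine (ae_restrict_iff' measurableSet_Ioi).2 (Filter.Eventually.of_forall fun t ht => ?_)
  obtain ⟨h1, ht'⟩ := hN t (le_of_lt ht)
  rw [Real.norm_of_nonneg (inv_nonneg.2 ht'.le), div_mul_div_comm, le_div_iff₀ (by positivity),
    mul_comm, mul_assoc, mul_inv_cancel₀ ht'.ne']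
  linarith

theorem inverse_one_add_sq_planeEmb {J : Cl n} (hJ : J ∈ sphere n) {z : ℂ} (hz : z.re ≠ 0) :
    Ring.inverse (1 + planeEmb J z ^ 2) = planeEmb J (1 + z ^ 2)⁻¹ := by
  rw [← planeEmb_inv hJ (one_add_sq_ne_zero hz), planeEmb_add, planeEmb_one, planeEmb_pow hJ]

/-- On the positive real axis two remainders of `f` differ by an explicit `D`, whose limits at `0`
and at infinity are the differences of the coefficients; the Dini condition forces both to vanish.
Hence the coefficients picked by choice in `extCalculus` may be replaced by any known ones. -/
theorem coeff_unique (hn : 1 ≤ n) (hθ : 0 < θ) {f : Cl n → Cl n} {c c' : Cl n × Cl n}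
    (h : remainder f c.1 c.2 ∈ SHLzero n θ) (h' : remainder f c'.1 c'.2 ∈ SHLzero n θ) : c = c' := by
  obtain ⟨J, hJ⟩ := sphere_nonempty hn
  have h0 : (0 : ℝ) ∈ angles θ := Or.inl ⟨by linarith, hθ⟩
  set D : ℝ → Cl n := fun t =>
    (c'.2 - c.2) + (1 + t ^ 2)⁻¹ • ((c'.1 - c'.2) - (c.1 - c.2)) with hD
  have hDc : Continuous D := by
    have : Continuous fun t : ℝ => (1 + t ^ 2)⁻¹ :=
      Continuous.inv₀ (by fun_prop) fun t => by positivity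
    fun_prop
  have hDe (t : ℝ) (ht : 0 < t) : D t =
      remainder f c.1 c.2 (polar J t 0) - remainder f c'.1 c'.2 (polar J t 0) := by
    have hp : polar J t 0 = planeEmb J (t : ℂ) := by simp [polar, planeEmb]
    have hinv : planeEmb J (1 + (t : ℂ) ^ 2)⁻¹ = (1 + t ^ 2)⁻¹ • (1 : Cl n) := by
      have : ((1 + (t : ℂ) ^ 2)⁻¹ : ℂ) = (((1 + t ^ 2)⁻¹ : ℝ) : ℂ) := by push_cast; rfl
      rw [this, planeEmb, Complex.ofReal_re, Complex.ofReal_im, zero_smul, add_zero]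
    simp only [remainder, hp]
    rw [inverse_one_add_sq_planeEmb hJ (by simpa using ht.ne'), hinv]
    simp only [hD, smul_mul_assoc, one_mul]
    module
  have hDi : IntegrableOn (fun t => ‖D t‖ / t) (Ioi 0) := by
    refine Integrable.mono' ((h.2.2 J hJ 0 h0).add (h'.2.2 J hJ 0 h0)) ?_ ?_
    · exact (hDc.norm.continuousOn.div continuousOn_id fun t ht =>
        ne_of_gt ht).aestronglyMeasurable measurableSet_Ioi
    · refine (ae_restrict_iff' measurableSet_Ioi).2 (Filter.Eventually.of_forall fun t ht => ?_)
      have ht' : 0 < t := ht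
      rw [norm_div, norm_norm, Real.norm_of_nonneg ht'.le, hDe t ht', Pi.add_apply, ← add_div]
      exact div_le_div_of_nonneg_right (norm_sub_le _ _) ht'.le
  have e1 : c'.1 - c.1 = 0 := by
    refine eq_zero_of_dini_of_tendsto_zero hDi ?_
    have := (hDc.tendsto 0).mono_left (nhdsWithin_le_nhds (s := Ioi 0))
    have h2 : D 0 = c'.1 - c.1 := by
      simp [hD]
      abel
    rwa [h2] at this
  have e2 : c'.2 - c.2 = 0 := by
    refine eq_zero_of_dini_of_tendsto_atTop hDi ?_
    have h2 : Filter.Tendsto (fun t : ℝ => (1 + t ^ 2)⁻¹) Filter.atTop (nhds 0) :=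
      Filter.Tendsto.inv_tendsto_atTop (Filter.tendsto_atTop_add_const_left _ _
        (Filter.tendsto_pow_atTop two_ne_zero))
    simpa using (h2.smul_const ((c'.1 - c'.2) - (c.1 - c.2))).const_add (c'.2 - c.2)
  exact Prod.ext (sub_eq_zero.1 e1).symm (sub_eq_zero.1 e2).symm

end CliffordHInfty
end

noncomputable section

namespace CliffordHInfty

open MeasureTheory Set

variable {n : ℕ} {E : Type*} [NormedAddCommGroup E] [NormedSpace ℝ E]

/-! ### The `ω`-functional calculus of intrinsic functions -/

theorem isSectorialResolvent_quadInv [CompleteSpace E] (hn : 1 ≤ n)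
    {T : CMod n E →ₗ.[ℝ] CMod n E} {ω φ : ℝ} (hω : 0 < ω) (hωφ : ω < φ) (hφ : φ < Real.pi / 2)
    (hT : IsBisectorial T ω) :
    IsSectorialResolvent ω φ (fun z => quadInv T z.re (‖z‖ ^ 2))
      (fun z => opComp T (quadInv T z.re (‖z‖ ^ 2))) where
  toIsPseudoResolvent := isPseudoResolvent_quadInv hn hω (hωφ.trans hφ) hT
  pos := hω
  lt := hωφ
  lt_pi := hφ
  bound := exists_bound_quadInv hn hω hωφ hφ hT

theorem resolvent_mul_expand {𝔅 : Type*} [Ring 𝔅] [Algebra ℝ 𝔅] {j : 𝔅} (hj : j * j = -1)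
    (R S : 𝔅) (x y p q : ℝ) :
    (x • R - y • (R * j) - S) * (p • (1 : 𝔅) + q • j) =
      ((x * p + y * q) • R - p • S) + ((x * q - y * p) • R - q • S) * j := by
  have h : R * j * j = -R := by rw [mul_assoc, hj, mul_neg, mul_one]
  simp only [mul_add, sub_mul, smul_mul_assoc, mul_smul_comm, mul_one, h]
  module

/-- `c` is the complex form of `ds_J f(s)`, and `z̄ c = -i t g(z)`. So the part free of `j` is the
integrand of `g`, and the coefficient of `j` is, up to sign, that of `i g`. -/
theorem rayOpIntegrand_eq {𝔅 : Type*} [NormedRing 𝔅] [NormedAlgebra ℝ 𝔅] (R S : ℂ → 𝔅)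
    (g : ℂ → ℂ) (j : 𝔅) (ψ t : ℝ) {z c : ℂ} (hz : z = cpolar t ψ)
    (hc : c = -Complex.I * (Complex.exp (ψ * Complex.I) * g z)) :
    ((z.re * c.re + z.im * c.im) • R z - c.re • S z) +
        ((z.re * c.im - z.im * c.re) • R z - c.im • S z) * j =
      rayOpIntegrand R S g ψ t - rayOpIntegrand R S (fun z => Complex.I * g z) ψ t * j := by
  have hzc : starRingEnd ℂ z * c = -Complex.I * (t * g z) := by
    have hn : starRingEnd ℂ (Complex.exp (ψ * Complex.I)) * Complex.exp (ψ * Complex.I) = 1 := by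
      rw [mul_comm, Complex.mul_conj, Complex.normSq_eq_norm_sq, Complex.norm_exp_ofReal_mul_I]
      simp
    have : starRingEnd ℂ z = t * starRingEnd ℂ (Complex.exp (ψ * Complex.I)) := by
      rw [hz, cpolar, map_mul, Complex.conj_ofReal]
    rw [this, hc]
    linear_combination (-Complex.I * t * g z) * hn
  have hre := congrArg Complex.re hzc
  have him := congrArg Complex.im hzc
  have hcre := congrArg Complex.re hc
  have hcim := congrArg Complex.im hc
  simp only [Complex.mul_re, Complex.mul_im, Complex.conj_re, Complex.conj_im, Complex.neg_re,
    Complex.neg_im, Complex.I_re, Complex.I_im, Complex.ofReal_re, Complex.ofReal_im] at hre him hcre hcim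
  have e1 : z.re * c.re + z.im * c.im = t * (g z).im := by linarith
  have e2 : z.re * c.im - z.im * c.re = -(t * (g z).re) := by linarith
  have e3 : c.re = (Complex.exp (ψ * Complex.I) * g z).im := by
    rw [Complex.mul_im]; linarith
  have e4 : c.im = -(Complex.exp (ψ * Complex.I) * (Complex.I * g z)).im := by
    rw [mul_left_comm, Complex.I_mul_im, Complex.mul_re]; linarith
  have e5 : (z.re * c.im - z.im * c.re) • R z - c.im • S z =
      -rayOpIntegrand R S (fun z => Complex.I * g z) ψ t := by
    rw [e2, e4, rayOpIntegrand, ← hz, Complex.I_mul_im]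
    module
  rw [e5, e1, e3, neg_mul, ← sub_eq_add_neg]
  congr 1
  rw [rayOpIntegrand, ← hz]

theorem rayIntegral_eq (T : CMod n E →ₗ.[ℝ] CMod n E) {J : Cl n} (hJ : J ∈ sphere n) {ψ : ℝ}
    (hψ : Real.cos ψ ≠ 0) {F : Cl n → Cl n} {g : ℂ → ℂ}
    (hF : ∀ z : ℂ, z.re ≠ 0 → F (planeEmb J z) = planeEmb J (g z)) :
    rayIntegral T J ψ F = ∫ t in Ioi (0 : ℝ),
      (rayOpIntegrand (fun z => quadInv T z.re (‖z‖ ^ 2))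
          (fun z => opComp T (quadInv T z.re (‖z‖ ^ 2))) g ψ t -
        rayOpIntegrand (fun z => quadInv T z.re (‖z‖ ^ 2))
          (fun z => opComp T (quadInv T z.re (‖z‖ ^ 2))) (fun z => Complex.I * g z) ψ t *
          lmul J) := by
  refine setIntegral_congr_fun measurableSet_Ioi fun t ht => ?_
  have hre : (cpolar t ψ).re ≠ 0 := by
    rw [cpolar_re]
    exact mul_ne_zero (ne_of_gt ht) hψ
  have h1 : polar J t ψ = planeEmb J (cpolar t ψ) := polar_eq_planeEmb J t ψ
  have h2 : polar J 1 ψ = planeEmb J (Complex.exp (ψ * Complex.I)) := by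
    rw [polar_eq_planeEmb, Complex.ofReal_one, one_mul]
  have h3 : -J = planeEmb J (-Complex.I) := by simp [planeEmb]
  have h4 : polar J 1 ψ * (-J) * F (polar J t ψ) =
      planeEmb J (-Complex.I * (Complex.exp (ψ * Complex.I) * g (cpolar t ψ))) := by
    rw [h1, h2, h3, hF _ hre, ← planeEmb_mul hJ, ← planeEmb_mul hJ]
    congr 1
    ring
  have h5 := resolvent_mul_expand (lmul_sphere_sq (E := E) hJ)
    (quadInv T (cpolar t ψ).re (‖cpolar t ψ‖ ^ 2))
    (opComp T (quadInv T (cpolar t ψ).re (‖cpolar t ψ‖ ^ 2))) (cpolar t ψ).re (cpolar t ψ).im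
    (-Complex.I * (Complex.exp (ψ * Complex.I) * g (cpolar t ψ))).re
    (-Complex.I * (Complex.exp (ψ * Complex.I) * g (cpolar t ψ))).im
  have h6 := rayOpIntegrand_eq (fun z => quadInv T z.re (‖z‖ ^ 2))
    (fun z => opComp T (quadInv T z.re (‖z‖ ^ 2))) g (lmul (E := E) J) ψ t rfl rfl
  refine Eq.trans ?_ (h5.trans h6)
  simp only [h4]
  rw [h1, resolventL_planeEmb T hJ, lmul_planeEmb]
  rfl

/-- Passing to the conjugate ray changes the sign of imaginary parts and keeps real parts.
Subtracting conjugate rays therefore doubles the term of `g` and cancels the term multiplied by `J`.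
-/
theorem rayOpIntegrand_conj {𝔅 : Type*} [NormedRing 𝔅] [NormedAlgebra ℝ 𝔅] {R S : ℂ → 𝔅}
    (hR : ∀ z, R (starRingEnd ℂ z) = R z) (hS : ∀ z, S (starRingEnd ℂ z) = S z) {g : ℂ → ℂ}
    (hg : ∀ z, g (starRingEnd ℂ z) = starRingEnd ℂ (g z)) {ψ ψ' : ℝ}
    (hψ : Complex.exp (ψ' * Complex.I) = starRingEnd ℂ (Complex.exp (ψ * Complex.I))) (t : ℝ) :
    rayOpIntegrand R S g ψ' t = -rayOpIntegrand R S g ψ t ∧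
    rayOpIntegrand R S (fun z => Complex.I * g z) ψ' t =
      rayOpIntegrand R S (fun z => Complex.I * g z) ψ t := by
  have hz : cpolar t ψ' = starRingEnd ℂ (cpolar t ψ) := by
    rw [cpolar, cpolar, hψ, map_mul, Complex.conj_ofReal]
  constructor
  · rw [rayOpIntegrand, rayOpIntegrand, hz, hR, hS, hg, hψ, ← map_mul, Complex.conj_im,
      Complex.conj_im]
    module
  · simp only [rayOpIntegrand]
    rw [hz, hR, hS, hg, hψ, mul_left_comm, ← map_mul, Complex.I_mul_im, Complex.I_mul_im,
      Complex.conj_re, Complex.conj_re, mul_left_comm, Complex.I_mul_im, Complex.I_mul_im]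

theorem integral_sub_integral_conj {𝔅 : Type*} [NormedRing 𝔅] [NormedAlgebra ℝ 𝔅]
    [CompleteSpace 𝔅] {ω φ : ℝ} {R S : ℂ → 𝔅} (h : IsSectorialResolvent ω φ R S)
    (hR : ∀ z, R (starRingEnd ℂ z) = R z) (hS : ∀ z, S (starRingEnd ℂ z) = S z) {g : ℂ → ℂ}
    (hg : IsSymbol g) (j : 𝔅) {ψ ψ' : ℝ} (hc : |Real.cos ψ| = Real.cos φ)
    (hψ : Complex.exp (ψ' * Complex.I) = starRingEnd ℂ (Complex.exp (ψ * Complex.I))) :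
    (∫ t in Ioi (0 : ℝ), (rayOpIntegrand R S g ψ t -
        rayOpIntegrand R S (fun z => Complex.I * g z) ψ t * j)) -
      (∫ t in Ioi (0 : ℝ), (rayOpIntegrand R S g ψ' t -
        rayOpIntegrand R S (fun z => Complex.I * g z) ψ' t * j)) =
      (2 : ℝ) • rayOp R S g ψ := by
  have h1 := h.integrableOn_rayOpIntegrand hg hc
  have h2 := (h.integrableOn_I_mul_rayOpIntegrand hg hc).mul_const j
  have he : ∀ t, rayOpIntegrand R S g ψ' t -
      rayOpIntegrand R S (fun z => Complex.I * g z) ψ' t * j = -rayOpIntegrand R S g ψ t -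
      rayOpIntegrand R S (fun z => Complex.I * g z) ψ t * j := fun t => by
    rw [(rayOpIntegrand_conj hR hS hg.conj hψ t).1, (rayOpIntegrand_conj hR hS hg.conj hψ t).2]
  simp only [he]
  have h3 : IntegrableOn (fun t => -rayOpIntegrand R S g ψ t) (Ioi 0) := h1.neg
  rw [integral_sub h1 h2, integral_sub h3 h2, integral_neg, rayOp]
  module

theorem one_div_two_mul_smul {M : Type*} [AddCommGroup M] [Module ℝ M] (r : ℝ) (a b : M) :
    (1 / (2 * r)) • ((2 : ℝ) • a - (2 : ℝ) • b) = (1 / r) • (a - b) := by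
  rw [← smul_sub, smul_smul]
  congr 1
  ring

theorem omegaCalculus_eq_symbolOp [CompleteSpace E] (hn : 1 ≤ n) {T : CMod n E →ₗ.[ℝ] CMod n E}
    {ω φ : ℝ} (hω : 0 < ω) (hωφ : ω < φ) (hφ : φ < Real.pi / 2) (hT : IsBisectorial T ω)
    {J : Cl n} (hJ : J ∈ sphere n) {F : Cl n → Cl n} {g : ℂ → ℂ} (hg : IsSymbol g)
    (hF : ∀ z : ℂ, z.re ≠ 0 → F (planeEmb J z) = planeEmb J (g z)) :
    omegaCalculus T J φ F = symbolOp (fun z => quadInv T z.re (‖z‖ ^ 2))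
      (fun z => opComp T (quadInv T z.re (‖z‖ ^ 2))) φ g := by
  have h := isSectorialResolvent_quadInv hn hω hωφ hφ hT
  have hcp := h.cos_pos
  have hR (z : ℂ) : quadInv T (starRingEnd ℂ z).re (‖starRingEnd ℂ z‖ ^ 2) =
      quadInv T z.re (‖z‖ ^ 2) := by rw [Complex.conj_re, Complex.norm_conj]
  have hS (z : ℂ) : opComp T (quadInv T (starRingEnd ℂ z).re (‖starRingEnd ℂ z‖ ^ 2)) =
      opComp T (quadInv T z.re (‖z‖ ^ 2)) := by rw [hR]
  have e1 : Complex.exp ((-φ : ℝ) * Complex.I) =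
      starRingEnd ℂ (Complex.exp (φ * Complex.I)) := by
    rw [← Complex.exp_conj, map_mul, Complex.conj_ofReal, Complex.conj_I]
    push_cast
    congr 1
    ring
  have e2 : Complex.exp ((Real.pi + φ : ℝ) * Complex.I) =
      starRingEnd ℂ (Complex.exp ((Real.pi - φ : ℝ) * Complex.I)) := by
    rw [exp_pi_sub_mul_I, map_neg, Complex.conj_conj]
    push_cast
    rw [add_mul, Complex.exp_add, Complex.exp_pi_mul_I, neg_one_mul]
  have k1 := integral_sub_integral_conj h hR hS hg (lmul J) h.abs_cos e1
  have k2 := integral_sub_integral_conj h hR hS hg (lmul J) h.abs_cos_pi_sub e2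
  rw [← rayIntegral_eq T hJ hcp.ne' hF, ← rayIntegral_eq T hJ (ψ := -φ)
    (by rw [Real.cos_neg]; exact hcp.ne') hF] at k1
  rw [← rayIntegral_eq T hJ (ψ := Real.pi - φ)
      (by rw [Real.cos_pi_sub]; exact neg_ne_zero.2 hcp.ne') hF,
    ← rayIntegral_eq T hJ (ψ := Real.pi + φ)
      (by rw [add_comm, Real.cos_add_pi]; exact neg_ne_zero.2 hcp.ne') hF] at k2
  -- The four rays form two conjugate pairs, `±φ` and `π ± φ`; each pair contributes twice a
  -- `rayOp`, which no longer contains `J`.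
  have hsum : rayIntegral T J (-φ) F - rayIntegral T J φ F + rayIntegral T J (Real.pi - φ) F
      - rayIntegral T J (Real.pi + φ) F =
      (rayIntegral T J (Real.pi - φ) F - rayIntegral T J (Real.pi + φ) F) -
        (rayIntegral T J φ F - rayIntegral T J (-φ) F) := by abel
  rw [omegaCalculus, hsum, k1, k2, symbolOp]
  exact one_div_two_mul_smul Real.pi _ _

theorem extCalculus_eq (hn : 1 ≤ n) (T : CMod n E →ₗ.[ℝ] CMod n E) {θ : ℝ} (hθ : 0 < θ)
    (J : Cl n) (φ : ℝ) {f : Cl n → Cl n} {c : Cl n × Cl n}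
    (hc : remainder f c.1 c.2 ∈ SHLzero n θ) :
    extCalculus T θ J φ f = lmul c.2 + quadInv T 0 1 ∘L lmul (c.1 - c.2)
      + omegaCalculus T J φ (remainder f c.1 c.2) := by
  have h : f ∈ SHLbnd n θ := ⟨c, hc⟩
  have hch : h.choose = c := coeff_unique hn hθ h.choose_spec hc
  rw [extCalculus, dif_pos h, hch]

/-! ### The regularizers -/

theorem regInfinity_planeEmb (k : ℕ) {J : Cl n} (hJ : J ∈ sphere n) {z : ℂ} (hz : z.re ≠ 0) :
    regInfinity k (planeEmb J z) = planeEmb J ((1 + z ^ 2)⁻¹ ^ (k + 1)) := by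
  rw [regInfinity, inv_pow, ← planeEmb_inv hJ (pow_ne_zero _ (one_add_sq_ne_zero hz)),
    planeEmb_pow hJ, planeEmb_add, planeEmb_one, planeEmb_pow hJ]

theorem regZero_planeEmb (k : ℕ) {J : Cl n} (hJ : J ∈ sphere n) {z : ℂ} (hz : z.re ≠ 0) :
    regZero k (planeEmb J z) = planeEmb J ((z * (1 + z ^ 2)⁻¹) ^ (k + 1)) := by
  have := regInfinity_planeEmb k hJ hz
  rw [regInfinity] at this
  rw [regZero, this, ← planeEmb_pow hJ, ← planeEmb_mul hJ, mul_pow]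

theorem remainder_regInfinity_planeEmb (k : ℕ) {J : Cl n} (hJ : J ∈ sphere n) {z : ℂ}
    (hz : z.re ≠ 0) : remainder (regInfinity k) ((1 : ℝ) • 1) ((0 : ℝ) • 1) (planeEmb J z) =
      planeEmb J ((1 + z ^ 2)⁻¹ ^ (k + 1) - (1 + z ^ 2)⁻¹) := by
  rw [remainder, regInfinity_planeEmb k hJ hz, inverse_one_add_sq_planeEmb hJ hz, planeEmb_sub]
  simp

theorem remainder_regZero_planeEmb (k : ℕ) {J : Cl n} (hJ : J ∈ sphere n) {z : ℂ}
    (hz : z.re ≠ 0) : remainder (regZero k) ((0 : ℝ) • 1) ((0 : ℝ) • 1) (planeEmb J z) =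
      planeEmb J ((z * (1 + z ^ 2)⁻¹) ^ (k + 1)) := by
  rw [remainder, regZero_planeEmb k hJ hz]
  simp

theorem mem_SHLzero_of_mem_Nzero {θ : ℝ} {f : Cl n → Cl n} (h : f ∈ Nzero n θ) :
    f ∈ SHLzero n θ := ⟨intrinsic_subset_SHL _ h.1, h.2⟩

theorem pow_injective {A : CMod n E →L[ℝ] CMod n E} (hA : Function.Injective A) (k : ℕ) :
    Function.Injective (A ^ k : CMod n E →L[ℝ] CMod n E) := by
  induction k with
  | zero => exact fun v w h => h
  | succ k ih =>
    rw [pow_succ]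
    exact ih.comp hA

theorem isQuadPair_zero_one [CompleteSpace E] (hn : 1 ≤ n)
    {T : CMod n E →ₗ.[ℝ] CMod n E} {ω : ℝ} (hω : 0 < ω) (hω2 : ω < Real.pi / 2)
    (hT : IsBisectorial T ω) :
    IsQuadPair T 0 1 (quadInv T 0 1) (opComp T (quadInv T 0 1)) := by
  have hI : Complex.I ∈ sectorCompl ω := by
    change |Complex.I.re| < Real.cos ω * ‖Complex.I‖
    simpa using cos_pos_of_lt hω hω2
  simpa using isQuadPair_of_mem_sectorCompl hn hω hω2 hT hI

theorem injective_extCalculus_regInfinity [CompleteSpace E] (hn : 1 ≤ n)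
    {T : CMod n E →ₗ.[ℝ] CMod n E} {ω θ φ : ℝ} (hω : 0 < ω) (hωφ : ω < φ) (hφθ : φ < θ)
    (hθ : θ < Real.pi / 2) (hT : IsBisectorial T ω) {J : Cl n} (hJ : J ∈ sphere n) (k : ℕ) :
    Function.Injective (extCalculus T θ J φ (regInfinity k)) := by
  have hθ0 : 0 < θ := hω.trans (hωφ.trans hφθ)
  have hφ := hφθ.trans hθ
  have h := isSectorialResolvent_quadInv hn hω hωφ hφ hT
  have hN := mem_Nzero_of_planeEmb hn hθ0 hθ (IsSymbol.inv_pow_sub_inv k)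
    (fun J hJ z hz => remainder_regInfinity_planeEmb k hJ hz)
  rw [extCalculus_eq hn T hθ0 J φ
    (c := ((1 : ℝ) • (1 : Cl n), (0 : ℝ) • (1 : Cl n))) (mem_SHLzero_of_mem_Nzero hN),
    omegaCalculus_eq_symbolOp hn hω hωφ hφ hT hJ (IsSymbol.inv_pow_sub_inv k)
      fun z hz => remainder_regInfinity_planeEmb k hJ hz, h.symbolOp_inv_pow_sub_inv]
  simp only [zero_smul, one_smul, sub_zero, lmul_zero, lmul_one, Complex.I_re, Complex.norm_I,
    one_pow, zero_add]
  change Function.Injective (quadInv T 0 1 * 1 + _ : CMod n E →L[ℝ] CMod n E)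
  -- The term `(1 + T²)⁻¹ (f_0 - f_∞)` with `f_0 = 1`, `f_∞ = 0` cancels the `-R` of the remainder,
  -- and `R ^ (k+1)` is left.
  rw [mul_one, add_sub_cancel]
  exact pow_injective (isQuadPair_zero_one hn hω (hωφ.trans hφ) hT).inv.injective _

theorem injective_extCalculus_regZero [CompleteSpace E] (hn : 1 ≤ n)
    {T : CMod n E →ₗ.[ℝ] CMod n E} {ω θ φ : ℝ} (hω : 0 < ω) (hωφ : ω < φ) (hφθ : φ < θ)
    (hθ : θ < Real.pi / 2) (hT : IsBisectorial T ω)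
    (hTi : Function.Injective fun v : T.domain => T v) {J : Cl n} (hJ : J ∈ sphere n) (k : ℕ) :
    Function.Injective (extCalculus T θ J φ (regZero k)) := by
  have hθ0 : 0 < θ := hω.trans (hωφ.trans hφθ)
  have hφ := hφθ.trans hθ
  have h := isSectorialResolvent_quadInv hn hω hωφ hφ hT
  have hN := mem_Nzero_of_planeEmb hn hθ0 hθ (IsSymbol.pow_div_one_add_sq k)
    (fun J hJ z hz => remainder_regZero_planeEmb k hJ hz)
  rw [extCalculus_eq hn T hθ0 J φ
    (c := ((0 : ℝ) • (1 : Cl n), (0 : ℝ) • (1 : Cl n))) (mem_SHLzero_of_mem_Nzero hN),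
    omegaCalculus_eq_symbolOp hn hω hωφ hφ hT hJ (IsSymbol.pow_div_one_add_sq k)
      fun z hz => remainder_regZero_planeEmb k hJ hz, h.symbolOp_pow_div_one_add_sq]
  simp only [zero_smul, sub_zero, lmul_zero, Complex.I_re, Complex.norm_I, one_pow, zero_add,
    ContinuousLinearMap.comp_zero]
  have hp := isQuadPair_zero_one hn hω (hωφ.trans hφ) hT
  -- Only `S = T R` has to be injective: `T` is injective by assumption, and `R` as an inverse.
  refine pow_injective (fun v w hvw => hp.inv.injective ?_) _
  have h1 := (LinearPMap.mem_graph_iff T).1 (hp.graph_fst v)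
  have h2 := (LinearPMap.mem_graph_iff T).1 (hp.graph_fst w)
  obtain ⟨x, hx, hx'⟩ := h1
  obtain ⟨y, hy, hy'⟩ := h2
  have : x = y := hTi (by simp only [hx', hy', hvw])
  simp only at hx hy
  rw [← hx, ← hy, this]

theorem mem_hInfty_graph_iff (T : CMod n E →ₗ.[ℝ] CMod n E) (θ : ℝ) (J : Cl n) (φ : ℝ)
    (g f : Cl n → Cl n) (hg : Function.Injective (extCalculus T θ J φ g)) (v w : CMod n E) :
    (v, w) ∈ (hInfty T θ J φ g f).graph ↔
      extCalculus T θ J φ g w = extCalculus T θ J φ (fun s => g s * f s) v := by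
  set A : CMod n E →ₗ.[ℝ] CMod n E := (extCalculus T θ J φ g).toLinearMap.toPMap ⊤ with hA
  set B : CMod n E →ₗ[ℝ] CMod n E := (extCalculus T θ J φ fun s => g s * f s).toLinearMap with hB
  have hker : A.toFun.ker = ⊥ := by
    rw [LinearMap.ker_eq_bot]
    intro x y hxy
    exact Subtype.ext (hg hxy)
  have h1 : (v, w) ∈ (hInfty T θ J φ g f).graph ↔ (B v, w) ∈ A.inverse.graph := by
    rw [LinearPMap.mem_graph_iff, LinearPMap.mem_graph_iff]
    constructor
    · rintro ⟨y, hy, hyw⟩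
      simp only at hy
      subst hy
      exact ⟨⟨B y, y.2⟩, rfl, hyw⟩
    · rintro ⟨y, hy, hyw⟩
      simp only at hy
      have hv : v ∈ A.inverse.domain.comap B := by
        rw [Submodule.mem_comap, ← hy]
        exact y.2
      have hyv : (⟨B v, hv⟩ : A.inverse.domain) = y := Subtype.ext hy.symm
      exact ⟨⟨v, hv⟩, rfl, (congrArg A.inverse hyv).trans hyw⟩
  rw [h1, LinearPMap.inverse_graph hker]
  constructor
  · rintro ⟨p, hp, hpe⟩
    obtain ⟨y, hy, hy'⟩ := (LinearPMap.mem_graph_iff A).1 hp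
    have e1 : p.2 = B v := congrArg Prod.fst hpe
    have e2 : p.1 = w := congrArg Prod.snd hpe
    rw [← e2, ← hy]
    exact hy'.trans e1
  · intro h
    refine ⟨(w, B v), (LinearPMap.mem_graph_iff A).2 ⟨⟨w, trivial⟩, rfl, h⟩, rfl⟩

/-! ### Regularization -/

/-- The coefficients of the product are `f0` and `0`, since the regularizer is `1` at `0` and the
product decays like `|s|⁻²` at infinity. -/
theorem regInfinity_mul_mem_SHLbnd (hn : 1 ≤ n) {θ : ℝ} (hθ0 : 0 < θ) (hθ : θ < Real.pi / 2)
    {f : Cl n → Cl n} (hf : f ∈ SHL (doubleSector n θ)) (k : ℕ) (C r : ℝ) (f0 : Cl n) (hr : 0 < r)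
    (hi : ∀ J ∈ sphere n, ∀ φ ∈ angles θ,
      IntegrableOn (fun t : ℝ => ‖f (polar J t φ) - f0‖ / t) (Ioo 0 r))
    (hb : ∀ s ∈ doubleSector n θ, ‖f s‖ ≤ C * (1 + ‖s‖ ^ k)) :
    (fun s => regInfinity k s * f s) ∈ SHLbnd n θ := by
  have hcp := cos_pos_of_lt hθ0 hθ
  set N : ℝ := 2 ^ n * 2 ^ n with hN
  have hN0 : 0 ≤ N := by positivity
  have hrem (J : Cl n) (hJ : J ∈ sphere n) (z : ℂ) (hz : z.re ≠ 0) :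
      remainder (fun s => regInfinity k s * f s) f0 0 (planeEmb J z) =
        planeEmb J ((1 + z ^ 2)⁻¹ ^ (k + 1)) * f (planeEmb J z) - planeEmb J (1 + z ^ 2)⁻¹ * f0 := by
    rw [remainder, regInfinity_planeEmb k hJ hz, inverse_one_add_sq_planeEmb hJ hz]
    simp
  have hdu : ∀ z : ℂ, z.re ≠ 0 → DifferentiableAt ℂ (fun z : ℂ => (1 + z ^ 2)⁻¹) z :=
    fun z hz => IsSymbol.differentiableAt_inv_one_add_sq hz
  have hcu (z : ℂ) : (1 + (starRingEnd ℂ z) ^ 2)⁻¹ = starRingEnd ℂ (1 + z ^ 2)⁻¹ := by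
    rw [conj_one_add_sq, map_inv₀]
  have hSHL : remainder (fun s => regInfinity k s * f s) f0 0 ∈ SHL (doubleSector n θ) := by
    obtain ⟨f₀, f₁, hs⟩ := hf
    have s1 := hs.intrinsic_mul (m := fun z => (1 + z ^ 2)⁻¹ ^ (k + 1)) hn hθ0 hθ
      (F := fun s => regInfinity k s * f s) (fun z hz => (hdu z hz).pow _)
      (fun z => by rw [hcu, map_pow]) fun J hJ z hz => by rw [regInfinity_planeEmb k hJ hz]
    have s2 := (isLeftSlice_const (doubleSector n θ) f0).intrinsic_mul
      (m := fun z => (1 + z ^ 2)⁻¹) hn hθ0 hθ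
      (F := fun s => Ring.inverse (1 + s ^ 2) * f0) hdu hcu
      fun J hJ z hz => by rw [inverse_one_add_sq_planeEmb hJ hz]
    have s3 := s1.sub hn hθ0 hθ s2
    have he : (fun s => regInfinity k s * f s - Ring.inverse (1 + s ^ 2) * f0) =
        remainder (fun s => regInfinity k s * f s) f0 0 := by
      funext s
      simp [remainder]
    rw [he] at s3
    exact ⟨_, _, s3⟩
  set c : ℝ := (Real.cos θ)⁻¹ with hc
  have hc0 : 0 < c := inv_pos.2 hcp
  have hub (z : ℂ) (hz : z ∈ csector θ) : ‖(1 + z ^ 2)⁻¹‖ ≤ c / (1 + ‖z‖ ^ 2) :=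
    norm_inv_one_add_sq_le hθ0 hθ hz
  have hpb (z : ℂ) (hz : z ∈ csector θ) :
      ‖(1 + z ^ 2)⁻¹ ^ (k + 1)‖ ≤ (c / (1 + ‖z‖ ^ 2)) ^ (k + 1) := by
    rw [norm_pow]
    exact pow_le_pow_left₀ (norm_nonneg _) (hub z hz) _
  refine ⟨(f0, 0), hSHL, ?_⟩
  refine boundedAndDini_of_norm_le_of_integrableOn hn hθ0 hθ hSHL
    (C := N * (c ^ (k + 1) * (2 * |C|)) + N * (c * ‖f0‖)) (by positivity) hr ?_ ?_
  · intro s hs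
    have hfs := hb s hs
    obtain ⟨J, hJ, z, hz, rfl⟩ := exists_planeEmb_of_mem_doubleSector hθ0 hθ hs
    rw [hrem J hJ z (re_ne_zero_of_lt hθ0 hθ hz)]
    rw [norm_planeEmb hJ] at hfs ⊢
    have hr0 : 0 ≤ ‖z‖ := norm_nonneg z
    set ρ : ℝ := 1 + ‖z‖ ^ 2 with hρ
    have hρ1 : 1 ≤ ρ := by nlinarith
    -- With `t = |s|`, both `1` and `t ^ k` are at most `ρ ^ k`. So `k` of the `k + 1` factors `1/ρ`
    -- absorb the growth of `f`, and one remains for decay.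
    have hfs2 : ‖f (planeEmb J z)‖ ≤ 2 * |C| * ρ ^ k := by
      have h1 : ‖z‖ ^ k ≤ ρ ^ k :=
        pow_le_pow_left₀ hr0 (by nlinarith [sq_nonneg (‖z‖ - 1)]) k
      have h2 : 1 ≤ ρ ^ k := one_le_pow₀ hρ1
      refine hfs.trans ((mul_le_mul_of_nonneg_right (le_abs_self C) (by positivity)).trans ?_)
      nlinarith [abs_nonneg C]
    have t1 : ‖planeEmb J ((1 + z ^ 2)⁻¹ ^ (k + 1)) * f (planeEmb J z)‖ ≤
        N * (c ^ (k + 1) * (2 * |C|)) / ρ := by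
      refine (norm_mul_cl_le _ _).trans ?_
      rw [norm_planeEmb hJ]
      calc N * (‖(1 + z ^ 2)⁻¹ ^ (k + 1)‖ * ‖f (planeEmb J z)‖)
          ≤ N * ((c / ρ) ^ (k + 1) * (2 * |C| * ρ ^ k)) := by
            gcongr
            exact hpb z hz.le
        _ = _ := by
            have : ρ ≠ 0 := by positivity
            rw [div_pow, pow_succ ρ]
            field_simp
    have t2 : ‖planeEmb J (1 + z ^ 2)⁻¹ * f0‖ ≤ N * (c * ‖f0‖) / ρ := by
      refine (norm_mul_cl_le _ _).trans ?_
      rw [norm_planeEmb hJ]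
      calc N * (‖(1 + z ^ 2)⁻¹‖ * ‖f0‖) ≤ N * (c / ρ * ‖f0‖) := by
            gcongr
            exact hub z hz.le
        _ = _ := by ring
    rw [add_div]
    exact (norm_sub_le _ _).trans (add_le_add t1 t2)
  · intro J hJ φ hφ
    obtain ⟨D, hD, hDb⟩ := (IsSymbol.inv_pow_sub_inv k).bound θ hθ0 hθ
    refine Integrable.mono' (g := fun t => N * c ^ (k + 1) * (‖f (polar J t φ) - f0‖ / t) +
      N * D * ‖f0‖) (((hi J hJ φ hφ).const_mul _).add ?_) ?_ ?_
    · exact integrableOn_const (by simp)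
    · exact ((continuousOn_norm_ray_div hn hθ0 hθ hSHL hJ hφ).mono
        Ioo_subset_Ioi_self).aestronglyMeasurable measurableSet_Ioo
    · refine (ae_restrict_iff' measurableSet_Ioo).2 (Filter.Eventually.of_forall fun t ht => ?_)
      have ht0 : 0 < t := ht.1
      have hz := abs_re_cpolar_gt hn hθ0 hθ ht0 hφ
      have hp : polar J t φ = planeEmb J (cpolar t φ) := polar_eq_planeEmb J t φ
      have hzn := norm_cpolar ht0.le φ
      set z := cpolar t φ
      -- Near `0` the first summand inherits the Dini condition from `f - f0`, and the second is
      -- `O(t)`, hence bounded after division by `t`.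
      have e : remainder (fun s => regInfinity k s * f s) f0 0 (polar J t φ) =
          planeEmb J ((1 + z ^ 2)⁻¹ ^ (k + 1)) * (f (polar J t φ) - f0) +
            planeEmb J ((1 + z ^ 2)⁻¹ ^ (k + 1) - (1 + z ^ 2)⁻¹) * f0 := by
        rw [hp, hrem J hJ z (re_ne_zero_of_lt hθ0 hθ hz), planeEmb_sub, mul_sub, sub_mul]
        abel
      have t1 : ‖planeEmb J ((1 + z ^ 2)⁻¹ ^ (k + 1)) * (f (polar J t φ) - f0)‖ ≤
          N * c ^ (k + 1) * ‖f (polar J t φ) - f0‖ := by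
        refine (norm_mul_cl_le _ _).trans ?_
        have h1 : ‖(1 + z ^ 2)⁻¹ ^ (k + 1)‖ ≤ c ^ (k + 1) :=
          (hpb z hz.le).trans (pow_le_pow_left₀ (by positivity)
            (div_le_self hc0.le (by nlinarith [sq_nonneg ‖z‖])) _)
        rw [norm_planeEmb hJ, mul_assoc N]
        exact mul_le_mul_of_nonneg_left (mul_le_mul_of_nonneg_right h1 (norm_nonneg _)) hN0
      have t2 : ‖planeEmb J ((1 + z ^ 2)⁻¹ ^ (k + 1) - (1 + z ^ 2)⁻¹) * f0‖ ≤
          N * D * ‖f0‖ * t := by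
        refine (norm_mul_cl_le _ _).trans ?_
        have h1 := hDb z hz.le
        rw [hzn] at h1
        have h2 : D * t / (1 + t ^ 2) ≤ D * t :=
          div_le_self (by positivity) (by nlinarith [sq_nonneg t])
        rw [norm_planeEmb hJ]
        calc N * (‖(1 + z ^ 2)⁻¹ ^ (k + 1) - (1 + z ^ 2)⁻¹‖ * ‖f0‖)
            ≤ N * (D * t * ‖f0‖) := by
              gcongr
              exact h1.trans h2
          _ = _ := by ring
      rw [norm_div, norm_norm, Real.norm_of_nonneg ht0.le, div_le_iff₀ ht0, e]
      refine (norm_add_le _ _).trans ((add_le_add t1 t2).trans (le_of_eq ?_))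
      field_simp

theorem regZero_mul_mem_SHLbnd (hn : 1 ≤ n) {θ : ℝ} (hθ0 : 0 < θ) (hθ : θ < Real.pi / 2)
    {f : Cl n → Cl n} (hf : f ∈ SHL (doubleSector n θ)) (k : ℕ) (C : ℝ)
    (hb : ∀ s ∈ doubleSector n θ, ‖f s‖ ≤ C * (1 / ‖s‖ ^ k + ‖s‖ ^ k)) :
    (fun s => regZero k s * f s) ∈ SHLbnd n θ := by
  have hcp := cos_pos_of_lt hθ0 hθ
  set N : ℝ := 2 ^ n * 2 ^ n with hN
  have hN0 : 0 ≤ N := by positivity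
  have hg := IsSymbol.pow_div_one_add_sq k
  have hSHL : (fun s => regZero k s * f s) ∈ SHL (doubleSector n θ) := by
    obtain ⟨f₀, f₁, hs⟩ := hf
    exact ⟨_, _, hs.intrinsic_mul (m := fun z => (z * (1 + z ^ 2)⁻¹) ^ (k + 1)) hn hθ0 hθ
      (F := fun s => regZero k s * f s) hg.differentiableAt hg.conj
      fun J hJ z hz => by rw [regZero_planeEmb k hJ hz]⟩
  have he : remainder (fun s => regZero k s * f s) 0 0 = fun s => regZero k s * f s := by
    funext s
    simp [remainder]
  refine ⟨(0, 0), ?_⟩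
  rw [he]
  refine ⟨hSHL, ?_⟩
  set c : ℝ := (Real.cos θ)⁻¹ with hc
  have hc0 : 0 < c := inv_pos.2 hcp
  refine boundedAndDini_of_norm_le hn hθ0 hθ hSHL (C := N * (c ^ (k + 1) * (2 * |C|)))
    (by positivity) fun s hs => ?_
  have hfs := hb s hs
  obtain ⟨J, hJ, z, hz, rfl⟩ := exists_planeEmb_of_mem_doubleSector hθ0 hθ hs
  have hre := re_ne_zero_of_lt hθ0 hθ hz
  rw [regZero_planeEmb k hJ hre]
  rw [norm_planeEmb hJ] at hfs ⊢
  have hr0 : 0 < ‖z‖ := norm_pos_iff.2 (by rintro rfl; simp at hre)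
  set t : ℝ := ‖z‖ with ht
  set ρ : ℝ := 1 + t ^ 2 with hρ
  have hρ0 : 0 < ρ := by positivity
  have hρ1 : 1 ≤ ρ := by nlinarith
  -- The factor `t ^ k` of the regularizer compensates `t ^ (-k)` at `0`, and `t ^ (2k) ≤ ρ ^ k`
  -- handles infinity. One factor `t / ρ` is left over, which gives boundedness and the Dini
  -- condition at both ends with zero coefficients.
  have hfs2 : t ^ k * ‖f (planeEmb J z)‖ ≤ 2 * |C| * ρ ^ k := by
    have h1 : t ^ k * t ^ k ≤ ρ ^ k := by
      rw [← mul_pow]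
      exact pow_le_pow_left₀ (by positivity) (by nlinarith) k
    have h2 : 1 ≤ ρ ^ k := one_le_pow₀ hρ1
    calc t ^ k * ‖f (planeEmb J z)‖ ≤ t ^ k * (|C| * (1 / t ^ k + t ^ k)) := by
          gcongr
          exact hfs.trans (mul_le_mul_of_nonneg_right (le_abs_self C) (by positivity))
      _ = |C| * (1 + t ^ k * t ^ k) := by field_simp
      _ ≤ |C| * (2 * ρ ^ k) := by gcongr; linarith
      _ = _ := by ring
  have hpb : ‖(z * (1 + z ^ 2)⁻¹) ^ (k + 1)‖ ≤ (t * (c / ρ)) ^ (k + 1) := by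
    rw [norm_pow, norm_mul]
    exact pow_le_pow_left₀ (by positivity)
      (mul_le_mul_of_nonneg_left (norm_inv_one_add_sq_le hθ0 hθ hz.le) hr0.le) _
  refine (norm_mul_cl_le _ _).trans ?_
  rw [norm_planeEmb hJ]
  calc N * (‖(z * (1 + z ^ 2)⁻¹) ^ (k + 1)‖ * ‖f (planeEmb J z)‖)
      ≤ N * ((t * (c / ρ)) ^ (k + 1) * ‖f (planeEmb J z)‖) := by gcongr
    _ = N * (c / ρ) ^ (k + 1) * t * (t ^ k * ‖f (planeEmb J z)‖) := by ring
    _ ≤ N * (c / ρ) ^ (k + 1) * t * (2 * |C| * ρ ^ k) := by gcongr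
    _ = _ := by
        rw [div_pow, pow_succ ρ]
        field_simp

end CliffordHInfty
end

/-! ### The proposition. -/

open CliffordHInfty in
theorem mainTheorem8 {n : ℕ} (hn : 1 ≤ n)
    {E : Type*} [NormedAddCommGroup E] [NormedSpace ℝ E] [CompleteSpace E]
    (T : CMod n E →ₗ.[ℝ] CMod n E) (ω θ : ℝ) (hω : 0 < ω) (hωθ : ω < θ) (hθ : θ < Real.pi / 2)
    (hT : IsBisectorial T ω) :
    (∀ f ∈ SHL (doubleSector n θ), ∀ (k : ℕ) (C r : ℝ) (f0 : Cl n), 0 < r →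
      (∀ J ∈ sphere n, ∀ φ ∈ angles θ,
        MeasureTheory.IntegrableOn (fun t : ℝ => ‖f (polar J t φ) - f0‖ / t) (Set.Ioo 0 r)) →
      (∀ s ∈ doubleSector n θ, ‖f s‖ ≤ C * (1 + ‖s‖ ^ k)) →
      f ∈ SHLreg T ω θ ∧ IsRegularizer T ω θ (regInfinity k) f ∧
      ∀ J ∈ sphere n, ∀ φ ∈ Set.Ioo ω θ, ∀ v w : CMod n E,
        (v, w) ∈ (hInfty T θ J φ (regInfinity k) f).graph ↔
          extCalculus T θ J φ (regInfinity k) w =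
            extCalculus T θ J φ (fun s => regInfinity k s * f s) v) ∧
    (Function.Injective (fun v : T.domain => T v) →
      ∀ f ∈ SHL (doubleSector n θ), ∀ (k : ℕ) (C : ℝ),
        (∀ s ∈ doubleSector n θ, ‖f s‖ ≤ C * (1 / ‖s‖ ^ k + ‖s‖ ^ k)) →
        f ∈ SHLreg T ω θ ∧ IsRegularizer T ω θ (regZero k) f ∧
        ∀ J ∈ sphere n, ∀ φ ∈ Set.Ioo ω θ, ∀ v w : CMod n E,
          (v, w) ∈ (hInfty T θ J φ (regZero k) f).graph ↔
            extCalculus T θ J φ (regZero k) w =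
              extCalculus T θ J φ (fun s => regZero k s * f s) v) := by
  have hθ0 : 0 < θ := hω.trans hωθ
  refine ⟨fun f hf k C r f0 hr hi hb => ?_, fun hTi f hf k C hb => ?_⟩
  · have hreg : IsRegularizer T ω θ (regInfinity k) f :=
      { mem_Nbnd := ⟨1, 0, mem_Nzero_of_planeEmb hn hθ0 hθ (IsSymbol.inv_pow_sub_inv k)
          fun J hJ z hz => remainder_regInfinity_planeEmb k hJ hz⟩
        mul_mem := regInfinity_mul_mem_SHLbnd hn hθ0 hθ hf k C r f0 hr hi hb
        injective := fun J hJ φ hφ =>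
          injective_extCalculus_regInfinity hn hω hφ.1 hφ.2 hθ hT hJ k }
    exact ⟨⟨hf, _, hreg⟩, hreg, fun J hJ φ hφ v w =>
      mem_hInfty_graph_iff T θ J φ _ f (hreg.injective J hJ φ hφ) v w⟩
  · have hreg : IsRegularizer T ω θ (regZero k) f :=
      { mem_Nbnd := ⟨0, 0, mem_Nzero_of_planeEmb hn hθ0 hθ (IsSymbol.pow_div_one_add_sq k)
          fun J hJ z hz => remainder_regZero_planeEmb k hJ hz⟩
        mul_mem := regZero_mul_mem_SHLbnd hn hθ0 hθ hf k C hb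
        injective := fun J hJ φ hφ =>
          injective_extCalculus_regZero hn hω hφ.1 hφ.2 hθ hT hTi hJ k }
    exact ⟨⟨hf, _, hreg⟩, hreg, fun J hJ φ hφ v w =>
      mem_hInfty_graph_iff T θ J φ _ f (hreg.injective J hJ φ hφ) v w⟩
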